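/- Let $p$ be an odd prime. For nonzero $x=p^sa$, $y=p^tb\in\mathbb{Q}_p$ ($a,b$ units) let $(x,y)_p=\left(\frac{-1}{p}\right)^{st}\left(\frac{a}{p}\right)^{t}\left(\frac{b}{p}\right)^{s}$ be the Hilbert symbol. For $g=\begin{pmatrix}a&b\\c&d\end{pmatrix}\in \mathrm{SL}_2(\mathbb{Q}_p)$ put $\tau(g)=c$ if $c\ne0$, $\tau(g)=d$ if $c=0$; put $s_p(g)=(c,d)_p$ if $cd\neq0$ and $\mathrm{ord}_p(c)$ is odd, $s_p(g)=1$ otherwise. Let $\widetilde{\mathrm{SL}}_2(\mathbb{Q}_p)=\mathrm{SL}_2(\mathbb{Q}_p)\times\{\pm1\}$ be the double cover with group law $(g,\epsilon_1)(h,\epsilon_2)=(gh,\epsilon_1\epsilon_2\sigma_p(g,h))$, $\sigma_p(g,h)=(\tau(gh)\tau(g),\tau(gh)\tau(h))_p\,s_p(g)s_p(h)s_p(gh)$, with its usual locally compact group topology (for which the images of the principal congruence subgroups of level $p^n$, $n\ge1$, under $k\mapsto(k,1)$ are a neighbourhood basis of the identity). Let $K_0=\left\{\begin{pmatrix}a&b\\c&d\end{pmatrix}\in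 \mathrm{SL}_2(\mathbb{Z}_p): c\in p\mathbb{Z}_p\right\}$, and let $S=\overline{K_0}$ be its full inverse image in the double cover. Let $\gamma$ be either the trivial character or the Legendre character $\left(\frac{\cdot}{p}\right)$ of $(\mathbb{Z}/p\mathbb{Z})^\times$, and denote also by $\gamma$ the genuine character $\gamma(A,\epsilon)=\epsilon\,\gamma(a \bmod p)$ of $S$, where $a$ is the upper left entry of $A\in K_0$. Let $H(S,\gamma)$ be the space of locally constant compactly supported functions $f:\widetilde{\mathrm{SL}}_2(\mathbb{Q}_p)\to\mathbb{C}$ with $f(kgk')=\overline{\gamma}(k)\overline{\gamma}(k')f(g)$ for all $g$ and all $k,k'\in S$; it is a unital $\mathbb{C}$-algebra under the convolution $(f_1*f_2)(h)=\int f_1(g)f_2(g^{-1}h)\,dg$, where $dg$ is the Haar measure with $\mathrm{vol}(S)=1$, with identity element $\overline{\gamma}$ on $S$, extended by $0$. Let $\varepsilon_p=1$ if $p\equiv1\pmod 4$ and $\varepsilon_p=i$ if $p\equiv3\pmod4$, and let $w(t)=\begin{pmatrix}0&t\\-t^{-1}&0\end{pmatrix}$. Let $\mathcal{U}_0$ and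 $\mathcal{U}_1$ be the elements of $H(S,\gamma)$ supported respectively on $S(w(1),1)S$ and $S(w(p^{-1}),1)S$ and given there, for $k,k'\in S$, by $$\mathcal{U}_0(k(w(1),1)k')=\overline{\gamma}(k)\overline{\gamma}(k'),\qquad \mathcal{U}_1(k(w(p^{-1}),1)k')=\overline{\gamma}(k)\,\overline{\varepsilon_p}\left(\tfrac{-1}{p}\right)\overline{\gamma}(k').$$ Then the genuine Iwahori Hecke algebra $H(S,\gamma)$ is generated as a $\mathbb{C}$-algebra by $\mathcal{U}_0$ and $\mathcal{U}_1$, with defining relations $$\mathcal{U}_0^2=(p-1)\,\mathcal{U}_0+p,\qquad \mathcal{U}_1^2=p\qquad\text{if }\gamma\text{ is trivial},$$ $$\mathcal{U}_0^2=\left(\tfrac{-1}{p}\right)p,\qquad \mathcal{U}_1^2=\varepsilon_p(p-1)\,\mathcal{U}_1+\left(\tfrac{-1}{p}\right)p\qquad\text{if }\gamma=\left(\tfrac{\cdot}{p}\right).$$ That is, mapping the generators to $\mathcal{U}_0$, $\mathcal{U}_1$ defines an isomorphism onto $H(S,\gamma)$ from the associative unital $\mathbb{C}$-algebra presented by two generators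 and these two relations. -/

import Mathlib

open MeasureTheory

open scoped MatrixGroups

namespace MetaSL2

noncomputable section

/-! ### The Hilbert symbol on the `p`-adic numbers, `p` odd -/

section HilbertSymbol

variable {p : ℕ} [Fact p.Prime]

/-- An element of `ℚ_p` of norm at most one, seen as a `p`-adic integer. -/
def toInt (x : ℚ_[p]) (h : ‖x‖ ≤ 1) : ℤ_[p] := ⟨x, h⟩

/-- Reduction modulo `p` of a `p`-adic integer (and `0` on non-integral elements). -/
def residue (x : ℚ_[p]) : ZMod p :=
  if h : ‖x‖ ≤ 1 then PadicInt.toZMod (toInt x h) else 0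

/-- The unit `u` in the decomposition `x = p ^ n * u`, `n = ord_p x`, of a nonzero `x`. -/
def unitPart (x : ℚ_[p]) : ℚ_[p] := x * (p : ℚ_[p]) ^ (-x.valuation)

/-- The Legendre symbol `(u / p)` of the unit part `u` of a nonzero `p`-adic number. -/
def legUnit (x : ℚ_[p]) : ℤˣ :=
  open Classical in if IsSquare (residue (unitPart x)) then 1 else -1

/-- The Hilbert symbol of `ℚ_p` for odd `p`: for units `a`, `b`,
`(p ^ s * a, p ^ t * b)_p = (-1 / p) ^ (s * t) * (a / p) ^ t * (b / p) ^ s`. -/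
def hilb (x y : ℚ_[p]) : ℤˣ :=
  legUnit (-1 : ℚ_[p]) ^ (x.valuation * y.valuation) *
    legUnit x ^ y.valuation * legUnit y ^ x.valuation

lemma residue_mul {x y : ℚ_[p]} (hx : ‖x‖ ≤ 1) (hy : ‖y‖ ≤ 1) :
    residue (x * y) = residue x * residue y := by
  have hxy : ‖x * y‖ ≤ 1 := by
    rw [norm_mul]; exact mul_le_one₀ hx (norm_nonneg _) hy
  rw [residue, residue, residue, dif_pos hx, dif_pos hy, dif_pos hxy, ← map_mul]
  rfl

lemma residue_eq_zero_iff {x : ℚ_[p]} (hx : ‖x‖ ≤ 1) : residue x = 0 ↔ ‖x‖ < 1 := by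
  rw [residue, dif_pos hx, ← RingHom.mem_ker, PadicInt.ker_toZMod,
    IsLocalRing.mem_maximalIdeal, PadicInt.mem_nonunits]
  rfl

lemma residue_eq_one {x : ℚ_[p]} (hx : ‖x - 1‖ < 1) : residue x = 1 := by
  have h1 : ‖x‖ ≤ 1 := by
    have : x = (x - 1) + 1 := by ring
    rw [this]
    refine (Padic.nonarchimedean _ _).trans (max_le hx.le ?_)
    simp
  have h2 : toInt x h1 - 1 ∈ RingHom.ker (PadicInt.toZMod (p := p)) := by
    rw [PadicInt.ker_toZMod, IsLocalRing.mem_maximalIdeal, PadicInt.mem_nonunits]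
    exact hx
  rw [residue, dif_pos h1]
  rw [RingHom.mem_ker, map_sub, map_one, sub_eq_zero] at h2
  exact h2

lemma p_ne : (p : ℚ_[p]) ≠ 0 := by
  exact_mod_cast (Fact.out : p.Prime).ne_zero

lemma norm_unitPart {x : ℚ_[p]} (hx : x ≠ 0) : ‖unitPart x‖ = 1 := by
  have hp : (p : ℝ) ≠ 0 := by exact_mod_cast (Fact.out : p.Prime).ne_zero
  rw [unitPart, norm_mul, Padic.norm_eq_zpow_neg_valuation hx, Padic.norm_p_zpow, ← zpow_add₀ hp]
  simp

lemma unitPart_mul {x y : ℚ_[p]} (hx : x ≠ 0) (hy : y ≠ 0) :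
    unitPart (x * y) = unitPart x * unitPart y := by
  rw [unitPart, unitPart, unitPart, Padic.valuation_mul hx hy, neg_add, zpow_add₀ p_ne]
  ring

lemma legUnit_coe {x : ℚ_[p]} (hx : x ≠ 0) :
    (legUnit x : ℤ) = quadraticChar (ZMod p) (residue (unitPart x)) := by
  have h0 : residue (unitPart x) ≠ 0 := by
    rw [Ne, residue_eq_zero_iff (norm_unitPart hx).le, norm_unitPart hx]
    exact lt_irrefl _
  rw [legUnit, quadraticChar_apply, quadraticCharFun, if_neg h0]
  split_ifs <;> rfl

lemma legUnit_mul {x y : ℚ_[p]} (hx : x ≠ 0) (hy : y ≠ 0) :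
    legUnit (x * y) = legUnit x * legUnit y := by
  ext
  rw [legUnit_coe (mul_ne_zero hx hy), Units.val_mul, legUnit_coe hx, legUnit_coe hy,
    unitPart_mul hx hy, residue_mul (norm_unitPart hx).le (norm_unitPart hy).le, map_mul]

lemma norm_one_of_near {x : ℚ_[p]} (h : ‖x - 1‖ < 1) : ‖x‖ = 1 := by
  have h1 := residue_eq_one h
  have h2 : ‖x‖ ≤ 1 := by
    by_contra h3
    rw [residue, dif_neg h3] at h1
    exact zero_ne_one h1
  refine le_antisymm h2 (not_lt.1 fun h3 => ?_)
  rw [(residue_eq_zero_iff h2).2 h3] at h1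
  exact zero_ne_one h1

lemma valuation_zero_of_norm_one {x : ℚ_[p]} (h : ‖x‖ = 1) : x.valuation = 0 := by
  have hx : x ≠ 0 := by rintro rfl; simp at h
  have hp : (1 : ℝ) < p := by exact_mod_cast (Fact.out : p.Prime).one_lt
  rw [Padic.norm_eq_zpow_neg_valuation hx] at h
  have := (zpow_eq_one_iff_right₀ (by positivity) hp.ne').1 h
  omega

lemma legUnit_near {x : ℚ_[p]} (h : ‖x - 1‖ < 1) : legUnit x = 1 := by
  have hv := valuation_zero_of_norm_one (norm_one_of_near h)
  rw [legUnit, unitPart, hv]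
  simp [residue_eq_one h]

lemma hilb_comm (x y : ℚ_[p]) : hilb x y = hilb y x := by
  rw [hilb, hilb, mul_comm x.valuation, mul_right_comm]

lemma hilb_mul_left {x y : ℚ_[p]} (z : ℚ_[p]) (hx : x ≠ 0) (hy : y ≠ 0) :
    hilb (x * y) z = hilb x z * hilb y z := by
  simp only [hilb, legUnit_mul hx hy, Padic.valuation_mul hx hy, mul_zpow, add_mul, zpow_add]
  ac_rfl

lemma hilb_mul_right {x y : ℚ_[p]} (z : ℚ_[p]) (hx : x ≠ 0) (hy : y ≠ 0) :
    hilb z (x * y) = hilb z x * hilb z y := by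
  rw [hilb_comm, hilb_mul_left z hx hy, hilb_comm x, hilb_comm y]

lemma hilb_one_left (x : ℚ_[p]) : hilb 1 x = 1 := by
  have : legUnit (1 : ℚ_[p]) = 1 := legUnit_near (by simp)
  simp [hilb, this]

lemma hilb_one_right (x : ℚ_[p]) : hilb x 1 = 1 := by rw [hilb_comm, hilb_one_left]

lemma sq_one (u : ℤˣ) : u * u = 1 := Int.units_mul_self u

lemma hilb_inv_left {x : ℚ_[p]} (z : ℚ_[p]) (hx : x ≠ 0) : hilb x⁻¹ z = hilb x z := by
  have h := hilb_mul_left z (inv_ne_zero hx) hx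
  rw [inv_mul_cancel₀ hx, hilb_one_left] at h
  rw [← mul_one (hilb x⁻¹ z), ← sq_one (hilb x z), ← mul_assoc, ← h, one_mul]

lemma hilb_inv_right {x : ℚ_[p]} (z : ℚ_[p]) (hx : x ≠ 0) : hilb z x⁻¹ = hilb z x := by
  rw [hilb_comm, hilb_inv_left z hx, hilb_comm]

lemma hilb_add_one_aux {x y : ℚ_[p]} (h : x + y = 1) (hv : ‖x‖ < 1) : hilb x y = 1 := by
  have h1 : ‖y - 1‖ < 1 := by
    have : y - 1 = -x := by rw [← h]; ring
    rwa [this, norm_neg]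
  rw [hilb, valuation_zero_of_norm_one (norm_one_of_near h1), legUnit_near h1]
  simp

/-- The Steinberg relation. -/
lemma hilb_add_one {x y : ℚ_[p]} (hx : x ≠ 0) (h : x + y = 1) : hilb x y = 1 := by
  rcases lt_trichotomy ‖x‖ 1 with hx1 | hx1 | hx1
  · exact hilb_add_one_aux h hx1
  · rcases lt_or_ge ‖y‖ 1 with hy1 | hy1
    · rw [hilb_comm]; exact hilb_add_one_aux (by rw [← h]; ring) hy1
    · have hy2 : ‖y‖ = 1 := by
        refine le_antisymm ?_ hy1
        have : y = 1 - x := by rw [← h]; ring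
        rw [this, sub_eq_add_neg]
        refine (Padic.nonarchimedean _ _).trans (max_le (by simp) ?_)
        rw [norm_neg, hx1]
      rw [hilb, valuation_zero_of_norm_one hx1, valuation_zero_of_norm_one hy2]
      simp
  · have hn : (-1 : ℚ_[p]) ≠ 0 := by simp
    have hu : ‖(1 - x⁻¹) - 1‖ < 1 := by
      have : (1 - x⁻¹) - 1 = -x⁻¹ := by ring
      rw [this, norm_neg, norm_inv]
      exact inv_lt_one_of_one_lt₀ hx1
    have hu0 : 1 - x⁻¹ ≠ 0 := by
      intro h0
      rw [h0] at hu
      simp at hu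
    have e : y = -1 * x * (1 - x⁻¹) := by
      rw [← eq_sub_iff_add_eq'] at h
      rw [h]; field_simp; ring
    have hvn : (-1 : ℚ_[p]).valuation = 0 := valuation_zero_of_norm_one (by simp)
    have hl : legUnit y = legUnit (-1 : ℚ_[p]) * legUnit x := by
      rw [e, legUnit_mul (mul_ne_zero hn hx) hu0, legUnit_mul hn hx, legUnit_near hu, mul_one]
    have hvy : y.valuation = x.valuation := by
      rw [e, Padic.valuation_mul (mul_ne_zero hn hx) hu0, Padic.valuation_mul hn hx, hvn,
        valuation_zero_of_norm_one (norm_one_of_near hu)]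
      simp
    rw [hilb, hl, hvy, mul_zpow]
    have h2 : legUnit (-1 : ℚ_[p]) ^ (x.valuation * x.valuation) *
        legUnit (-1 : ℚ_[p]) ^ x.valuation = 1 := by
      rw [← zpow_add]
      have : Even (x.valuation * x.valuation + x.valuation) := by
        have := Int.even_mul_succ_self x.valuation
        rwa [mul_add, mul_one] at this
      obtain ⟨k, hk⟩ := this
      rw [hk, zpow_add, sq_one]
    have h3 := sq_one (legUnit x ^ x.valuation)
    generalize legUnit (-1 : ℚ_[p]) ^ (x.valuation * x.valuation) = a at *
    generalize legUnit (-1 : ℚ_[p]) ^ x.valuation = b at *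
    generalize legUnit x ^ x.valuation = c at *
    calc a * c * (b * c) = (a * b) * (c * c) := by ac_rfl
      _ = 1 := by rw [h2, h3, one_mul]

lemma hilb_neg_self {x : ℚ_[p]} (hx : x ≠ 0) : hilb x (-x) = 1 := by
  by_cases h1 : x = 1
  · rw [h1, hilb_one_left]
  have h2 : (1 - x) ≠ 0 := sub_ne_zero.2 (Ne.symm h1)
  have h3 : (1 - x⁻¹) ≠ 0 := by
    intro h; apply h1; rw [sub_eq_zero] at h
    rw [← inv_inv x, ← h, inv_one]
  have e : -x = (1 - x) * (1 - x⁻¹)⁻¹ := by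
    have h4 : x - 1 ≠ 0 := sub_ne_zero.2 h1
    field_simp
    ring
  rw [e, hilb_mul_right x h2 (inv_ne_zero h3), hilb_inv_right x h3,
    hilb_add_one hx (by ring), ← hilb_inv_left _ hx,
    hilb_add_one (inv_ne_zero hx) (by ring), mul_one]

end HilbertSymbol

/-! ### The double cover of `SL(2, ℚ_p)` -/

section Cover

set_option linter.unusedSimpArgs false

variable {p : ℕ} [Fact p.Prime]

/-- `τ(g) = c` if `c ≠ 0` and `τ(g) = d` otherwise, `(c, d)` being the second row of `g`. -/
def tau (g : SL(2, ℚ_[p])) : ℚ_[p] :=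
  open Classical in if g 1 0 ≠ 0 then g 1 0 else g 1 1

/-- `s_p(g) = (c, d)_p` if `c * d ≠ 0` and `ord_p c` is odd, and `s_p(g) = 1` otherwise. -/
def sFactor (g : SL(2, ℚ_[p])) : ℤˣ :=
  open Classical in
  if g 1 0 * g 1 1 ≠ 0 ∧ Odd (g 1 0).valuation then hilb (g 1 0) (g 1 1) else 1

/-- The first factor of the cocycle. -/
def kub (g h : SL(2, ℚ_[p])) : ℤˣ := hilb (tau (g * h) * tau g) (tau (g * h) * tau h)

/-- The `2`-cocycle
`σ_p(g, h) = (τ(gh) τ(g), τ(gh) τ(h))_p * s_p(g) * s_p(h) * s_p(gh)`. -/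
def sigma (g h : SL(2, ℚ_[p])) : ℤˣ := kub g h * sFactor g * sFactor h * sFactor (g * h)

lemma tau_ne_zero (g : SL(2, ℚ_[p])) : tau g ≠ 0 := by
  rw [tau]
  split_ifs with h
  · exact h
  · intro h1
    have := g.det_coe
    rw [Matrix.det_fin_two, h1, not_not.1 h] at this
    simp at this

/-- The matrix `x(s) = (1, s; 0, 1)`. -/
def xMat (s : ℚ_[p]) : SL(2, ℚ_[p]) := ⟨!![1, s; 0, 1], by simp [Matrix.det_fin_two]⟩

/-- The matrix `h(t) = (t, 0; 0, t⁻¹)`. -/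
def hMat (t : ℚ_[p]) (ht : t ≠ 0) : SL(2, ℚ_[p]) :=
  ⟨!![t, 0; 0, t⁻¹], by simp [Matrix.det_fin_two, ht]⟩

/-- The matrix `w(t) = (0, t; -t⁻¹, 0)`. -/
def wMat (t : ℚ_[p]) (ht : t ≠ 0) : SL(2, ℚ_[p]) :=
  ⟨!![0, t; -t⁻¹, 0], by simp [Matrix.det_fin_two, ht]⟩

lemma tau_one : tau (1 : SL(2, ℚ_[p])) = 1 := by simp [tau]

lemma hilb_mul_self {y : ℚ_[p]} (x : ℚ_[p]) (hy : y ≠ 0) : hilb x (y * y) = 1 := by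
  rw [hilb_mul_right x hy hy, sq_one]

lemma kub_one_left (g : SL(2, ℚ_[p])) : kub 1 g = 1 := by
  rw [kub, one_mul, tau_one, mul_one, hilb_mul_self _ (tau_ne_zero g)]

lemma sigma_one_left (g : SL(2, ℚ_[p])) : sigma 1 g = 1 := by
  have h : sFactor (1 : SL(2, ℚ_[p])) = 1 := by simp [sFactor]
  rw [sigma, kub_one_left, h, one_mul, one_mul, one_mul, sq_one]

/-- `g` satisfies the cocycle identity against all pairs. -/
def Coc (g : SL(2, ℚ_[p])) : Prop :=
  ∀ h k, kub g h * kub (g * h) k = kub g (h * k) * kub h k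

lemma coc_alg {e A B C D F G H I J : ℤˣ} (h1 : e * A = F * G) (h2 : e * C = H * I)
    (h3 : F * B = H * J) (h4 : G * J = I * D) : A * B = C * D := by
  apply mul_left_cancel (a := e * F)
  calc e * F * (A * B) = (e * A) * (F * B) := by ac_rfl
    _ = (F * H) * (G * J) := by rw [h1, h3]; ac_rfl
    _ = (H * I) * (F * D) := by rw [h4]; ac_rfl
    _ = e * F * (C * D) := by rw [← h2]; ac_rfl

lemma coc_mul {g g' : SL(2, ℚ_[p])} (hg : Coc g) (hg' : Coc g') : Coc (g * g') := by
  intro h k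
  have h1 := hg g' h
  have h2 := hg g' (h * k)
  have h3 := hg (g' * h) k
  have h4 := hg' h k
  rw [mul_assoc] at h3
  simp only [mul_assoc] at h1 h2 h3 h4 ⊢
  exact coc_alg h1 h2 h3 h4

lemma mul_entry (g h : SL(2, ℚ_[p])) (i j : Fin 2) :
    (g * h) i j = g i 0 * h 0 j + g i 1 * h 1 j := by
  rw [Matrix.SpecialLinearGroup.coe_mul, Matrix.mul_apply, Fin.sum_univ_two]

lemma tau_of_ne {g : SL(2, ℚ_[p])} (h : g 1 0 ≠ 0) : tau g = g 1 0 := by rw [tau, if_pos h]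

lemma tau_of_eq {g : SL(2, ℚ_[p])} (h : g 1 0 = 0) : tau g = g 1 1 := by
  rw [tau, if_neg (not_not.2 h)]

lemma tau_x_mul (s : ℚ_[p]) (g : SL(2, ℚ_[p])) : tau (xMat s * g) = tau g := by
  have e : ∀ j, (xMat s * g) 1 j = g 1 j := by
    intro j; rw [mul_entry]; simp [xMat]
  rw [tau, tau, e, e]

lemma tau_h_mul (t : ℚ_[p]) (ht : t ≠ 0) (g : SL(2, ℚ_[p])) :
    tau (hMat t ht * g) = t⁻¹ * tau g := by
  have e : ∀ j, (hMat t ht * g) 1 j = t⁻¹ * g 1 j := by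
    intro j; rw [mul_entry]; simp [hMat]
  by_cases h : g 1 0 = 0
  · rw [tau_of_eq h, tau_of_eq (by rw [e, h, mul_zero]), e]
  · rw [tau_of_ne h, tau_of_ne (by rw [e]; exact mul_ne_zero (inv_ne_zero ht) h), e]

lemma kub_x (s : ℚ_[p]) (g : SL(2, ℚ_[p])) : kub (xMat s) g = 1 := by
  have : tau (xMat s) = 1 := by simp [tau, xMat]
  rw [kub, tau_x_mul, this, mul_one, hilb_mul_self _ (tau_ne_zero g)]

lemma coc_x (s : ℚ_[p]) : Coc (xMat s) := by
  intro h k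
  rw [kub_x, kub_x, kub, kub, mul_assoc, tau_x_mul, tau_x_mul]

lemma coc_h (t : ℚ_[p]) (ht : t ≠ 0) : Coc (hMat t ht) := by
  intro h k
  have ht' := inv_ne_zero ht
  have e : tau (hMat t ht) = t⁻¹ := by simp [tau, hMat]
  have hh := tau_ne_zero h
  have hk := tau_ne_zero k
  have hhk := tau_ne_zero (h * k)
  simp only [kub, mul_assoc, tau_h_mul, e]
  simp only [hilb_mul_left, hilb_mul_right, hilb_inv_left, hilb_inv_right, ne_eq, ht, ht', hh, hk,
    hhk, not_false_eq_true, mul_eq_zero, or_self, hilb_comm _ t]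
  generalize hilb t t = a1
  generalize hilb t (tau h) = a2
  generalize hilb t (tau k) = a3
  generalize hilb t (tau (h * k)) = a4
  rcases Int.units_eq_one_or a1 with rfl | rfl <;> rcases Int.units_eq_one_or a2 with rfl | rfl <;>
    rcases Int.units_eq_one_or a3 with rfl | rfl <;>
    rcases Int.units_eq_one_or a4 with rfl | rfl <;> simp

lemma hilb_self {m x : ℚ_[p]} (hm : m = -1) (hx : x ≠ 0) : hilb x x = hilb m x := by
  have h := hilb_neg_self hx
  rw [neg_eq_neg_one_mul, hilb_mul_right x (by simp) hx, ← hm] at h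
  rw [hilb_comm m, ← mul_one (hilb x m), ← sq_one (hilb x x), ← mul_assoc, h, one_mul]

lemma sq_cancel (u v : ℤˣ) : u * (u * v) = v := by rw [← mul_assoc, sq_one, one_mul]

lemma hilb_steinberg {x y : ℚ_[p]} (hx : x ≠ 0) (hxy : x + y ≠ 0) :
    hilb (x * (x + y)⁻¹) (y * (x + y)⁻¹) = 1 :=
  hilb_add_one (mul_ne_zero hx (inv_ne_zero hxy)) (by field_simp)

lemma symb_w {m a c A C x2 y2 x23 y23 x3 : ℚ_[p]} (hm : m = -1) (hx3 : x3 ≠ 0)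
    (hac : a ≠ 0 ∨ c ≠ 0) (hAC : A ≠ 0 ∨ C ≠ 0)
    (hx2 : (c ≠ 0 ∧ x2 = c) ∨ (c = 0 ∧ x2 = a⁻¹)) (hy2 : (a ≠ 0 ∧ y2 = m * a) ∨ (a = 0 ∧ y2 = c⁻¹))
    (hx23 : (C ≠ 0 ∧ x23 = C) ∨ (C = 0 ∧ x23 = A⁻¹))
    (hy23 : (A ≠ 0 ∧ y23 = m * A) ∨ (A = 0 ∧ y23 = C⁻¹))
    (h3 : (x3 = a * C + m * c * A) ∨ (a = x3 * A ∧ c = x3 * C)) :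
    hilb (y2 * m) (y2 * x2) * hilb (y23 * y2) (y23 * x3) =
      hilb (y23 * m) (y23 * x23) * hilb (x23 * x2) (x23 * x3) := by
  have hm0 : m ≠ 0 := by simp [hm]
  rcases h3 with h3 | ⟨ha, hc⟩
  · by_cases ha : a = 0
    · subst ha
      obtain ⟨-, rfl⟩ := hy2.resolve_left (by simp)
      have hc := hac.resolve_left (by simp)
      obtain ⟨-, rfl⟩ := hx2.resolve_right (by simp [hc])
      have hA : A ≠ 0 := by rintro rfl; simp at h3; exact hx3 h3
      obtain ⟨-, rfl⟩ := hy23.resolve_right (by simp [hA])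
      rw [zero_mul, zero_add] at h3
      subst h3
      rcases hx23 with ⟨hC, rfl⟩ | ⟨rfl, rfl⟩
      · simp only [hilb_mul_left, hilb_mul_right, hilb_inv_left, hilb_inv_right, ne_eq, mul_eq_zero,
          inv_eq_zero, or_self, not_false_eq_true, hm0, hc, hA, hC, hilb_self hm hc, hilb_self hm hA, hilb_self hm hC, mul_assoc, mul_comm, mul_left_comm, hilb_comm,
          sq_one, sq_cancel, mul_one, one_mul]
      · simp only [hilb_mul_left, hilb_mul_right, hilb_inv_left, hilb_inv_right, ne_eq, mul_eq_zero,
          inv_eq_zero, or_self, not_false_eq_true, hm0, hc, hA, hilb_self hm hc, hilb_self hm hA, mul_assoc, mul_comm, mul_left_comm, hilb_comm,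
          sq_one, sq_cancel, mul_one, one_mul]
    · obtain ⟨-, rfl⟩ := hy2.resolve_right (by simp [ha])
      by_cases hc : c = 0
      · subst hc
        obtain ⟨-, rfl⟩ := hx2.resolve_left (by simp)
        have hC : C ≠ 0 := by rintro rfl; simp at h3; exact hx3 h3
        obtain ⟨-, rfl⟩ := hx23.resolve_right (by simp [hC])
        rw [mul_zero, zero_mul, add_zero] at h3
        subst h3
        rcases hy23 with ⟨hA, rfl⟩ | ⟨rfl, rfl⟩
        · simp only [hilb_mul_left, hilb_mul_right, hilb_inv_left, hilb_inv_right, ne_eq, mul_eq_zero,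
            inv_eq_zero, or_self, not_false_eq_true, hm0, ha, hA, hC, hilb_self hm ha, hilb_self hm hA, hilb_self hm hC, mul_assoc, mul_comm, mul_left_comm, hilb_comm,
            sq_one, sq_cancel, mul_one, one_mul]
        · simp only [hilb_mul_left, hilb_mul_right, hilb_inv_left, hilb_inv_right, ne_eq, mul_eq_zero,
            inv_eq_zero, or_self, not_false_eq_true, hm0, ha, hC, hilb_self hm ha, hilb_self hm hC, mul_assoc, mul_comm, mul_left_comm, hilb_comm,
            sq_one, sq_cancel, mul_one, one_mul]
      · obtain ⟨-, rfl⟩ := hx2.resolve_right (by simp [hc])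
        rcases hy23 with ⟨hA, rfl⟩ | ⟨rfl, rfl⟩
        · rcases hx23 with ⟨hC, rfl⟩ | ⟨rfl, rfl⟩
          · have hst := hilb_steinberg (x := a * x23) (y := m * x2 * A) (mul_ne_zero ha hC)
              (by rw [← h3]; exact hx3)
            rw [← h3] at hst
            clear h3
            rw [← mul_one (_ * _), ← hst]
            simp only [hilb_mul_left, hilb_mul_right, hilb_inv_left, hilb_inv_right, ne_eq, mul_eq_zero,
              inv_eq_zero, or_self, not_false_eq_true, hm0, ha, hc, hA, hC, hx3, hilb_self hm ha, hilb_self hm hc, hilb_self hm hA, hilb_self hm hC, hilb_self hm hx3, mul_assoc, mul_comm, mul_left_comm, hilb_comm,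
              sq_one, sq_cancel, mul_one, one_mul]
          · rw [mul_zero, zero_add] at h3
            subst h3
            simp only [hilb_mul_left, hilb_mul_right, hilb_inv_left, hilb_inv_right, ne_eq, mul_eq_zero,
              inv_eq_zero, or_self, not_false_eq_true, hm0, ha, hc, hA, hilb_self hm ha, hilb_self hm hc, hilb_self hm hA, mul_assoc, mul_comm, mul_left_comm, hilb_comm,
              sq_one, sq_cancel, mul_one, one_mul]
        · have hC := hAC.resolve_left (by simp)
          obtain ⟨-, rfl⟩ := hx23.resolve_right (by simp [hC])
          rw [mul_zero, add_zero] at h3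
          subst h3
          simp only [hilb_mul_left, hilb_mul_right, hilb_inv_left, hilb_inv_right, ne_eq, mul_eq_zero,
            inv_eq_zero, or_self, not_false_eq_true, hm0, ha, hc, hC, hilb_self hm ha, hilb_self hm hc, hilb_self hm hC, mul_assoc, mul_comm, mul_left_comm, hilb_comm,
            sq_one, sq_cancel, mul_one, one_mul]
  · subst ha hc
    simp only [mul_eq_zero, ne_eq, hx3, false_or] at hx2 hy2
    rcases hy23 with ⟨hA, rfl⟩ | ⟨rfl, rfl⟩
    · obtain ⟨-, rfl⟩ := hy2.resolve_right (by simp [hA])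
      rcases hx23 with ⟨hC, rfl⟩ | ⟨rfl, rfl⟩
      · obtain ⟨-, rfl⟩ := hx2.resolve_right (by simp [hC])
        simp only [hilb_mul_left, hilb_mul_right, hilb_inv_left, hilb_inv_right, ne_eq, mul_eq_zero,
          inv_eq_zero, or_self, not_false_eq_true, hm0, hA, hC, hx3, hilb_self hm hA, hilb_self hm hC, hilb_self hm hx3, mul_assoc, mul_comm, mul_left_comm, hilb_comm,
          sq_one, sq_cancel, mul_one, one_mul]
      · obtain ⟨-, rfl⟩ := hx2.resolve_left (by simp)
        simp only [hilb_mul_left, hilb_mul_right, hilb_inv_left, hilb_inv_right, ne_eq, mul_eq_zero,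
          inv_eq_zero, or_self, not_false_eq_true, hm0, hA, hx3, hilb_self hm hA, hilb_self hm hx3, mul_assoc, mul_comm, mul_left_comm, hilb_comm,
          sq_one, sq_cancel, mul_one, one_mul]
    · have hC := hAC.resolve_left (by simp)
      obtain ⟨-, rfl⟩ := hx23.resolve_right (by simp [hC])
      obtain ⟨-, rfl⟩ := hy2.resolve_left (by simp)
      obtain ⟨-, rfl⟩ := hx2.resolve_right (by simp [hC])
      simp only [hilb_mul_left, hilb_mul_right, hilb_inv_left, hilb_inv_right, ne_eq, mul_eq_zero,
        inv_eq_zero, or_self, not_false_eq_true, hm0, hC, hx3, hilb_self hm hC, hilb_self hm hx3, mul_assoc, mul_comm, mul_left_comm, hilb_comm,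
        sq_one, sq_cancel, mul_one, one_mul]

lemma coc_w : Coc (wMat (1 : ℚ_[p]) one_ne_zero) := by
  intro h k
  have e : tau (wMat (1 : ℚ_[p]) one_ne_zero) = -1 := by simp [tau, wMat]
  have dh := h.det_coe
  have dhk := (h * k).det_coe
  have dk := k.det_coe
  rw [Matrix.det_fin_two] at dh dhk dk
  have e00 := mul_entry h k 0 0
  have e01 := mul_entry h k 0 1
  have e10 := mul_entry h k 1 0
  have e11 := mul_entry h k 1 1
  have tw : ∀ g : SL(2, ℚ_[p]), (g 0 0 ≠ 0 ∧ tau (wMat 1 one_ne_zero * g) = -1 * g 0 0) ∨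
      (g 0 0 = 0 ∧ tau (wMat 1 one_ne_zero * g) = (g 1 0)⁻¹) := by
    intro g
    have dg := g.det_coe
    rw [Matrix.det_fin_two] at dg
    have ew : ∀ j, (wMat (1 : ℚ_[p]) one_ne_zero * g : SL(2, ℚ_[p])) 1 j = -1 * g 0 j := by
      intro j; rw [mul_entry]; simp [wMat]
    by_cases h0 : g 0 0 = 0
    · refine Or.inr ⟨h0, ?_⟩
      rw [h0, zero_mul, zero_sub] at dg
      rw [tau_of_eq (by rw [ew, h0, mul_zero]), ew]
      exact eq_inv_of_mul_eq_one_left (by linear_combination dg)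
    · refine Or.inl ⟨h0, ?_⟩
      rw [tau_of_ne (by rw [ew]; simpa using h0), ew]
  have tx : ∀ g : SL(2, ℚ_[p]), (g 1 0 ≠ 0 ∧ tau g = g 1 0) ∨
      (g 1 0 = 0 ∧ tau g = (g 0 0)⁻¹) := by
    intro g
    have dg := g.det_coe
    rw [Matrix.det_fin_two] at dg
    by_cases h0 : g 1 0 = 0
    · refine Or.inr ⟨h0, ?_⟩
      rw [h0, mul_zero, sub_zero] at dg
      rw [tau_of_eq h0]
      exact eq_inv_of_mul_eq_one_left (by linear_combination dg)
    · exact Or.inl ⟨h0, tau_of_ne h0⟩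
  have nz : ∀ g : SL(2, ℚ_[p]), g 0 0 ≠ 0 ∨ g 1 0 ≠ 0 := by
    intro g
    have dg := g.det_coe
    rw [Matrix.det_fin_two] at dg
    by_contra! h0
    rw [h0.1, h0.2] at dg
    simp at dg
  simp only [kub, mul_assoc, e]
  refine symb_w rfl (tau_ne_zero k) (nz h) (nz (h * k)) (tx h) (tw h) (tx (h * k)) (tw (h * k)) ?_
  rcases tx k with ⟨h0, h1⟩ | ⟨h0, h1⟩
  · left
    rw [h1, e00, e10]
    linear_combination -(k 1 0) * dh
  · right
    rw [h1, e00, e10, h0]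
    rw [h0, mul_zero, sub_zero] at dk
    have : k 0 0 ≠ 0 := by
      intro h2
      rw [h2, zero_mul] at dk
      exact zero_ne_one dk
    constructor <;> field_simp <;> ring

lemma coc_all (g : SL(2, ℚ_[p])) : Coc g := by
  have dg := g.det_coe
  rw [Matrix.det_fin_two] at dg
  by_cases h0 : g 1 0 = 0
  · rw [h0, mul_zero, sub_zero] at dg
    have h1 : g 0 0 ≠ 0 := by
      intro h2
      rw [h2, zero_mul] at dg
      exact zero_ne_one dg
    have : g = xMat (g 0 0 * g 0 1) * hMat (g 0 0) h1 := by
      ext i j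
      rw [mul_entry]
      fin_cases i <;> fin_cases j <;> simp [xMat, hMat, h0]
      · field_simp
      · exact eq_inv_of_mul_eq_one_right dg
    rw [this]
    exact coc_mul (coc_x _) (coc_h _ _)
  · have h1 : -(g 1 0)⁻¹ ≠ 0 := by simp [h0]
    have : g = xMat (g 0 0 * (g 1 0)⁻¹) * (hMat (-(g 1 0)⁻¹) h1 *
        (wMat 1 one_ne_zero * xMat (g 1 1 * (g 1 0)⁻¹))) := by
      ext i j
      simp only [mul_entry]
      fin_cases i <;> fin_cases j <;> simp [xMat, hMat, wMat, h0]
      · field_simp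
        linear_combination -dg
      · field_simp
    rw [this]
    exact coc_mul (coc_x _) (coc_mul (coc_h _ _) (coc_mul coc_w (coc_x _)))

/-- The cocycle identity. -/
lemma sigma_cocycle (g h k : SL(2, ℚ_[p])) :
    sigma g h * sigma (g * h) k = sigma g (h * k) * sigma h k := by
  have H := coc_all g h k
  simp only [sigma, ← mul_assoc g h k]
  generalize sFactor (g * h * k) = s1
  generalize sFactor (g * h) = s2
  generalize sFactor (h * k) = s3
  have h2 := sq_one s2
  have h3 := sq_one s3
  rw [mul_assoc] at *
  generalize sFactor g = t1 at *
  generalize sFactor h = t2 at *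
  generalize sFactor k = t3 at *
  generalize kub (g * h) k = k1 at *
  generalize kub g h = k2 at *
  generalize kub h k = k3 at *
  generalize kub g (h * k) = k4 at *
  calc _ = (k2 * k1) * (s2 * s2) * (t1 * t2 * t3 * s1) := by ac_rfl
    _ = (k4 * k3) * (s3 * s3) * (t1 * t2 * t3 * s1) := by rw [H, h2, h3]
    _ = _ := by ac_rfl

end Cover

/-- The double cover of `SL(2, ℚ_p)` (`p` odd): the set `SL(2, ℚ_p) × {1, -1}`. -/
@[ext]
structure Mp (p : ℕ) [Fact p.Prime] where
  /-- the underlying matrix -/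
  mat : SL(2, ℚ_[p])
  /-- the sign -/
  sgn : ℤˣ

namespace Mp

variable {p : ℕ} [Fact p.Prime]

/-- `(g, ε₁) (h, ε₂) = (g h, ε₁ ε₂ σ_p(g, h))`. -/
instance : Mul (Mp p) := ⟨fun g h => ⟨g.mat * h.mat, g.sgn * h.sgn * sigma g.mat h.mat⟩⟩

instance : One (Mp p) := ⟨⟨1, 1⟩⟩

instance : Inv (Mp p) := ⟨fun g => ⟨g.mat⁻¹, g.sgn * sigma g.mat⁻¹ g.mat⟩⟩

lemma mul_def (g h : Mp p) : g * h = ⟨g.mat * h.mat, g.sgn * h.sgn * sigma g.mat h.mat⟩ := rfl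

lemma one_def : (1 : Mp p) = ⟨1, 1⟩ := rfl

lemma inv_def (g : Mp p) : g⁻¹ = ⟨g.mat⁻¹, g.sgn * sigma g.mat⁻¹ g.mat⟩ := rfl

instance : Group (Mp p) :=
  Group.ofLeftAxioms
    (by
      intro g h k
      simp only [mul_def, mul_assoc, mk.injEq, true_and]
      have H := sigma_cocycle g.mat h.mat k.mat
      generalize sigma g.mat h.mat = a at *
      generalize sigma (g.mat * h.mat) k.mat = b at *
      generalize sigma g.mat (h.mat * k.mat) = c at *
      generalize sigma h.mat k.mat = d at *
      calc _ = g.sgn * h.sgn * k.sgn * (a * b) := by ac_rfl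
        _ = _ := by rw [H]; ac_rfl)
    (by
      intro g
      simp only [mul_def, one_def, sigma_one_left, one_mul, mul_one])
    (by
      intro g
      simp only [mul_def, one_def, inv_def, inv_mul_cancel, mk.injEq, true_and]
      generalize sigma g.mat⁻¹ g.mat = a
      rw [mul_right_comm g.sgn a g.sgn, sq_one, one_mul, sq_one])

/-- The projection of the double cover to `SL(2, ℚ_p)`. -/
def proj : Mp p →* SL(2, ℚ_[p]) where
  toFun := mat
  map_one' := rfl
  map_mul' _ _ := rfl

/-- The set of the `(k, 1)`, where `k ∈ SL(2, ℤ_p)` is congruent to `1` modulo `p ^ n`. -/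
def congruenceNhd (n : ℕ) : Set (Mp p) :=
  {k | k.sgn = 1 ∧ ∀ i j, ‖(k.mat i j : ℚ_[p]) - (1 : SL(2, ℚ_[p])) i j‖ ≤ (p : ℝ) ^ (-(n : ℤ))}

/-- The topology of the double cover. For odd `p` and `n ≥ 1`, the section `k ↦ (k, 1)` is a
homomorphism on the principal congruence subgroup of level `p ^ n`, and the left translates of the
images of these subgroups form a basis of the topology. -/
instance : TopologicalSpace (Mp p) :=
  TopologicalSpace.generateFrom
    {U | ∃ (g : Mp p) (n : ℕ), 1 ≤ n ∧ U = (fun k => g * k) '' congruenceNhd n}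

instance : MeasurableSpace (Mp p) := borel (Mp p)

instance : BorelSpace (Mp p) := ⟨rfl⟩

end Mp

/-! ### The genuine Iwahori Hecke algebra -/

section HeckeAlgebra

variable {p : ℕ} [Fact p.Prime]

/-- The Iwahori subgroup `K_0^p(p)` of `SL(2, ℤ_p)`: integral entries, and `c ∈ p ℤ_p`. -/
def iwahori (p : ℕ) [Fact p.Prime] : Subgroup SL(2, ℚ_[p]) where
  carrier := {g | (∀ i j, ‖(g i j : ℚ_[p])‖ ≤ 1) ∧ ‖(g 1 0 : ℚ_[p])‖ < 1}
  mul_mem' := by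
    rintro g h ⟨hg, hg'⟩ ⟨hh, hh'⟩
    refine ⟨fun i j => ?_, ?_⟩
    · rw [mul_entry]
      refine (Padic.nonarchimedean _ _).trans (max_le ?_ ?_) <;> rw [norm_mul] <;>
        exact mul_le_one₀ (hg _ _) (norm_nonneg _) (hh _ _)
    · rw [mul_entry]
      refine (Padic.nonarchimedean _ _).trans_lt (max_lt ?_ ?_) <;> rw [norm_mul]
      · exact mul_lt_one_of_nonneg_of_lt_one_left (norm_nonneg _) hg' (hh _ _)
      · exact mul_lt_one_of_nonneg_of_lt_one_right (hg _ _) (norm_nonneg _) hh'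
  one_mem' := by
    refine ⟨fun i j => ?_, ?_⟩
    · fin_cases i <;> fin_cases j <;> simp
    · simp
  inv_mem' := by
    rintro g ⟨hg, hg'⟩
    refine ⟨fun i j => ?_, ?_⟩
    · rw [Matrix.SpecialLinearGroup.coe_inv, Matrix.adjugate_fin_two]
      fin_cases i <;> fin_cases j <;> simp [hg]
    · rw [Matrix.SpecialLinearGroup.coe_inv, Matrix.adjugate_fin_two]
      simpa using hg'

/-- The complete inverse image `S` of the Iwahori subgroup in the double cover. -/
def iwahoriCover (p : ℕ) [Fact p.Prime] : Subgroup (Mp p) := (iwahori p).comap Mp.proj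

/-- The genuine character `γ(A, ε) = ε * γ(a mod p)` of the inverse image of the Iwahori subgroup,
for a character `γ` of `(ℤ/p)ˣ`; here `a` is the upper left entry of `A`. -/
def genuineChar (γ : MulChar (ZMod p) ℂ) (k : Mp p) : ℂ :=
  ((k.sgn : ℤ) : ℂ) * γ (residue (k.mat 0 0))

/-- `H(S, γ)`: the locally constant compactly supported functions `f` with
`f(k g k') = conj γ(k) * conj γ(k') * f(g)` for `k`, `k'` in `S`. -/
def heckeSpace (γ : MulChar (ZMod p) ℂ) : Submodule ℂ (Mp p → ℂ) where
  carrier := {f | IsLocallyConstant f ∧ HasCompactSupport f ∧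
    ∀ g : Mp p, ∀ k ∈ iwahoriCover p, ∀ k' ∈ iwahoriCover p,
      f (k * g * k') = (starRingEnd ℂ) (genuineChar γ k) * (starRingEnd ℂ) (genuineChar γ k') * f g}
  add_mem' := by
    rintro f f' ⟨h1, h2, h3⟩ ⟨h1', h2', h3'⟩
    refine ⟨h1.add h1', h2.add h2', fun g k hk k' hk' => ?_⟩
    rw [Pi.add_apply, Pi.add_apply, h3 g k hk k' hk', h3' g k hk k' hk', mul_add]
  zero_mem' := by
    refine ⟨IsLocallyConstant.const 0, HasCompactSupport.zero, fun g k hk k' hk' => by simp⟩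
  smul_mem' := by
    rintro c f ⟨h1, h2, h3⟩
    refine ⟨h1.comp (fun z => c • z), h2.comp_left (smul_zero c), fun g k hk k' hk' => ?_⟩
    rw [Pi.smul_apply, Pi.smul_apply, h3 g k hk k' hk', smul_eq_mul, smul_eq_mul]
    ring

/-- The convolution `(f₁ * f₂)(h) = ∫ f₁(g) f₂(g⁻¹ h) dg`. -/
def conv (μ : Measure (Mp p)) (f₁ f₂ : Mp p → ℂ) : Mp p → ℂ :=
  fun h => ∫ g, f₁ g * f₂ (g⁻¹ * h) ∂μ

open Classical in
/-- The identity element of `H(S, γ)`: it is `conj γ` on `S` and `0` elsewhere. -/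
def heckeOne (γ : MulChar (ZMod p) ℂ) : Mp p → ℂ :=
  fun g => if g ∈ iwahoriCover p then (starRingEnd ℂ) (genuineChar γ g) else 0

/-- `ε_p = 1` if `p ≡ 1 mod 4`, and `ε_p = i` if `p ≡ 3 mod 4`. -/
def epsilonP (p : ℕ) : ℂ := if p % 4 = 1 then 1 else Complex.I

/-- The value of the extended character `γ` at `(w(t), 1)`: for `t = p ^ n * u`, `u` a unit, it is
`1` if `n` is even and `ε_p * (-u / p)` if `n` is odd. -/
def gammaW (t : ℚ_[p]) : ℂ :=
  if Even t.valuation then 1 else epsilonP p * ((legUnit (-t) : ℤ) : ℂ)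

/-- The element `(w(p ^ (-n)), 1)` of the double cover. -/
def wElt (p : ℕ) [Fact p.Prime] (n : ℤ) : Mp p :=
  ⟨wMat ((p : ℚ_[p]) ^ (-n)) (zpow_ne_zero _ p_ne), 1⟩

/-- `f` is the function `𝒰_n`: it is supported on the double coset of `(w(p ^ (-n)), 1)`, and there
`𝒰_n(k (w(p ^ (-n)), 1) k') = conj γ(k) * conj γ((w(p ^ (-n)), 1)) * conj γ(k')`. -/
def IsHeckeU (γ : MulChar (ZMod p) ℂ) (n : ℤ) (f : Mp p → ℂ) : Prop :=
  (∀ k ∈ iwahoriCover p, ∀ k' ∈ iwahoriCover p,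
    f (k * wElt p n * k') = (starRingEnd ℂ) (genuineChar γ k) *
      (starRingEnd ℂ) (gammaW ((p : ℚ_[p]) ^ (-n))) * (starRingEnd ℂ) (genuineChar γ k')) ∧
  ∀ g, (∀ k ∈ iwahoriCover p, ∀ k' ∈ iwahoriCover p, g ≠ k * wElt p n * k') → f g = 0

end HeckeAlgebra

/-! ### The presented algebra -/

/-- The relations `u₀ ^ 2 = a₀ u₀ + b₀` and `u₁ ^ 2 = a₁ u₁ + b₁` in the free algebra on two
generators `u₀`, `u₁`. -/
inductive QuadRel (a b : Fin 2 → ℂ) : FreeAlgebra ℂ (Fin 2) → FreeAlgebra ℂ (Fin 2) → Prop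
  | rel (i : Fin 2) : QuadRel a b (FreeAlgebra.ι ℂ i * FreeAlgebra.ι ℂ i)
      (a i • FreeAlgebra.ι ℂ i + algebraMap ℂ (FreeAlgebra ℂ (Fin 2)) (b i))

/-- The algebra with generators `u₀`, `u₁` and defining relations
`u₀ ^ 2 = a₀ u₀ + b₀`, `u₁ ^ 2 = a₁ u₁ + b₁`. -/
abbrev QuadAlg (a b : Fin 2 → ℂ) : Type := RingQuot (QuadRel a b)

/-- The generators `u₀`, `u₁`. -/
def QuadAlg.gen (a b : Fin 2 → ℂ) (i : Fin 2) : QuadAlg a b :=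
  RingQuot.mkAlgHom ℂ (QuadRel a b) (FreeAlgebra.ι ℂ i)

/-- The space `H(S, γ)`, with the convolution for the measure `μ`, is a `ℂ`-algebra, generated by
`𝒰_0` and `𝒰_1` with the defining relations `𝒰_0 ^ 2 = a₀ 𝒰_0 + b₀` and `𝒰_1 ^ 2 = a₁ 𝒰_1 + b₁`:
there is an isomorphism of algebras from the presented algebra, mapping `u₀`, `u₁` to these. -/
def HasPresentation {p : ℕ} [Fact p.Prime] (μ : Measure (Mp p)) (γ : MulChar (ZMod p) ℂ)
    (a b : Fin 2 → ℂ) : Prop :=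
  ∃ Φ : QuadAlg a b ≃ₗ[ℂ] heckeSpace γ,
    (∀ x y, (Φ (x * y) : Mp p → ℂ) = conv μ (Φ x) (Φ y)) ∧
    (Φ 1 : Mp p → ℂ) = heckeOne γ ∧
    IsHeckeU γ 0 (Φ (QuadAlg.gen a b 0)) ∧
    IsHeckeU γ 1 (Φ (QuadAlg.gen a b 1))

/-- The Legendre character `(· / p)` of `(ℤ/p)ˣ`, with complex values. -/
def legendreChar (p : ℕ) [Fact p.Prime] : MulChar (ZMod p) ℂ :=
  (quadraticChar (ZMod p)).ringHomComp (Int.castRingHom ℂ)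

end

end MetaSL2

namespace MetaSL2

noncomputable section

/-! ### The Hecke algebra of a group, a subgroup and a character -/

section CosetConvolution

variable {G : Type*} [Group G] {S : Subgroup G}

/-! Since S is open and compact of volume 1, an equivariant function that is locally constant with
compact support is the same thing as an equivariant function supported on finitely many left cosets
of S. Integrals over the group become finite sums over G/S (`mem_heckeSpace_iff`,
`conv_eq_cosetConv`). The algebra can therefore be studied for an abstract group, subgroup and
character.

The double cosets of S are indexed by the infinite dihedral affine Weyl group, represented by h(p^j)
and w(p^j). If left multiplication by w(1) or w(p⁻¹) increases length, it carries a double coset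
into a single double coset, and convolution with the corresponding generator then does not kill
functions (`RankOne.conv_apply_mul`). So each alternating word in the two generators is nonzero and
lives on exactly one double coset, and the words form a basis of the Hecke algebra
(`DihedralCosets.linearIndependent_intWord`, `DihedralCosets.span_intWord`). In the abstract algebra
with two quadratic relations the alternating words already span (`QuadAlg.span_intWord`), so once
the relations hold the natural map is an isomorphism.

What remains is a rank one computation for each generator (`RankOne.conv_self`). If S w S is the
union of q cosets r_i w S, w² = z ∈ S, and the function takes the value λ at w, then its square has
constant term q λ² χ(z⁻¹) and linear coefficient λ ∑ c_i, where c_i is the value of χ on the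
S-factors of w⁻¹ r_i⁻¹ w in S w S. Here q = p. For w(1) everything takes place in SL(2, ℤ_p), over
which the cover splits (`sigma_maxCompact`), and c_b = γ(-1)γ(b). For w(p⁻¹) the cocycle contributes
a Legendre symbol, c_b = (b/p)γ(b) (`wOne_conj`, `lift_xMat_eq`), and a sign (-1/p) in z, which ε_p²
= (-1/p) cancels. Orthogonality of characters modulo p then gives the coefficients: the two
generators exchange roles as γ passes from trivial to Legendre. -/

/-- The set of left cosets of `S` which meet the support of `f`. -/
def cosetSupport (S : Subgroup G) (f : G → ℂ) : Set (G ⧸ S) :=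
  QuotientGroup.mk '' Function.support f

/-- Convolution of functions on `G`, as a sum over the left cosets of `S`. -/
def cosetConv (S : Subgroup G) (f₁ f₂ : G → ℂ) (h : G) : ℂ :=
  ∑' x : G ⧸ S, f₁ x.out * f₂ (x.out⁻¹ * h)

lemma apply_out {F : G → ℂ} (hF : ∀ g, ∀ k : S, F (g * k) = F g) (g : G) :
    F ((g : G ⧸ S).out) = F g := by
  obtain ⟨k, hk⟩ := QuotientGroup.mk_out_eq_mul S g
  rw [hk, hF]

/-- Left translation permutes the cosets, and right invariance makes the choice of representatives
irrelevant. This plays the role of left invariance of Haar measure. -/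
lemma tsum_out_translate {F : G → ℂ} (hF : ∀ g, ∀ k : S, F (g * k) = F g) (a : G) :
    ∑' x : G ⧸ S, F x.out = ∑' x : G ⧸ S, F (a * x.out) := by
  rw [← (MulAction.toPerm a : Equiv.Perm (G ⧸ S)).tsum_eq]
  refine tsum_congr fun x => ?_
  rw [← apply_out hF (a * x.out)]
  congr 2
  conv_lhs => rw [← QuotientGroup.out_eq' x]
  rfl

/-- The functions on `G` which are biequivariant for the character `χ` of `S` and supported on
finitely many cosets of `S`. -/
def heckeModule (χ : S →* ℂ) : Submodule ℂ (G → ℂ) where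
  carrier := {f | (∀ g, ∀ k k' : S, f (k * g * k') = χ k * χ k' * f g) ∧
    (cosetSupport S f).Finite}
  add_mem' := by
    rintro f f' ⟨h1, h2⟩ ⟨h1', h2'⟩
    refine ⟨fun g k k' => by simp only [Pi.add_apply, h1, h1', mul_add], (h2.union h2').subset ?_⟩
    rw [cosetSupport, cosetSupport, cosetSupport, ← Set.image_union]
    exact Set.image_mono (Function.support_add f f')
  zero_mem' := ⟨fun g k k' => by simp, by simp [cosetSupport]⟩
  smul_mem' := by
    rintro c f ⟨h1, h2⟩
    refine ⟨fun g k k' => ?_, h2.subset (Set.image_mono (Function.support_const_smul_subset c f))⟩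
    simp only [Pi.smul_apply, h1, smul_eq_mul]
    ring

variable {χ : S →* ℂ}

lemma char_mul_inv (χ : S →* ℂ) (k : S) : χ k * χ k⁻¹ = 1 := by
  rw [← map_mul, mul_inv_cancel, map_one]

lemma char_ne_zero (χ : S →* ℂ) (k : S) : χ k ≠ 0 :=
  left_ne_zero_of_mul_eq_one (char_mul_inv χ k)

namespace heckeModule

lemma apply_mul_left {f : G → ℂ} (hf : f ∈ heckeModule χ) (k : S) (g : G) :
    f (k * g) = χ k * f g := by
  have := hf.1 g k 1
  simpa using this

lemma apply_mul_right {f : G → ℂ} (hf : f ∈ heckeModule χ) (g : G) (k : S) :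
    f (g * k) = χ k * f g := by
  have := hf.1 g 1 k
  simpa using this

/-- The factor χ(k) from the first function cancels χ(k⁻¹) from the second, so the summand descends
to G/S and the representatives chosen in `cosetConv` do not matter. -/
lemma conv_summand {f₁ f₂ : G → ℂ} (h₁ : f₁ ∈ heckeModule χ) (h₂ : f₂ ∈ heckeModule χ) (h g : G)
    (k : S) : f₁ (g * k) * f₂ ((g * k)⁻¹ * h) = f₁ g * f₂ (g⁻¹ * h) := by
  have e : (g * k)⁻¹ * h = ((k⁻¹ : S) : G) * (g⁻¹ * h) := by simp [mul_assoc]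
  rw [e, apply_mul_right h₁, apply_mul_left h₂]
  linear_combination (f₁ g * f₂ (g⁻¹ * h)) * char_mul_inv χ k

/-- A pair (y, x) is recovered from y and the coset of y⁻¹x, each of which ranges over a finite set.
This gives both closure under convolution and the interchange of sums in associativity. -/
lemma finite_conv_support {f₁ f₂ : G → ℂ} (h₁ : (cosetSupport S f₁).Finite)
    (h₂ : (cosetSupport S f₂).Finite) :
    {q : (G ⧸ S) × (G ⧸ S) | f₁ q.1.out ≠ 0 ∧ f₂ (q.1.out⁻¹ * q.2.out) ≠ 0}.Finite := by
  refine ((h₁.prod h₂).image fun q => (q.1, q.1.out • q.2)).subset ?_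
  rintro ⟨y, x⟩ ⟨hy, hx⟩
  refine ⟨(y, ((y.out⁻¹ * x.out : G) : G ⧸ S)), ⟨⟨_, hy, QuotientGroup.out_eq' y⟩, ⟨_, hx, rfl⟩⟩, ?_⟩
  refine Prod.ext rfl ?_
  change ((y.out * (y.out⁻¹ * x.out) : G) : G ⧸ S) = x
  rw [mul_inv_cancel_left]
  exact QuotientGroup.out_eq' x

lemma conv_support {f₁ f₂ : G → ℂ} {h : G} (hh : cosetConv S f₁ f₂ h ≠ 0) :
    ∃ g, f₁ g ≠ 0 ∧ f₂ (g⁻¹ * h) ≠ 0 := by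
  by_contra! H
  apply hh
  rw [cosetConv, ← tsum_zero]
  refine tsum_congr fun x => ?_
  by_cases hx : f₁ x.out = 0
  · rw [hx, zero_mul]
  · rw [H _ hx, mul_zero]

lemma conv_apply_eq_sum {ι : Type*} [Fintype ι] {f₁ f₂ : G → ℂ} (h₁ : f₁ ∈ heckeModule χ)
    (h₂ : f₂ ∈ heckeModule χ) (r : ι → G) (hinj : ∀ i j, (r i)⁻¹ * r j ∈ S → i = j)
    (hsupp : ∀ g, f₁ g ≠ 0 → ∃ i, (r i)⁻¹ * g ∈ S) (h : G) :
    cosetConv S f₁ f₂ h = ∑ i, f₁ (r i) * f₂ ((r i)⁻¹ * h) := by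
  have hr : Function.Injective fun i => (r i : G ⧸ S) := fun i j hij =>
    hinj i j (QuotientGroup.eq.1 hij)
  rw [cosetConv, ← hr.tsum_eq, tsum_fintype]
  · exact Finset.sum_congr rfl fun i _ =>
      apply_out (F := fun g => f₁ g * f₂ (g⁻¹ * h)) (conv_summand h₁ h₂ h) (r i)
  · intro x hx
    obtain ⟨i, hi⟩ := hsupp _ (left_ne_zero_of_mul hx)
    exact ⟨i, (QuotientGroup.eq.2 hi).trans (QuotientGroup.out_eq' x)⟩

lemma conv_mem {f₁ f₂ : G → ℂ} (h₁ : f₁ ∈ heckeModule χ) (h₂ : f₂ ∈ heckeModule χ) :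
    cosetConv S f₁ f₂ ∈ heckeModule χ := by
  refine ⟨fun g k k' => ?_, ?_⟩
  -- Re-indexing by x ↦ k x moves k from the argument of the second function to the left of the
  -- first.
  · rw [cosetConv, tsum_out_translate (F := fun x => f₁ x * f₂ (x⁻¹ * (k * g * k')))
      (conv_summand h₁ h₂ _) k, cosetConv, ← tsum_mul_left]
    refine tsum_congr fun x => ?_
    have e : ((k : G) * x.out)⁻¹ * (k * g * k') = x.out⁻¹ * g * k' := by group
    simp only [e]
    rw [apply_mul_left h₁, apply_mul_right h₂]
    ring
  · refine ((finite_conv_support h₁.2 h₂.2).image Prod.snd).subset ?_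
    rintro _ ⟨h, hh, rfl⟩
    obtain ⟨g, hg1, hg2⟩ := conv_support hh
    refine ⟨((g : G ⧸ S), (h : G ⧸ S)), ⟨?_, ?_⟩, rfl⟩
    · obtain ⟨k, hk⟩ := QuotientGroup.mk_out_eq_mul S g
      simp only [hk, apply_mul_right h₁]
      exact mul_ne_zero (char_ne_zero χ k) hg1
    · obtain ⟨k, hk⟩ := QuotientGroup.mk_out_eq_mul S g
      obtain ⟨l, hl⟩ := QuotientGroup.mk_out_eq_mul S h
      have e : (g * k)⁻¹ * (h * l) = ((k⁻¹ : S) : G) * (g⁻¹ * h) * l := by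
        simp [mul_assoc]
      simp only [hk, hl, e, h₂.1]
      exact mul_ne_zero (mul_ne_zero (char_ne_zero χ _) (char_ne_zero χ _)) hg2

lemma conv_apply_eq_sum_finset {f₁ f₂ : G → ℂ} (h₁ : (cosetSupport S f₁).Finite) (h : G) :
    cosetConv S f₁ f₂ h = ∑ x ∈ h₁.toFinset, f₁ x.out * f₂ (x.out⁻¹ * h) := by
  refine tsum_eq_sum fun x hx => ?_
  by_cases h0 : f₁ x.out = 0
  · rw [h0, zero_mul]
  · exact absurd (h₁.mem_toFinset.2 ⟨_, h0, QuotientGroup.out_eq' x⟩) hx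

lemma conv_assoc {f₁ f₂ f₃ : G → ℂ} (h₁ : f₁ ∈ heckeModule χ) (h₂ : f₂ ∈ heckeModule χ)
    (h₃ : f₃ ∈ heckeModule χ) :
    cosetConv S (cosetConv S f₁ f₂) f₃ = cosetConv S f₁ (cosetConv S f₂ f₃) := by
  funext h
  have hs : Summable (Function.uncurry fun x y : G ⧸ S =>
      f₁ y.out * (f₂ (y.out⁻¹ * x.out) * f₃ (x.out⁻¹ * h))) := by
    refine summable_of_hasFiniteSupport
      (((finite_conv_support h₁.2 h₂.2).image Prod.swap).subset ?_)
    rintro ⟨x, y⟩ hxy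
    exact ⟨(y, x), ⟨left_ne_zero_of_mul hxy, left_ne_zero_of_mul (right_ne_zero_of_mul hxy)⟩, rfl⟩
  calc ∑' x : G ⧸ S, (∑' y : G ⧸ S, f₁ y.out * f₂ (y.out⁻¹ * x.out)) * f₃ (x.out⁻¹ * h)
      = ∑' x : G ⧸ S, ∑' y : G ⧸ S, f₁ y.out * (f₂ (y.out⁻¹ * x.out) * f₃ (x.out⁻¹ * h)) := by
        refine tsum_congr fun x => ?_
        rw [← tsum_mul_right]
        exact tsum_congr fun y => mul_assoc _ _ _
    _ = ∑' y : G ⧸ S, ∑' x : G ⧸ S, f₁ y.out * (f₂ (y.out⁻¹ * x.out) * f₃ (x.out⁻¹ * h)) :=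
        hs.tsum_comm.symm
    _ = ∑' y : G ⧸ S, f₁ y.out * ∑' x : G ⧸ S, f₂ x.out * f₃ (x.out⁻¹ * (y.out⁻¹ * h)) := by
        refine tsum_congr fun y => ?_
        rw [tsum_mul_left, tsum_out_translate (F := fun g => f₂ g * f₃ (g⁻¹ * (y.out⁻¹ * h)))
          (conv_summand h₂ h₃ _) y.out⁻¹]
        simp [mul_assoc]

open Classical in
/-- The identity element: it is `χ` on `S` and `0` elsewhere. -/
def unitFun (χ : S →* ℂ) (g : G) : ℂ := if h : g ∈ S then χ ⟨g, h⟩ else 0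

lemma unitFun_mem (χ : S →* ℂ) : unitFun χ ∈ heckeModule χ := by
  refine ⟨fun g k k' => ?_, (Set.finite_singleton ((1 : G) : G ⧸ S)).subset ?_⟩
  · by_cases hg : g ∈ S
    · have : (k : G) * g * k' ∈ S := mul_mem (mul_mem k.2 hg) k'.2
      rw [unitFun, unitFun, dif_pos hg, dif_pos this, mul_right_comm, ← map_mul, ← map_mul]
      rfl
    · have : (k : G) * g * k' ∉ S := by
        rwa [mul_mem_cancel_right k'.2, mul_mem_cancel_left k.2]
      rw [unitFun, unitFun, dif_neg hg, dif_neg this, mul_zero]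
  · rintro _ ⟨g, hg, rfl⟩
    have : g ∈ S := by
      by_contra h
      exact hg (dif_neg h)
    exact QuotientGroup.eq.2 (by simpa using this)

lemma unitFun_apply_coe (k : S) : unitFun χ (k : G) = χ k := dif_pos k.2

lemma unitFun_of_notMem {g : G} (hg : g ∉ S) : unitFun χ g = 0 := dif_neg hg

lemma unitFun_conv {f : G → ℂ} (hf : f ∈ heckeModule χ) :
    cosetConv S (unitFun χ) f = f := by
  funext h
  rw [conv_apply_eq_sum (unitFun_mem χ) hf (fun _ : Unit => (1 : G)) (fun _ _ _ => rfl)]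
  · have := unitFun_apply_coe (χ := χ) 1
    simp only [OneMemClass.coe_one, map_one] at this
    simp [this]
  · intro g hg
    refine ⟨(), ?_⟩
    by_contra h
    exact hg (unitFun_of_notMem (by simpa using h))

lemma conv_unitFun {f : G → ℂ} (hf : f ∈ heckeModule χ) :
    cosetConv S f (unitFun χ) = f := by
  funext h
  rw [cosetConv, tsum_eq_single (h : G ⧸ S)]
  · rw [apply_out (F := fun g => f g * unitFun χ (g⁻¹ * h))
      (conv_summand hf (unitFun_mem χ) h), inv_mul_cancel]
    have := unitFun_apply_coe (χ := χ) 1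
    simp only [OneMemClass.coe_one, map_one] at this
    rw [this, mul_one]
  · intro x hx
    rw [unitFun_of_notMem, mul_zero]
    intro hmem
    exact hx ((QuotientGroup.out_eq' x).symm.trans (QuotientGroup.eq.2 hmem))

lemma conv_add_left {f₁ f₁' f₂ : G → ℂ} (h₁ : f₁ ∈ heckeModule χ) (h₁' : f₁' ∈ heckeModule χ) :
    cosetConv S (f₁ + f₁') f₂ = cosetConv S f₁ f₂ + cosetConv S f₁' f₂ := by
  have hs : ∀ {f}, f ∈ heckeModule χ → ∀ h,
      Summable fun x : G ⧸ S => f x.out * f₂ (x.out⁻¹ * h) := by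
    intro f hf h
    refine summable_of_hasFiniteSupport (hf.2.subset fun x hx => ?_)
    exact ⟨_, left_ne_zero_of_mul hx, QuotientGroup.out_eq' x⟩
  funext h
  simp only [cosetConv, Pi.add_apply, add_mul]
  exact (hs h₁ h).tsum_add (hs h₁' h)

lemma conv_add_right {f₁ f₂ f₂' : G → ℂ} (h₁ : f₁ ∈ heckeModule χ) :
    cosetConv S f₁ (f₂ + f₂') = cosetConv S f₁ f₂ + cosetConv S f₁ f₂' := by
  have hs : ∀ (f : G → ℂ) (h : G), Summable fun x : G ⧸ S => f₁ x.out * f (x.out⁻¹ * h) := by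
    intro f h
    refine summable_of_hasFiniteSupport (h₁.2.subset fun x hx => ?_)
    exact ⟨_, left_ne_zero_of_mul hx, QuotientGroup.out_eq' x⟩
  funext h
  simp only [cosetConv, Pi.add_apply, mul_add]
  exact (hs f₂ h).tsum_add (hs f₂' h)

lemma conv_smul_left (c : ℂ) (f₁ f₂ : G → ℂ) :
    cosetConv S (c • f₁) f₂ = c • cosetConv S f₁ f₂ := by
  funext h
  simp only [cosetConv, Pi.smul_apply, smul_eq_mul, mul_assoc, tsum_mul_left]

lemma conv_smul_right (c : ℂ) (f₁ f₂ : G → ℂ) :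
    cosetConv S f₁ (c • f₂) = c • cosetConv S f₁ f₂ := by
  funext h
  simp only [cosetConv, Pi.smul_apply, smul_eq_mul, mul_left_comm _ c, tsum_mul_left]

instance : Mul (heckeModule χ) := ⟨fun f g => ⟨cosetConv S f g, conv_mem f.2 g.2⟩⟩

instance : One (heckeModule χ) := ⟨⟨unitFun χ, unitFun_mem χ⟩⟩

lemma coe_mul (f g : heckeModule χ) : ((f * g : heckeModule χ) : G → ℂ) = cosetConv S f g := rfl

lemma coe_one : ((1 : heckeModule χ) : G → ℂ) = unitFun χ := rfl

instance : Ring (heckeModule χ) :=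
  { (inferInstance : AddCommGroup (heckeModule χ)),
    (inferInstance : Mul (heckeModule χ)),
    (inferInstance : One (heckeModule χ)) with
    left_distrib := fun a b c => Subtype.ext (conv_add_right a.2)
    right_distrib := fun a b c => Subtype.ext (conv_add_left a.2 b.2)
    zero_mul := fun a => Subtype.ext (by
      funext h
      simp [coe_mul, cosetConv])
    mul_zero := fun a => Subtype.ext (by
      funext h
      simp [coe_mul, cosetConv])
    mul_assoc := fun a b c => Subtype.ext (conv_assoc a.2 b.2 c.2)
    one_mul := fun a => Subtype.ext (unitFun_conv a.2)
    mul_one := fun a => Subtype.ext (conv_unitFun a.2) }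

instance : Algebra ℂ (heckeModule χ) :=
  Algebra.ofModule (fun c f g => Subtype.ext (conv_smul_left (S := S) c f g))
    (fun c f g => Subtype.ext (conv_smul_right (S := S) c f g))

end heckeModule
end CosetConvolution

/-! ### Functions on one double coset S w S and their quadratic relation. -/

section RankOne

variable {G : Type*} [Group G] {S : Subgroup G}

/-- An element `w` with `w ^ 2 ∈ S`, for which `S w S` is the disjoint union of the cosets
`r i * w * S`, and for which `w⁻¹ S w` is contained in `S ∪ S w S`, compatibly with a character
`χ` of `S`. -/
structure RankOne (χ : S →* ℂ) (w : G) (ι : Type*) where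
  /-- representatives of the cosets, up to `w` -/
  r : ι → S
  /-- the index of the trivial representative -/
  base : ι
  /-- the values of `χ` on the rank one relations -/
  c : ι → ℂ
  /-- the square of `w` -/
  z : S
  r_base : r base = 1
  char_r : ∀ i, χ (r i) = 1
  sq_eq : w * w = z
  inj : ∀ i j, ((r i : G) * w)⁻¹ * (r j * w) ∈ S → i = j
  cover : ∀ s : S, ∃ i, ((r i : G) * w)⁻¹ * (s * w) ∈ S
  stab : ∀ k k' : S, (k : G) * w = w * k' → χ k = χ k'
  opp : ∀ i, i ≠ base → ∃ k k' : S, w⁻¹ * (r i : G)⁻¹ * w = k * w * k' ∧ χ k * χ k' = c i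

open Classical in
/-- The function with value `χ k * lam * χ k'` at `k * w * k'`, and `0` outside `S w S`. -/
def doubleCosetFun (χ : S →* ℂ) (w : G) (lam : ℂ) (g : G) : ℂ :=
  if h : ∃ q : S × S, g = q.1 * w * q.2 then χ h.choose.1 * lam * χ h.choose.2 else 0

lemma doubleCosetFun_of_forall_ne {χ : S →* ℂ} {w : G} {lam : ℂ} {g : G}
    (h : ∀ k k' : S, g ≠ k * w * k') : doubleCosetFun χ w lam g = 0 :=
  dif_neg fun ⟨q, hq⟩ => h q.1 q.2 hq

lemma exists_of_doubleCosetFun_ne_zero {χ : S →* ℂ} {w : G} {lam : ℂ} {g : G}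
    (h : doubleCosetFun χ w lam g ≠ 0) : ∃ k k' : S, g = k * w * k' := by
  by_contra! H
  exact h (doubleCosetFun_of_forall_ne H)

namespace RankOne

variable {χ : S →* ℂ} {w : G} {ι : Type*} (R : RankOne χ w ι)
include R

/-- Two expressions of the same element as k w k' differ by some s w = w s' with s, s' in S, and
`stab` says that χ(s) = χ(s'); hence the chosen decomposition is immaterial. -/
lemma doubleCosetFun_apply (lam : ℂ) (k k' : S) :
    doubleCosetFun χ w lam (k * w * k') = χ k * lam * χ k' := by
  have h : ∃ q : S × S, (k : G) * w * k' = q.1 * w * q.2 := ⟨(k, k'), rfl⟩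
  rw [doubleCosetFun, dif_pos h]
  have hs := h.choose_spec
  generalize h.choose = q at hs
  have e : ((q.1⁻¹ * k : S) : G) * w = w * ((q.2 * k'⁻¹ : S) : G) := by
    push_cast
    rw [mul_assoc, inv_mul_eq_iff_eq_mul, ← mul_assoc w, ← mul_assoc, eq_mul_inv_iff_mul_eq, hs,
      mul_assoc]
  have e1 := R.stab _ _ e
  rw [map_mul, map_mul] at e1
  have h1 := char_mul_inv χ q.1
  have h2 := char_mul_inv χ k'
  linear_combination (-χ q.1 * χ k' * lam) * e1 + (χ k * χ k' * lam) * h1 - (χ q.1 * χ q.2 * lam) * h2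

lemma doubleCosetFun_self (lam : ℂ) : doubleCosetFun χ w lam w = lam := by
  simpa using R.doubleCosetFun_apply lam 1 1

lemma doubleCosetFun_mem [Finite ι] (lam : ℂ) : doubleCosetFun χ w lam ∈ heckeModule χ := by
  refine ⟨fun g k k' => ?_, (Set.finite_range fun i => (((R.r i : G) * w : G) : G ⧸ S)).subset ?_⟩
  · by_cases h : ∃ l l' : S, g = l * w * l'
    · obtain ⟨l, l', rfl⟩ := h
      have e : (k : G) * (l * w * l') * k' = ((k * l : S) : G) * w * ((l' * k' : S) : G) := by
        simp [mul_assoc]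
      rw [e, R.doubleCosetFun_apply, R.doubleCosetFun_apply, map_mul, map_mul]
      ring
    · push Not at h
      rw [doubleCosetFun_of_forall_ne h, doubleCosetFun_of_forall_ne, mul_zero]
      intro l l' e
      apply h (k⁻¹ * l) (l' * k'⁻¹)
      push_cast
      rw [mul_assoc, mul_assoc, eq_inv_mul_iff_mul_eq, ← mul_assoc w, ← mul_assoc (l : G),
        eq_mul_inv_iff_mul_eq, ← mul_assoc (l : G), e]
  · rintro _ ⟨g, hg, rfl⟩
    obtain ⟨k, k', rfl⟩ := exists_of_doubleCosetFun_ne_zero hg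
    obtain ⟨i, hi⟩ := R.cover k
    refine ⟨i, QuotientGroup.eq.2 ?_⟩
    rw [← mul_assoc]
    exact mul_mem hi k'.2

/-- The BN-pair axiom w⁻¹ S w ⊆ S ∪ S w S. Write s w = r_i w t: the base index gives an element of
S, any other is handled by inverting `opp` and replacing w⁻¹ by w z⁻¹. -/
lemma conj_mem_or (s : S) :
    w⁻¹ * s * w ∈ S ∨ ∃ k k' : S, w⁻¹ * s * w = k * w * k' := by
  obtain ⟨i, hi⟩ := R.cover s
  have e : w⁻¹ * s * w = w⁻¹ * R.r i * w * (((R.r i : G) * w)⁻¹ * (s * w)) := by group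
  by_cases h : i = R.base
  · left
    rw [h, R.r_base] at hi
    rw [e, h, R.r_base]
    simpa using hi
  · right
    obtain ⟨k, k', hk, -⟩ := R.opp i h
    refine ⟨k'⁻¹, R.z⁻¹ * k⁻¹ * ⟨_, hi⟩, ?_⟩
    rw [e]
    have e2 : w⁻¹ * R.r i * w = ((k : G) * w * k')⁻¹ := by rw [← hk]; group
    rw [e2]
    push_cast
    rw [← R.sq_eq]
    group

variable [Fintype ι]

lemma conv_apply (lam : ℂ) {f : G → ℂ} (hf : f ∈ heckeModule χ) (h : G) :
    cosetConv S (doubleCosetFun χ w lam) f h =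
      ∑ i, lam * f (w⁻¹ * (R.r i : G)⁻¹ * h) := by
  rw [heckeModule.conv_apply_eq_sum (R.doubleCosetFun_mem lam) hf (fun i => (R.r i : G) * w) R.inj]
  · refine Finset.sum_congr rfl fun i _ => ?_
    have := R.doubleCosetFun_apply lam (R.r i) 1
    rw [OneMemClass.coe_one, mul_one, map_one, mul_one, R.char_r, one_mul] at this
    rw [this, mul_inv_rev]
  · intro g hg
    obtain ⟨k, k', rfl⟩ := exists_of_doubleCosetFun_ne_zero hg
    obtain ⟨i, hi⟩ := R.cover k
    refine ⟨i, ?_⟩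
    rw [← mul_assoc]
    exact mul_mem hi k'.2

/-- In the length-increasing situation w D ⊆ D', every non-base term evaluates f at a point k w k' g
of D', outside its support. Only the base term is left, so convolution is injective on functions
supported on D. -/
lemma conv_apply_mul {D D' : Set G} (hw : ∀ g ∈ D, w * g ∈ D')
    (hD : ∀ g ∈ D, ∀ k : S, k * g ∈ D) (hD' : ∀ g ∈ D', ∀ k : S, k * g ∈ D')
    (hdisj : Disjoint D D') (lam : ℂ) {f : G → ℂ} (hf : f ∈ heckeModule χ)
    (hfD : Function.support f ⊆ D) {g : G} (hg : g ∈ D) :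
    cosetConv S (doubleCosetFun χ w lam) f (w * g) = lam * f g := by
  rw [R.conv_apply lam hf, Finset.sum_eq_single R.base]
  · rw [R.r_base]
    simp
  · intro i _ hi
    obtain ⟨k, k', hk, -⟩ := R.opp i hi
    have e : w⁻¹ * (R.r i : G)⁻¹ * (w * g) = k * (w * (k' * g)) := by
      rw [← mul_assoc, hk]
      simp only [mul_assoc]
    rw [e]
    have h1 : (k : G) * (w * (k' * g)) ∈ D' := hD' _ (hw _ (hD _ hg _)) _
    have h2 : f (k * (w * (k' * g))) = 0 := by
      by_contra h
      exact hdisj.le_bot ⟨hfD h, h1⟩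
    rw [h2, mul_zero]
  · simp

omit R [Fintype ι] in
lemma conv_support_subset {D D' : Set G} (hw : ∀ g ∈ D, w * g ∈ D')
    (hD : ∀ g ∈ D, ∀ k : S, k * g ∈ D) (hD' : ∀ g ∈ D', ∀ k : S, k * g ∈ D')
    (lam : ℂ) {f : G → ℂ} (hfD : Function.support f ⊆ D) :
    Function.support (cosetConv S (doubleCosetFun χ w lam) f) ⊆ D' := by
  intro h hh
  obtain ⟨g, hg, hg'⟩ := heckeModule.conv_support hh
  obtain ⟨k, k', rfl⟩ := exists_of_doubleCosetFun_ne_zero hg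
  have e : h = k * (w * (k' * ((k * w * k')⁻¹ * h))) := by group
  rw [e]
  exact hD' _ (hw _ (hD _ (hfD hg') _)) _

/-- The quadratic relation. -/
lemma conv_self [DecidableEq ι] (lam : ℂ) (hw : w ∉ S) :
    cosetConv S (doubleCosetFun χ w lam) (doubleCosetFun χ w lam) =
      (lam * ∑ i ∈ Finset.univ.erase R.base, R.c i) • doubleCosetFun χ w lam +
        (Fintype.card ι * lam ^ 2 * χ R.z⁻¹) • heckeModule.unitFun χ := by
  have hU := R.doubleCosetFun_mem lam
  have hww : w⁻¹ = w * ((R.z⁻¹ : S) : G) := by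
    push_cast
    rw [← R.sq_eq]
    group
  have hwS : ∀ k k' : S, (k : G) * w * k' ∉ S := by
    intro k k'
    rwa [mul_mem_cancel_right k'.2, mul_mem_cancel_left k.2]
  have h1 : ∀ k : S, doubleCosetFun χ w lam (k : G) = 0 := by
    intro k
    refine doubleCosetFun_of_forall_ne fun l l' h => hwS l l' ?_
    rw [← h]
    exact k.2
  -- Equivariance determines a function supported on S ∪ S w S by its values at 1 and w, so the
  -- relation is checked at these two points only.
  have key : ∀ f f' : G → ℂ, f ∈ heckeModule χ → f' ∈ heckeModule χ →
      (∀ g, f g ≠ 0 → g ∈ S ∨ ∃ k k' : S, g = k * w * k') →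
      (∀ g, f' g ≠ 0 → g ∈ S ∨ ∃ k k' : S, g = k * w * k') → f 1 = f' 1 → f w = f' w → f = f' := by
    intro f f' hf hf' hs hs' e1 ew
    funext g
    by_cases hg : g ∈ S ∨ ∃ k k' : S, g = k * w * k'
    · rcases hg with hg | ⟨k, k', rfl⟩
      · have a := heckeModule.apply_mul_left hf ⟨g, hg⟩ 1
        have b := heckeModule.apply_mul_left hf' ⟨g, hg⟩ 1
        rw [mul_one] at a b
        rw [a, b, e1]
      · rw [hf.1, hf'.1, ew]
    · rw [not_imp_comm.1 (hs g) hg, not_imp_comm.1 (hs' g) hg]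
  refine key _ _ (heckeModule.conv_mem hU hU) (add_mem (Submodule.smul_mem _ _ hU)
    (Submodule.smul_mem _ _ (heckeModule.unitFun_mem χ))) ?_ ?_ ?_ ?_
  · intro h hh
    obtain ⟨g, hg, hg'⟩ := heckeModule.conv_support hh
    obtain ⟨k, k', rfl⟩ := exists_of_doubleCosetFun_ne_zero hg
    obtain ⟨l, l', hl⟩ := exists_of_doubleCosetFun_ne_zero hg'
    -- Uses w = z w⁻¹ to bring S w S w S into the form to which `conj_mem_or` applies.
    have e : h = k * (R.z * (w⁻¹ * (k' * l : S) * w)) * l' := by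
      rw [inv_mul_eq_iff_eq_mul] at hl
      push_cast
      rw [hl, ← R.sq_eq]
      group
    rcases R.conj_mem_or (k' * l) with hm | ⟨m, m', hm⟩
    · left
      rw [e]
      exact mul_mem (mul_mem k.2 (mul_mem R.z.2 hm)) l'.2
    · right
      refine ⟨k * R.z * m, m' * l', ?_⟩
      rw [e, hm]
      push_cast
      group
  · intro g hg
    by_contra! hg'
    apply hg
    simp only [Pi.add_apply, Pi.smul_apply]
    rw [heckeModule.unitFun_of_notMem hg'.1, doubleCosetFun_of_forall_ne hg'.2]
    simp
  -- At 1 all cosets contribute equally, giving the constant term.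
  · rw [R.conv_apply lam hU]
    have e0 : ∀ i, lam * doubleCosetFun χ w lam (w⁻¹ * (R.r i : G)⁻¹ * 1) =
        lam ^ 2 * χ R.z⁻¹ := by
      intro i
      have e : w⁻¹ * (R.r i : G)⁻¹ * 1 = ((1 : S) : G) * w * ((R.z⁻¹ * (R.r i)⁻¹ : S) : G) := by
        rw [hww]
        push_cast
        group
      have hr := char_mul_inv χ (R.r i)
      rw [R.char_r, one_mul] at hr
      rw [e, R.doubleCosetFun_apply, map_mul, hr, map_one]
      ring
    simp only [e0, Finset.sum_const, Finset.card_univ, nsmul_eq_mul, Pi.add_apply, Pi.smul_apply]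
    have h2 := heckeModule.unitFun_apply_coe (χ := χ) 1
    have h3 := h1 1
    rw [OneMemClass.coe_one] at h2 h3
    rw [h2, h3, map_one, smul_zero, zero_add, smul_eq_mul, mul_one, mul_assoc]
  -- At w the base term is the value at 1, which vanishes because w ∉ S; the other terms give the
  -- numbers `c i`.
  · rw [R.conv_apply lam hU, ← Finset.add_sum_erase _ _ (Finset.mem_univ R.base)]
    have e0 : ∀ i ∈ Finset.univ.erase R.base,
        lam * doubleCosetFun χ w lam (w⁻¹ * (R.r i : G)⁻¹ * w) = lam ^ 2 * R.c i := by
      intro i hi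
      obtain ⟨k, k', hk, hc⟩ := R.opp i (Finset.ne_of_mem_erase hi)
      rw [hk, R.doubleCosetFun_apply, ← hc]
      ring
    rw [Finset.sum_congr rfl e0, ← Finset.mul_sum, R.r_base]
    have e1 : w⁻¹ * ((1 : S) : G)⁻¹ * w = ((1 : S) : G) := by simp
    simp only [Pi.add_apply, Pi.smul_apply, smul_eq_mul]
    rw [e1, h1, heckeModule.unitFun_of_notMem hw, R.doubleCosetFun_self]
    ring

end RankOne
end RankOne

/-! ### Alternating words -/

section Words

/-- The alternating word of length `n` in `x` and `y`, beginning with `x`. -/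
def altWord {A : Type*} [Monoid A] : A → A → ℕ → A
  | _, _, 0 => 1
  | x, y, n + 1 => x * altWord y x n

/-- The alternating word of length `|n|`, beginning with `x` if `n > 0` and with `y` if `n < 0`. -/
def intWord {A : Type*} [Monoid A] (x y : A) (n : ℤ) : A :=
  if 0 ≤ n then altWord x y n.toNat else altWord y x (-n).toNat

variable {A B : Type*} [Monoid A] [Monoid B]

lemma map_altWord (φ : A →* B) (x y : A) (n : ℕ) :
    φ (altWord x y n) = altWord (φ x) (φ y) n := by
  induction n generalizing x y with
  | zero => exact map_one φ
  | succ n ih => rw [altWord, altWord, map_mul, ih]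

lemma map_intWord (φ : A →* B) (x y : A) (n : ℤ) :
    φ (intWord x y n) = intWord (φ x) (φ y) n := by
  rw [intWord, intWord]
  split_ifs <;> exact map_altWord φ _ _ _

lemma intWord_zero (x y : A) : intWord x y 0 = 1 := rfl

/-- On signed lengths the two generators act as the reflections n ↦ 1 - n and n ↦ -1 - n of ℤ, which
generate the infinite dihedral group. The sign condition on n says that the length increases, so no
relation is needed. -/
lemma left_mul_intWord (x y : A) {n : ℤ} (hn : n ≤ 0) :
    x * intWord x y n = intWord x y (1 - n) := by
  have h1 : (1 - n).toNat = (-n).toNat + 1 := by omega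
  have h2 : intWord x y n = altWord y x (-n).toNat := by
    rcases hn.eq_or_lt with rfl | hn
    · rfl
    · rw [intWord, if_neg (by omega)]
  rw [h2, intWord, if_pos (by omega), h1, altWord]

lemma right_mul_intWord (x y : A) {n : ℤ} (hn : 0 ≤ n) :
    y * intWord x y n = intWord x y (-1 - n) := by
  have h1 : (-(-1 - n)).toNat = n.toNat + 1 := by omega
  rw [intWord, if_pos hn, intWord, if_neg (by omega), h1, altWord]

end Words

/-! ### The algebra with two quadratic relations and its spanning words. -/

section Presentation

variable {A : Type*} [Ring A] [Algebra ℂ A] {a b : Fin 2 → ℂ}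

lemma QuadAlg.gen_sq (a b : Fin 2 → ℂ) (i : Fin 2) :
    QuadAlg.gen a b i * QuadAlg.gen a b i = a i • QuadAlg.gen a b i + b i • 1 := by
  have h := RingQuot.mkAlgHom_rel ℂ (QuadRel.rel (a := a) (b := b) i)
  rw [map_mul, map_add, map_smul, AlgHom.commutes, Algebra.algebraMap_eq_smul_one] at h
  exact h

/-- The homomorphism from the presented algebra given by two elements satisfying the relations. -/
def QuadAlg.lift (u : Fin 2 → A) (hu : ∀ i, u i * u i = a i • u i + b i • 1) :
    QuadAlg a b →ₐ[ℂ] A :=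
  RingQuot.liftAlgHom ℂ ⟨FreeAlgebra.lift ℂ u, by
    rintro _ _ ⟨i⟩
    simp [hu, Algebra.algebraMap_eq_smul_one]⟩

lemma QuadAlg.lift_gen (u : Fin 2 → A) (hu : ∀ i, u i * u i = a i • u i + b i • 1) (i : Fin 2) :
    QuadAlg.lift u hu (QuadAlg.gen a b i) = u i := by
  rw [QuadAlg.lift, QuadAlg.gen, RingQuot.liftAlgHom_mkAlgHom_apply, FreeAlgebra.lift_ι_apply]

/-- The span of the words contains 1 and is stable under left multiplication by both generators,
hence is a left ideal containing 1. -/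
lemma QuadAlg.span_intWord (a b : Fin 2 → ℂ) :
    Submodule.span ℂ (Set.range (intWord (QuadAlg.gen a b 0) (QuadAlg.gen a b 1))) = ⊤ := by
  set x := QuadAlg.gen a b 0 with hx
  set y := QuadAlg.gen a b 1 with hy
  set V := Submodule.span ℂ (Set.range (intWord x y)) with hV
  have hword : ∀ n, intWord x y n ∈ V := fun n => Submodule.subset_span ⟨n, rfl⟩
  have hx0 : ∀ n, x * intWord x y n ∈ V := by
    intro n
    rcases le_or_gt n 0 with hn | hn
    · rw [left_mul_intWord x y hn]
      exact hword _
    -- Here the word already begins with x; the quadratic relation turns the resulting x² into a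
    -- combination of two words.
    · have e : intWord x y n = x * intWord x y (1 - n) := by
        rw [left_mul_intWord x y (by omega : 1 - n ≤ 0), sub_sub_cancel]
      have e2 : x * intWord x y n = a 0 • intWord x y n + b 0 • intWord x y (1 - n) := by
        rw [e, ← mul_assoc, hx, QuadAlg.gen_sq, add_mul, smul_mul_assoc, smul_mul_assoc, one_mul]
      rw [e2]
      exact add_mem (V.smul_mem _ (hword _)) (V.smul_mem _ (hword _))
  have hy0 : ∀ n, y * intWord x y n ∈ V := by
    intro n
    rcases le_or_gt 0 n with hn | hn
    · rw [right_mul_intWord x y hn]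
      exact hword _
    · have e : intWord x y n = y * intWord x y (-1 - n) := by
        rw [right_mul_intWord x y (by omega : 0 ≤ -1 - n), sub_sub_cancel]
      have e2 : y * intWord x y n = a 1 • intWord x y n + b 1 • intWord x y (-1 - n) := by
        rw [e, ← mul_assoc, hy, QuadAlg.gen_sq, add_mul, smul_mul_assoc, smul_mul_assoc, one_mul]
      rw [e2]
      exact add_mem (V.smul_mem _ (hword _)) (V.smul_mem _ (hword _))
  have hgen : ∀ i, ∀ v ∈ V, QuadAlg.gen a b i * v ∈ V := by
    intro i v hv
    induction hv using Submodule.span_induction with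
    | mem v hv =>
      obtain ⟨n, rfl⟩ := hv
      fin_cases i
      · exact hx0 n
      · exact hy0 n
    | zero => rw [mul_zero]; exact V.zero_mem
    | add v w _ _ hv hw => rw [mul_add]; exact add_mem hv hw
    | smul c v _ hv => rw [mul_smul_comm]; exact V.smul_mem c hv
  have hall : ∀ t : FreeAlgebra ℂ (Fin 2), ∀ v ∈ V, RingQuot.mkAlgHom ℂ (QuadRel a b) t * v ∈ V := by
    intro t
    induction t using FreeAlgebra.induction with
    | grade0 c =>
      intro v hv
      rw [AlgHom.commutes, Algebra.algebraMap_eq_smul_one, smul_mul_assoc, one_mul]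
      exact V.smul_mem c hv
    | grade1 i => exact hgen i
    | mul s t hs ht =>
      intro v hv
      rw [map_mul, mul_assoc]
      exact hs _ (ht v hv)
    | add s t hs ht =>
      intro v hv
      rw [map_add, add_mul]
      exact add_mem (hs v hv) (ht v hv)
  rw [eq_top_iff]
  rintro t -
  obtain ⟨t, rfl⟩ := RingQuot.mkAlgHom_surjective ℂ (QuadRel a b) t
  have := hall t 1 (by rw [← intWord_zero x y]; exact hword 0)
  rwa [mul_one] at this

/-- A spanning family mapped onto a basis is itself a basis, so the homomorphism is injective
without any normal form argument in the presented algebra. -/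
lemma QuadAlg.lift_bijective (u : Fin 2 → A) (hu : ∀ i, u i * u i = a i • u i + b i • 1)
    (hli : LinearIndependent ℂ (intWord (u 0) (u 1)))
    (hsp : Submodule.span ℂ (Set.range (intWord (u 0) (u 1))) = ⊤) :
    Function.Bijective (QuadAlg.lift u hu) := by
  set v := intWord (QuadAlg.gen a b 0) (QuadAlg.gen a b 1)
  have hv : ∀ n, QuadAlg.lift u hu (v n) = intWord (u 0) (u 1) n := by
    intro n
    have := map_intWord (QuadAlg.lift u hu : QuadAlg a b →* A)
      (QuadAlg.gen a b 0) (QuadAlg.gen a b 1) n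
    simpa [QuadAlg.lift_gen] using this
  have hcomp : ∀ c : ℤ →₀ ℂ, QuadAlg.lift u hu (Finsupp.linearCombination ℂ v c) =
      Finsupp.linearCombination ℂ (intWord (u 0) (u 1)) c := by
    intro c
    simp only [Finsupp.linearCombination_apply, Finsupp.sum, map_sum, map_smul, hv]
  have hsurj : ∀ t, ∃ c, Finsupp.linearCombination ℂ v c = t := by
    rw [← Function.Surjective, ← LinearMap.range_eq_top, Finsupp.range_linearCombination]
    exact QuadAlg.span_intWord a b
  constructor
  · rw [injective_iff_map_eq_zero]
    intro t ht
    obtain ⟨c, rfl⟩ := hsurj t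
    rw [hcomp] at ht
    rw [linearIndependent_iff.1 hli c ht, map_zero]
  · intro t
    have : t ∈ LinearMap.range (Finsupp.linearCombination ℂ (intWord (u 0) (u 1))) := by
      rw [Finsupp.range_linearCombination, hsp]
      trivial
    obtain ⟨c, rfl⟩ := this
    exact ⟨_, hcomp c⟩

end Presentation

/-! ### Hecke algebras whose double cosets form an infinite dihedral group. -/

section DihedralPresentation

variable {G : Type*} [Group G] {S : Subgroup G}

/-- The double coset of `x`. -/
def dcoset (S : Subgroup G) (x : G) : Set G := {g | ∃ k k' : S, g = k * x * k'}

lemma mem_dcoset_self (x : G) : x ∈ dcoset S x := ⟨1, 1, by simp⟩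

lemma mul_mem_dcoset {x g : G} (hg : g ∈ dcoset S x) (k : S) : k * g ∈ dcoset S x := by
  obtain ⟨l, l', rfl⟩ := hg
  exact ⟨k * l, l', by simp [mul_assoc]⟩

lemma mem_dcoset_mul {x g : G} (hg : g ∈ dcoset S x) (k : S) : g * k ∈ dcoset S x := by
  obtain ⟨l, l', rfl⟩ := hg
  exact ⟨l, l' * k, by simp [mul_assoc]⟩

/-- Representatives `d n` of the double cosets of `S`, indexed by the elements of the infinite
dihedral group (identified with `ℤ`, by the signed length), so that left multiplication by `w₀` and
`w₁` increases the length as it does in the dihedral group. -/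
structure DihedralCosets (S : Subgroup G) (w₀ w₁ : G) (d : ℤ → G) : Prop where
  zero : d 0 = 1
  cover : ∀ g, ∃ n, g ∈ dcoset S (d n)
  disj : ∀ m n g, g ∈ dcoset S (d m) → g ∈ dcoset S (d n) → m = n
  left : ∀ n ≤ 0, ∀ g ∈ dcoset S (d n), w₀ * g ∈ dcoset S (d (1 - n))
  right : ∀ n, 0 ≤ n → ∀ g ∈ dcoset S (d n), w₁ * g ∈ dcoset S (d (-1 - n))

variable {χ : S →* ℂ} {w₀ w₁ : G} {ι₀ ι₁ : Type*} [Fintype ι₀] [Fintype ι₁] {d : ℤ → G}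

/-- The element of the Hecke algebra supported on `S w S`, with value `lam` at `w`. -/
def RankOne.elt {w : G} {ι : Type*} [Finite ι] (R : RankOne χ w ι) (lam : ℂ) : heckeModule χ :=
  ⟨doubleCosetFun χ w lam, R.doubleCosetFun_mem lam⟩

lemma RankOne.elt_mul_self {w : G} {ι : Type*} [Fintype ι] [DecidableEq ι] (R : RankOne χ w ι)
    (lam : ℂ) (hw : w ∉ S) : R.elt lam * R.elt lam =
      (lam * ∑ i ∈ Finset.univ.erase R.base, R.c i) • R.elt lam +
        (Fintype.card ι * lam ^ 2 * χ R.z⁻¹) • 1 :=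
  Subtype.ext (R.conv_self lam hw)

namespace DihedralCosets

variable (H : DihedralCosets S w₀ w₁ d) (R₀ : RankOne χ w₀ ι₀) (R₁ : RankOne χ w₁ ι₁)
  {lam : Fin 2 → ℂ} (hlam : ∀ i, lam i ≠ 0)
include H

lemma disjoint {m n : ℤ} (h : m ≠ n) : Disjoint (dcoset S (d m)) (dcoset S (d n)) :=
  Set.disjoint_left.2 fun g hm hn => h (H.disj m n g hm hn)

include hlam

/-- Combines the two consequences of increasing length: the product is supported on the next double
coset, and it vanishes only if f does. -/
lemma elt_mul_left {n : ℤ} (hn : n ≤ 0) (f : heckeModule χ)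
    (hf : Function.support f.1 ⊆ dcoset S (d n)) (hf0 : f ≠ 0) :
    Function.support (R₀.elt (lam 0) * f).1 ⊆ dcoset S (d (1 - n)) ∧ R₀.elt (lam 0) * f ≠ 0 := by
  refine ⟨RankOne.conv_support_subset (H.left n hn) (fun g hg => mul_mem_dcoset hg)
    (fun g hg => mul_mem_dcoset hg) _ hf, fun h => hf0 ?_⟩
  ext g
  by_cases hg : g ∈ dcoset S (d n)
  · have h1 := R₀.conv_apply_mul (H.left n hn) (fun g hg => mul_mem_dcoset hg)
      (fun g hg => mul_mem_dcoset hg) (H.disjoint (by omega)) (lam 0) f.2 hf hg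
    have h2 : cosetConv S (doubleCosetFun χ w₀ (lam 0)) f.1 = 0 := congrArg Subtype.val h
    rw [h2] at h1
    exact (mul_eq_zero.1 h1.symm).resolve_left (hlam 0)
  · by_contra h
    exact hg (hf h)

lemma elt_mul_right {n : ℤ} (hn : 0 ≤ n) (f : heckeModule χ)
    (hf : Function.support f.1 ⊆ dcoset S (d n)) (hf0 : f ≠ 0) :
    Function.support (R₁.elt (lam 1) * f).1 ⊆ dcoset S (d (-1 - n)) ∧ R₁.elt (lam 1) * f ≠ 0 := by
  refine ⟨RankOne.conv_support_subset (H.right n hn) (fun g hg => mul_mem_dcoset hg)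
    (fun g hg => mul_mem_dcoset hg) _ hf, fun h => hf0 ?_⟩
  ext g
  by_cases hg : g ∈ dcoset S (d n)
  · have h1 := R₁.conv_apply_mul (H.right n hn) (fun g hg => mul_mem_dcoset hg)
      (fun g hg => mul_mem_dcoset hg) (H.disjoint (by omega)) (lam 1) f.2 hf hg
    have h2 : cosetConv S (doubleCosetFun χ w₁ (lam 1)) f.1 = 0 := congrArg Subtype.val h
    rw [h2] at h1
    exact (mul_eq_zero.1 h1.symm).resolve_left (hlam 1)
  · by_contra h
    exact hg (hf h)

/-- By induction on |n|: strip the first letter of the word and apply the length-increasing case to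
the rest. -/
lemma intWord_support (n : ℤ) :
    Function.support (intWord (R₀.elt (lam 0)) (R₁.elt (lam 1)) n).1 ⊆ dcoset S (d n) ∧
      intWord (R₀.elt (lam 0)) (R₁.elt (lam 1)) n ≠ 0 := by
  suffices h : ∀ k : ℕ, ∀ n : ℤ, n.natAbs = k →
      Function.support (intWord (R₀.elt (lam 0)) (R₁.elt (lam 1)) n).1 ⊆ dcoset S (d n) ∧
      intWord (R₀.elt (lam 0)) (R₁.elt (lam 1)) n ≠ 0 from h _ n rfl
  intro k
  induction k with
  | zero =>
    intro n hn
    obtain rfl : n = 0 := by omega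
    rw [intWord_zero, H.zero, heckeModule.coe_one]
    constructor
    · intro g hg
      by_contra hg'
      refine hg (heckeModule.unitFun_of_notMem fun hgS => hg' ⟨⟨g, hgS⟩, 1, by simp⟩)
    · intro h
      have h1 := congrFun (congrArg Subtype.val h) ((1 : S) : G)
      rw [heckeModule.coe_one, heckeModule.unitFun_apply_coe, map_one] at h1
      exact one_ne_zero h1
  | succ k ih =>
    intro n hn
    rcases lt_or_ge 0 n with h0 | h0
    · have h := ih (1 - n) (by omega)
      have := H.elt_mul_left R₀ hlam (by omega : 1 - n ≤ 0) _ h.1 h.2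
      rwa [left_mul_intWord _ _ (by omega : 1 - n ≤ 0), sub_sub_cancel] at this
    · have h := ih (-1 - n) (by omega)
      have := H.elt_mul_right R₁ hlam (by omega : 0 ≤ -1 - n) _ h.1 h.2
      rwa [right_mul_intWord _ _ (by omega : 0 ≤ -1 - n), sub_sub_cancel] at this

lemma intWord_apply_ne_zero (n : ℤ) :
    (intWord (R₀.elt (lam 0)) (R₁.elt (lam 1)) n).1 (d n) ≠ 0 := by
  obtain ⟨h1, h2⟩ := H.intWord_support R₀ R₁ hlam n
  intro h
  apply h2
  ext g
  by_contra hg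
  obtain ⟨k, k', rfl⟩ := h1 hg
  apply hg
  rw [(intWord (R₀.elt (lam 0)) (R₁.elt (lam 1)) n).2.1, h, mul_zero]
  rfl

lemma intWord_apply_of_ne {m n : ℤ} (hmn : m ≠ n) :
    (intWord (R₀.elt (lam 0)) (R₁.elt (lam 1)) m).1 (d n) = 0 := by
  by_contra h
  exact hmn (H.disj m n _ ((H.intWord_support R₀ R₁ hlam m).1 h) (mem_dcoset_self _))

lemma linearIndependent_intWord :
    LinearIndependent ℂ (intWord (R₀.elt (lam 0)) (R₁.elt (lam 1))) := by
  rw [linearIndependent_iff']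
  intro s c hc n hn
  have h := congrFun (congrArg Subtype.val hc) (d n)
  simp only [AddSubmonoidClass.coe_finsetSum, Submodule.coe_smul, Finset.sum_apply,
    Pi.smul_apply, smul_eq_mul] at h
  rw [Finset.sum_eq_single n] at h
  · exact (mul_eq_zero.1 h).resolve_right (H.intWord_apply_ne_zero R₀ R₁ hlam n)
  · intro m _ hmn
    rw [H.intWord_apply_of_ne R₀ R₁ hlam hmn, mul_zero]
  · exact fun h => absurd hn h

/-- The words are supported on pairwise disjoint double cosets, so the expansion of f is diagonal
and its coefficients are quotients of values at the representatives. -/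
lemma span_intWord :
    Submodule.span ℂ (Set.range (intWord (R₀.elt (lam 0)) (R₁.elt (lam 1)))) = ⊤ := by
  set b := intWord (R₀.elt (lam 0)) (R₁.elt (lam 1)) with hb
  rw [eq_top_iff]
  rintro f -
  have hfin : {n : ℤ | f.1 (d n) ≠ 0}.Finite := by
    -- Distinct representatives lie in distinct left cosets, and f meets finitely many of those.
    refine Set.Finite.of_finite_image (f := fun n => (d n : G ⧸ S))
      (f.2.2.subset ?_) ?_
    · rintro _ ⟨n, hn, rfl⟩
      exact ⟨d n, hn, rfl⟩
    · intro m _ n _ hmn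
      refine H.disj m n (d n) ⟨1, ⟨_, QuotientGroup.eq.1 hmn⟩, by simp⟩ (mem_dcoset_self _)
  have hf : f = ∑ n ∈ hfin.toFinset, (f.1 (d n) / (b n).1 (d n)) • b n := by
    ext g
    obtain ⟨m, k, k', rfl⟩ := H.cover g
    rw [f.2.1, (∑ n ∈ hfin.toFinset, (f.1 (d n) / (b n).1 (d n)) • b n).2.1]
    congr 1
    simp only [AddSubmonoidClass.coe_finsetSum, Submodule.coe_smul, Finset.sum_apply,
      Pi.smul_apply, smul_eq_mul]
    rw [Finset.sum_eq_single m]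
    · rw [div_mul_cancel₀ _ (H.intWord_apply_ne_zero R₀ R₁ hlam m)]
    · intro n _ hnm
      rw [hb, H.intWord_apply_of_ne R₀ R₁ hlam hnm, mul_zero]
    · intro hm
      have : f.1 (d m) = 0 := by simpa using hm
      rw [this, zero_div, zero_mul]
  rw [hf]
  exact Submodule.sum_mem _ fun n _ => Submodule.smul_mem _ _ (Submodule.subset_span ⟨n, rfl⟩)

/-- The Hecke algebra is presented by the two rank one elements and their quadratic relations. -/
theorem exists_algEquiv [DecidableEq ι₀] [DecidableEq ι₁] (hw₀ : w₀ ∉ S) (hw₁ : w₁ ∉ S)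
    {a b : Fin 2 → ℂ}
    (ha0 : a 0 = lam 0 * ∑ i ∈ Finset.univ.erase R₀.base, R₀.c i)
    (ha1 : a 1 = lam 1 * ∑ i ∈ Finset.univ.erase R₁.base, R₁.c i)
    (hb0 : b 0 = Fintype.card ι₀ * lam 0 ^ 2 * χ R₀.z⁻¹)
    (hb1 : b 1 = Fintype.card ι₁ * lam 1 ^ 2 * χ R₁.z⁻¹) :
    ∃ Φ : QuadAlg a b ≃ₐ[ℂ] heckeModule χ, Φ (QuadAlg.gen a b 0) = R₀.elt (lam 0) ∧
      Φ (QuadAlg.gen a b 1) = R₁.elt (lam 1) := by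
  have hu : ∀ i, (![R₀.elt (lam 0), R₁.elt (lam 1)] i) * (![R₀.elt (lam 0), R₁.elt (lam 1)] i) =
      a i • (![R₀.elt (lam 0), R₁.elt (lam 1)] i) + b i • 1 := by
    intro i
    fin_cases i
    · change R₀.elt (lam 0) * R₀.elt (lam 0) = a 0 • R₀.elt (lam 0) + b 0 • 1
      rw [R₀.elt_mul_self _ hw₀, ha0, hb0]
    · change R₁.elt (lam 1) * R₁.elt (lam 1) = a 1 • R₁.elt (lam 1) + b 1 • 1
      rw [R₁.elt_mul_self _ hw₁, ha1, hb1]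
  exact ⟨AlgEquiv.ofBijective (QuadAlg.lift _ hu) (QuadAlg.lift_bijective _ hu
    (H.linearIndependent_intWord R₀ R₁ hlam) (H.span_intWord R₀ R₁ hlam)),
    QuadAlg.lift_gen _ hu 0, QuadAlg.lift_gen _ hu 1⟩

end DihedralCosets
end DihedralPresentation

/-! ### The cocycle on the maximal compact subgroup -/

section MaxCompact

variable {p : ℕ} [Fact p.Prime]

lemma ne_zero_of_norm_one {x : ℚ_[p]} (h : ‖x‖ = 1) : x ≠ 0 := by
  rintro rfl
  simp at h

lemma hilb_unit_left {x : ℚ_[p]} (y : ℚ_[p]) (hx : ‖x‖ = 1) :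
    hilb x y = legUnit x ^ y.valuation := by
  rw [hilb, valuation_zero_of_norm_one hx]
  simp

lemma hilb_unit_unit {x y : ℚ_[p]} (hx : ‖x‖ = 1) (hy : ‖y‖ = 1) : hilb x y = 1 := by
  rw [hilb_unit_left y hx, valuation_zero_of_norm_one hy, zpow_zero]

lemma hilb_congr {x y z : ℚ_[p]} (hx : ‖x‖ = 1) (hy : ‖y‖ = 1) (h : legUnit x = legUnit y) :
    hilb x z = hilb y z := by
  rw [hilb_unit_left z hx, hilb_unit_left z hy, h]

/-- The subgroup `SL(2, ℤ_p)` of `SL(2, ℚ_p)`. -/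
def maxCompact (p : ℕ) [Fact p.Prime] : Subgroup SL(2, ℚ_[p]) where
  carrier := {g | ∀ i j, ‖(g i j : ℚ_[p])‖ ≤ 1}
  mul_mem' := by
    intro g h hg hh i j
    rw [mul_entry]
    refine (Padic.nonarchimedean _ _).trans (max_le ?_ ?_) <;> rw [norm_mul] <;>
      exact mul_le_one₀ (hg _ _) (norm_nonneg _) (hh _ _)
  one_mem' := by
    intro i j
    fin_cases i <;> fin_cases j <;> simp
  inv_mem' := by
    intro g hg i j
    rw [Matrix.SpecialLinearGroup.coe_inv, Matrix.adjugate_fin_two]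
    fin_cases i <;> fin_cases j <;> simp [hg _ _]

lemma iwahori_le_maxCompact : iwahori p ≤ maxCompact p := fun _ h => h.1

lemma det_entries (g : SL(2, ℚ_[p])) : g 0 0 * g 1 1 - g 0 1 * g 1 0 = 1 := by
  rw [← Matrix.det_fin_two, g.det_coe]

lemma norm_mul_lt_one_right {x y : ℚ_[p]} (hx : ‖x‖ ≤ 1) (hy : ‖y‖ < 1) : ‖x * y‖ < 1 := by
  rw [norm_mul]
  exact mul_lt_one_of_nonneg_of_lt_one_right hx (norm_nonneg _) hy

lemma norm_mul_lt_one_left {x y : ℚ_[p]} (hx : ‖x‖ < 1) (hy : ‖y‖ ≤ 1) : ‖x * y‖ < 1 := by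
  rw [mul_comm]
  exact norm_mul_lt_one_right hy hx

lemma norm_eq_one_of_mul {x y : ℚ_[p]} (hx : ‖x‖ ≤ 1) (hy : ‖y‖ ≤ 1) (h : ‖x * y‖ = 1) :
    ‖x‖ = 1 ∧ ‖y‖ = 1 := by
  rw [norm_mul] at h
  constructor
  · refine le_antisymm hx (not_lt.1 fun h1 => ?_)
    exact (mul_lt_one_of_nonneg_of_lt_one_left (norm_nonneg _) h1 hy).ne h
  · refine le_antisymm hy (not_lt.1 fun h1 => ?_)
    exact (mul_lt_one_of_nonneg_of_lt_one_right hx (norm_nonneg _) h1).ne h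

/-- If one of the two entries `b`, `c` is in `p ℤ_p`, then `a d` is close to one. -/
lemma maxCompact.near {g : SL(2, ℚ_[p])} (h : ‖g 0 1 * g 1 0‖ < 1) :
    ‖g 0 0 * g 1 1 - 1‖ < 1 := by
  have e : g 0 0 * g 1 1 - 1 = g 0 1 * g 1 0 := by linear_combination det_entries g
  rwa [e]

lemma maxCompact.diag_unit {g : SL(2, ℚ_[p])} (hg : g ∈ maxCompact p)
    (h : ‖g 0 1 * g 1 0‖ < 1) :
    ‖g 0 0‖ = 1 ∧ ‖g 1 1‖ = 1 ∧ legUnit (g 0 0) = legUnit (g 1 1) := by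
  have h1 := maxCompact.near h
  obtain ⟨ha, hd⟩ := norm_eq_one_of_mul (hg 0 0) (hg 1 1) (norm_one_of_near h1)
  refine ⟨ha, hd, ?_⟩
  have h2 := legUnit_near h1
  rw [legUnit_mul (ne_zero_of_norm_one ha) (ne_zero_of_norm_one hd)] at h2
  rw [← mul_one (legUnit (g 0 0)), ← sq_one (legUnit (g 1 1)), ← mul_assoc, h2, one_mul]

lemma sFactor_unit {g : SL(2, ℚ_[p])} (h : ‖g 1 0‖ = 1) : sFactor g = 1 := by
  rw [sFactor, if_neg]
  rintro ⟨-, h2⟩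
  rw [valuation_zero_of_norm_one h] at h2
  simp at h2

/-- For a unit d the symbol (c, d) is already trivial when ord c is even, and τ = d is a unit when c
= 0. The case distinction in the definition of the s-factor therefore disappears. -/
lemma sFactor_of_diag {g : SL(2, ℚ_[p])} (h : ‖g 1 1‖ = 1) :
    sFactor g = hilb (g 1 1) (tau g) := by
  by_cases h0 : g 1 0 = 0
  · rw [tau_of_eq h0, hilb_unit_unit h h, sFactor, if_neg]
    simp [h0]
  · rw [tau_of_ne h0, sFactor]
    split_ifs with h1
    · exact hilb_comm _ _
    · have : Even (g 1 0).valuation := by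
        rw [← Int.not_odd_iff_even]
        exact fun h2 => h1 ⟨mul_ne_zero h0 (ne_zero_of_norm_one h), h2⟩
      obtain ⟨k, hk⟩ := this
      rw [hilb_unit_left _ h, hk, zpow_add, sq_one]

lemma sFactor_congr {g h : SL(2, ℚ_[p])} (e : ∀ j, g 1 j = h 1 j) : sFactor g = sFactor h := by
  rw [sFactor, sFactor, e, e]

lemma sigma_x_left (s : ℚ_[p]) (g : SL(2, ℚ_[p])) : sigma (xMat s) g = 1 := by
  have e : sFactor (xMat s * g) = sFactor g := by
    refine sFactor_congr fun j => ?_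
    rw [mul_entry]
    simp [xMat]
  have e1 : sFactor (xMat s) = 1 := by simp [sFactor, xMat]
  rw [sigma, kub_x, e, e1, one_mul, one_mul, sq_one]

lemma maxCompact.entry_unit {g : SL(2, ℚ_[p])} (hg : g ∈ maxCompact p) (h : ‖g 1 0‖ < 1) :
    ‖g 0 0‖ = 1 ∧ ‖g 1 1‖ = 1 ∧ legUnit (g 0 0) = legUnit (g 1 1) :=
  maxCompact.diag_unit hg (norm_mul_lt_one_right (hg 0 1) h)

/-- If c is a unit, only symbols of units occur. Otherwise d is a unit, and both the first factor
and the product of the s-factors equal (u⁻¹, τ(g)). -/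
lemma sigma_h_left {u : ℚ_[p]} (hu : ‖u‖ = 1) (hu0 : u ≠ 0) {g : SL(2, ℚ_[p])}
    (hg : g ∈ maxCompact p) : sigma (hMat u hu0) g = 1 := by
  have e : ∀ j, (hMat u hu0 * g) 1 j = u⁻¹ * g 1 j := by
    intro j; rw [mul_entry]; simp [hMat]
  have e1 : sFactor (hMat u hu0) = 1 := by simp [sFactor, hMat]
  have e2 : tau (hMat u hu0) = u⁻¹ := by simp [tau, hMat]
  have hu1 : ‖u⁻¹‖ = 1 := by rw [norm_inv, hu, inv_one]
  have hui := inv_ne_zero hu0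
  have ht := tau_ne_zero g
  rw [sigma, kub, e1, tau_h_mul, e2, mul_one]
  rcases (hg 1 0).lt_or_eq with hc | hc
  · obtain ⟨ha, hd, -⟩ := maxCompact.entry_unit hg hc
    have hd' : ‖(hMat u hu0 * g) 1 1‖ = 1 := by rw [e, norm_mul, hu1, hd, one_mul]
    rw [sFactor_of_diag hd, sFactor_of_diag hd', tau_h_mul, e]
    have hd0 := ne_zero_of_norm_one hd
    rw [mul_right_comm u⁻¹ (tau g) u⁻¹, mul_assoc u⁻¹ (tau g) (tau g), hilb_mul_left _ (mul_ne_zero hui hui) ht,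
      hilb_mul_left _ hui hui, sq_one, one_mul, hilb_mul_right _ hui (mul_ne_zero ht ht),
      hilb_mul_self _ ht, mul_one, hilb_mul_left _ hui hd0, hilb_mul_right _ hui ht,
      hilb_mul_right _ hui ht, hilb_unit_unit hu1 hu1, hilb_unit_unit hd hu1, one_mul, one_mul,
      hilb_comm (tau g)]
    generalize hilb u⁻¹ (tau g) = a
    generalize hilb (g 1 1) (tau g) = b
    exact sq_one _
  · have hc' : ‖(hMat u hu0 * g) 1 0‖ = 1 := by rw [e, norm_mul, hu1, hc, one_mul]
    rw [sFactor_unit hc, sFactor_unit hc', tau_of_ne (ne_zero_of_norm_one hc),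
      hilb_unit_unit, mul_one, mul_one] <;> simp [hu, hc]

/-- The cases are: c not a unit, c a unit but a not, both units. A unit enters a Hilbert symbol only
through its Legendre symbol, and the determinant supplies the needed equality: a and d agree in the
first case, -b and c in the second. -/
lemma sigma_w_left {g : SL(2, ℚ_[p])} (hg : g ∈ maxCompact p) :
    sigma (wMat 1 one_ne_zero) g = 1 := by
  have e : ∀ j, (wMat (1 : ℚ_[p]) one_ne_zero * g) 1 j = -g 0 j := by
    intro j; rw [mul_entry]; simp [wMat]
  have e1 : sFactor (wMat (1 : ℚ_[p]) one_ne_zero) = 1 := by simp [sFactor, wMat]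
  have e2 : tau (wMat (1 : ℚ_[p]) one_ne_zero) = -1 := by simp [tau, wMat]
  have hm : ‖(-1 : ℚ_[p])‖ = 1 := by simp
  have hdet := det_entries g
  rw [sigma, kub, e1, e2, mul_one]
  rcases (hg 1 0).lt_or_eq with hc | hc
  · obtain ⟨ha, hd, had⟩ := maxCompact.entry_unit hg hc
    have ha' : ‖(wMat (1 : ℚ_[p]) one_ne_zero * g) 1 0‖ = 1 := by rw [e, norm_neg, ha]
    rw [sFactor_unit ha', sFactor_of_diag hd, mul_one, tau_of_ne (ne_zero_of_norm_one ha'), e]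
    have hae : -g 0 0 * -1 = g 0 0 := by ring
    have ha1 : ‖-g 0 0‖ = 1 := by rw [norm_neg, ha]
    rw [hae, hilb_mul_right _ (ne_zero_of_norm_one ha1) (tau_ne_zero g), hilb_unit_unit ha ha1,
      one_mul, hilb_congr ha hd had, sq_one]
  · rw [sFactor_unit hc, mul_one, tau_of_ne (ne_zero_of_norm_one hc)]
    rcases (hg 0 0).lt_or_eq with ha | ha
    · have hbc : ‖-(g 0 1) * g 1 0 - 1‖ < 1 := by
        have e3 : -(g 0 1) * g 1 0 - 1 = -(g 0 0 * g 1 1) := by linear_combination hdet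
        rw [e3, norm_neg]
        exact norm_mul_lt_one_left ha (hg 1 1)
      obtain ⟨hb, -⟩ := norm_eq_one_of_mul (by simpa using hg 0 1) hc.le (norm_one_of_near hbc)
      have hleg := legUnit_near hbc
      rw [legUnit_mul (ne_zero_of_norm_one hb) (ne_zero_of_norm_one hc)] at hleg
      have hb' : ‖(wMat (1 : ℚ_[p]) one_ne_zero * g) 1 1‖ = 1 := by rw [e, hb]
      have ht := tau_ne_zero (wMat (1 : ℚ_[p]) one_ne_zero * g)
      have hc0 := ne_zero_of_norm_one hc
      rw [sFactor_of_diag hb', e]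
      generalize tau (wMat (1 : ℚ_[p]) one_ne_zero * g) = t at *
      have ht' : t * -1 ≠ 0 := mul_ne_zero ht (by simp)
      rw [hilb_mul_right _ ht hc0, mul_comm t, hilb_mul_left _ (by simp) ht,
        hilb_mul_left _ (by simp) ht, hilb_unit_unit hm hc, one_mul, hilb_comm t (g 1 0)]
      have h3 : hilb t t = hilb (-1) t := hilb_self rfl ht
      have h4 : hilb (-g 0 1) t = hilb (g 1 0) t := by
        refine hilb_congr hb hc ?_
        rw [← mul_one (legUnit (-g 0 1)), ← sq_one (legUnit (g 1 0)), ← mul_assoc, hleg, one_mul]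
      rw [h3, h4, sq_one, one_mul, sq_one]
    · have ha' : ‖(wMat (1 : ℚ_[p]) one_ne_zero * g) 1 0‖ = 1 := by rw [e, norm_neg, ha]
      rw [sFactor_unit ha', mul_one, tau_of_ne (ne_zero_of_norm_one ha'), e]
      exact hilb_unit_unit (by simp [ha]) (by simp [ha, hc])

/-- The cocycle identity propagates triviality from the factors to a product, so it suffices to
treat generators of SL(2, ℤ_p). -/
lemma sigma_mul_left {g g' : SL(2, ℚ_[p])} (hg : ∀ h ∈ maxCompact p, sigma g h = 1)
    (hg' : ∀ h ∈ maxCompact p, sigma g' h = 1) (hmem : g' ∈ maxCompact p) :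
    ∀ h ∈ maxCompact p, sigma (g * g') h = 1 := by
  intro h hh
  have := sigma_cocycle g g' h
  rwa [hg _ hmem, hg _ (mul_mem hmem hh), hg' _ hh, one_mul, one_mul] at this

lemma xMat_mem {s : ℚ_[p]} (hs : ‖s‖ ≤ 1) : xMat s ∈ maxCompact p := by
  intro i j
  fin_cases i <;> fin_cases j <;> simp [xMat, hs]

lemma hMat_mem {u : ℚ_[p]} (hu : ‖u‖ = 1) (hu0 : u ≠ 0) : hMat u hu0 ∈ maxCompact p := by
  intro i j
  fin_cases i <;> fin_cases j <;> simp [hMat, hu]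

lemma wMat_mem {u : ℚ_[p]} (hu : ‖u‖ = 1) (hu0 : u ≠ 0) : wMat u hu0 ∈ maxCompact p := by
  intro i j
  fin_cases i <;> fin_cases j <;> simp [wMat, hu]

/-- The double cover splits over `SL(2, ℤ_p)`. -/
lemma sigma_maxCompact {g h : SL(2, ℚ_[p])} (hg : g ∈ maxCompact p) (hh : h ∈ maxCompact p) :
    sigma g h = 1 := by
  -- The big cell: when c is a unit, all factors of the Bruhat decomposition are integral.
  have key : ∀ g ∈ maxCompact p, ‖g 1 0‖ = 1 → ∀ h ∈ maxCompact p, sigma g h = 1 := by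
    intro g hg hc
    have h0 := ne_zero_of_norm_one hc
    have dg := det_entries g
    have h1 : -(g 1 0)⁻¹ ≠ 0 := by simp [h0]
    have e : g = xMat (g 0 0 * (g 1 0)⁻¹) * (hMat (-(g 1 0)⁻¹) h1 *
        (wMat 1 one_ne_zero * xMat (g 1 1 * (g 1 0)⁻¹))) := by
      ext i j
      simp only [mul_entry]
      fin_cases i <;> fin_cases j <;> simp [xMat, hMat, wMat, h0]
      · field_simp
        linear_combination -dg
      · field_simp
    have hx : ∀ i j, xMat (g i j * (g 1 0)⁻¹) ∈ maxCompact p := fun i j =>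
      xMat_mem (by rw [norm_mul, norm_inv, hc, inv_one, mul_one]; exact hg i j)
    have hu : ‖-(g 1 0)⁻¹‖ = 1 := by rw [norm_neg, norm_inv, hc, inv_one]
    have hw : wMat (1 : ℚ_[p]) one_ne_zero ∈ maxCompact p := wMat_mem (by simp) _
    rw [e]
    refine sigma_mul_left (fun h _ => sigma_x_left _ h) (sigma_mul_left
      (fun h hh => sigma_h_left hu h1 hh) (sigma_mul_left (fun h hh => sigma_w_left hh)
        (fun h _ => sigma_x_left _ h) (hx 1 1)) (mul_mem hw (hx 1 1)))
          (mul_mem (hMat_mem hu h1) (mul_mem hw (hx 1 1)))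
  rcases (hg 1 0).lt_or_eq with hc | hc
  · obtain ⟨ha, -, -⟩ := maxCompact.entry_unit hg hc
    have hw : wMat (1 : ℚ_[p]) one_ne_zero ∈ maxCompact p := wMat_mem (by simp) _
    -- When c is not a unit, a is one, so w(1) g lies in the big cell; h(-1) w(1) w(1) = 1 restores
    -- g.
    have e : g = hMat (-1) (by simp) * (wMat 1 one_ne_zero * (wMat 1 one_ne_zero * g)) := by
      ext i j
      simp only [mul_entry]
      fin_cases i <;> fin_cases j <;> simp [hMat, wMat]
    rw [e]
    refine sigma_mul_left (fun h hh => sigma_h_left (by simp) _ hh) (sigma_mul_left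
      (fun h hh => sigma_w_left hh) (key _ (mul_mem hw hg) ?_) (mul_mem hw hg))
      (mul_mem hw (mul_mem hw hg)) h hh
    rw [mul_entry]
    simp [wMat, ha]
  · exact key g hg hc h hh

end MaxCompact

/-! ### The section g ↦ (g, 1) and the conjugate character on S. -/

section Lift

variable {p : ℕ} [Fact p.Prime]

/-- The element `(g, 1)` of the double cover. -/
def lift (g : SL(2, ℚ_[p])) : Mp p := ⟨g, 1⟩

lemma lift_mul_lift {g h : SL(2, ℚ_[p])} (H : sigma g h = 1) : lift g * lift h = lift (g * h) := by
  rw [lift, lift, Mp.mul_def, H]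
  rfl

lemma lift_mul {g h : SL(2, ℚ_[p])} (hg : g ∈ maxCompact p) (hh : h ∈ maxCompact p) :
    lift g * lift h = lift (g * h) := lift_mul_lift (sigma_maxCompact hg hh)

lemma lift_one : lift (1 : SL(2, ℚ_[p])) = 1 := rfl

lemma lift_inv {g : SL(2, ℚ_[p])} (hg : g ∈ maxCompact p) : (lift g)⁻¹ = lift g⁻¹ := by
  rw [inv_eq_iff_mul_eq_one, lift_mul hg (inv_mem hg), mul_inv_cancel, lift_one]

lemma mem_iwahoriCover {g : Mp p} : g ∈ iwahoriCover p ↔ g.mat ∈ iwahori p := Iff.rfl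

lemma mem_iwahori {g : SL(2, ℚ_[p])} :
    g ∈ iwahori p ↔ (∀ i j, ‖(g i j : ℚ_[p])‖ ≤ 1) ∧ ‖(g 1 0 : ℚ_[p])‖ < 1 := Iff.rfl

/-- The complex conjugate of the genuine character, as a homomorphism. -/
def conjChar (γ : MulChar (ZMod p) ℂ) : iwahoriCover p →* ℂ where
  toFun k := (starRingEnd ℂ) (genuineChar γ k)
  map_one' := by
    simp [genuineChar, Mp.one_def, residue_eq_one]
  map_mul' := by
    rintro ⟨k, hk⟩ ⟨k', hk'⟩
    rw [mem_iwahoriCover] at hk hk'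
    have hσ := sigma_maxCompact (iwahori_le_maxCompact hk) (iwahori_le_maxCompact hk')
    have h1 : residue ((k.mat * k'.mat) 0 0) = residue (k.mat 0 0) * residue (k'.mat 0 0) := by
      have h2 : ‖k.mat 0 0 * k'.mat 0 0‖ ≤ 1 := by
        rw [norm_mul]
        exact mul_le_one₀ (hk.1 _ _) (norm_nonneg _) (hk'.1 _ _)
      -- The upper left entry of the product is aa' + bc' with c' ∈ p ℤ_p, hence congruent to aa'.
      have h3 : ‖k.mat 0 1 * k'.mat 1 0‖ < 1 := norm_mul_lt_one_right (hk.1 _ _) hk'.2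
      rw [mul_entry, ← residue_mul (hk.1 _ _) (hk'.1 _ _)]
      have h4 := (residue_eq_zero_iff h3.le).2 h3
      have h5 : ‖k.mat 0 0 * k'.mat 0 0 + k.mat 0 1 * k'.mat 1 0‖ ≤ 1 :=
        (Padic.nonarchimedean _ _).trans (max_le h2 h3.le)
      rw [residue, dif_pos h3.le] at h4
      rw [residue, residue, dif_pos h2, dif_pos h5, ← add_zero (PadicInt.toZMod (toInt _ h2)), ← h4,
        ← map_add]
      rfl
    simp only [genuineChar, MulMemClass.mk_mul_mk, Mp.mul_def, hσ, mul_one, h1,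
      map_mul, Units.val_mul, Int.cast_mul]
    ring

lemma conjChar_apply (γ : MulChar (ZMod p) ℂ) (k : iwahoriCover p) :
    conjChar γ k = (starRingEnd ℂ) (genuineChar γ k) := rfl

end Lift

/-! ### Topology and integration on the double cover -/

section Topology

variable {p : ℕ} [Fact p.Prime]

namespace Mp

lemma isOpen_mul_congruenceNhd (g : Mp p) {n : ℕ} (hn : 1 ≤ n) :
    IsOpen ((fun k => g * k) '' congruenceNhd n) :=
  TopologicalSpace.isOpen_generateFrom_of_mem ⟨g, n, hn, rfl⟩

lemma one_mem_congruenceNhd (n : ℕ) : (1 : Mp p) ∈ congruenceNhd n := by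
  refine ⟨rfl, fun i j => ?_⟩
  rw [one_def, sub_self, norm_zero]
  positivity

lemma zpow_neg_le_one (n : ℕ) : (p : ℝ) ^ (-(n : ℤ)) ≤ 1 :=
  zpow_le_one_of_nonpos₀ (by exact_mod_cast (Fact.out : p.Prime).one_lt.le) (by omega)

lemma zpow_neg_lt_one {n : ℕ} (hn : 1 ≤ n) : (p : ℝ) ^ (-(n : ℤ)) < 1 :=
  zpow_lt_one_of_neg₀ (by exact_mod_cast (Fact.out : p.Prime).one_lt) (by omega)

lemma mem_maxCompact_of_near {n : ℕ} {k : SL(2, ℚ_[p])}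
    (hk : ∀ i j, ‖(k i j : ℚ_[p]) - (1 : SL(2, ℚ_[p])) i j‖ ≤ (p : ℝ) ^ (-(n : ℤ))) :
    k ∈ maxCompact p := by
  intro i j
  have e : k i j = (k i j - (1 : SL(2, ℚ_[p])) i j) + (1 : SL(2, ℚ_[p])) i j := by ring
  rw [e]
  exact (Padic.nonarchimedean _ _).trans
    (max_le ((hk i j).trans (zpow_neg_le_one n)) ((maxCompact p).one_mem i j))

lemma congruenceNhd_mul {n : ℕ} {k k' : Mp p} (hk : k ∈ congruenceNhd n)
    (hk' : k' ∈ congruenceNhd n) : k * k' ∈ congruenceNhd n := by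
  have hm := mem_maxCompact_of_near hk.2
  have hm' := mem_maxCompact_of_near hk'.2
  refine ⟨?_, fun i j => ?_⟩
  · rw [mul_def]
    simp only
    rw [hk.1, hk'.1, sigma_maxCompact hm hm', one_mul, one_mul]
  · have e : (k * k').mat i j - (1 : SL(2, ℚ_[p])) i j =
        ((k.mat i 0 - (1 : SL(2, ℚ_[p])) i 0) * k'.mat 0 j +
          (k.mat i 1 - (1 : SL(2, ℚ_[p])) i 1) * k'.mat 1 j) +
          (k'.mat i j - (1 : SL(2, ℚ_[p])) i j) := by
      rw [mul_def]
      simp only [mul_entry]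
      fin_cases i <;> simp <;> ring
    rw [e]
    have h1 : ∀ l, ‖(k.mat i l - (1 : SL(2, ℚ_[p])) i l) * k'.mat l j‖ ≤ (p : ℝ) ^ (-(n : ℤ)) := by
      intro l
      rw [norm_mul]
      exact (mul_le_of_le_one_right (norm_nonneg _) (hm' l j)).trans (hk.2 i l)
    exact (Padic.nonarchimedean _ _).trans
      (max_le ((Padic.nonarchimedean _ _).trans (max_le (h1 0) (h1 1))) (hk'.2 i j))

lemma congruenceNhd_subset_iwahoriCover {n : ℕ} (hn : 1 ≤ n) :
    congruenceNhd n ⊆ (iwahoriCover p : Set (Mp p)) := by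
  intro k hk
  have h := (hk.2 1 0).trans_lt (zpow_neg_lt_one hn)
  refine ⟨mem_maxCompact_of_near hk.2, ?_⟩
  change ‖(k.mat 1 0 : ℚ_[p])‖ < 1
  simpa using h

lemma continuous_const_mul (g : Mp p) : Continuous fun x : Mp p => g * x := by
  refine continuous_generateFrom_iff.2 ?_
  rintro _ ⟨g', n, hn, rfl⟩
  have e : (fun x => g * x) ⁻¹' ((fun k => g' * k) '' congruenceNhd n) =
      (fun k => (g⁻¹ * g') * k) '' congruenceNhd n := by
    ext x
    constructor
    · rintro ⟨k, hk, h⟩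
      exact ⟨k, hk, by simp only at h ⊢; rw [mul_assoc, h, inv_mul_cancel_left]⟩
    · rintro ⟨k, hk, rfl⟩
      exact ⟨k, hk, by simp [mul_assoc]⟩
  rw [e]
  exact isOpen_mul_congruenceNhd _ hn

/-- S contains the congruence subgroup of level p, so every union of left cosets of S is open, and
by complement also closed. -/
lemma isOpen_preimage_mk (A : Set (Mp p ⧸ iwahoriCover p)) :
    IsOpen ((QuotientGroup.mk : Mp p → Mp p ⧸ iwahoriCover p) ⁻¹' A) := by
  rw [isOpen_iff_forall_mem_open]
  intro g hg
  refine ⟨_, ?_, isOpen_mul_congruenceNhd g le_rfl, ⟨1, one_mem_congruenceNhd 1, mul_one g⟩⟩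
  rintro _ ⟨k, hk, rfl⟩
  have : ((g * k : Mp p) : Mp p ⧸ iwahoriCover p) = g :=
    QuotientGroup.mk_mul_of_mem g (congruenceNhd_subset_iwahoriCover le_rfl hk)
  rw [Set.mem_preimage, this]
  exact hg

lemma isClosed_preimage_mk (A : Set (Mp p ⧸ iwahoriCover p)) :
    IsClosed ((QuotientGroup.mk : Mp p → Mp p ⧸ iwahoriCover p) ⁻¹' A) := by
  rw [← isOpen_compl_iff, ← Set.preimage_compl]
  exact isOpen_preimage_mk _

lemma preimage_mk_singleton (x : Mp p ⧸ iwahoriCover p) :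
    (QuotientGroup.mk : Mp p → Mp p ⧸ iwahoriCover p) ⁻¹' {x} =
      (fun g => x.out⁻¹ * g) ⁻¹' (iwahoriCover p) := by
  ext g
  rw [Set.mem_preimage, Set.mem_singleton_iff, Set.mem_preimage, SetLike.mem_coe,
    ← QuotientGroup.eq, QuotientGroup.out_eq', eq_comm]

lemma isCompact_iwahori : IsCompact (iwahori p : Set SL(2, ℚ_[p])) := by
  have hemb : Topology.IsEmbedding
      (Subtype.val : SL(2, ℚ_[p]) → Matrix (Fin 2) (Fin 2) ℚ_[p]) :=
    Topology.IsEmbedding.subtypeVal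
  refine hemb.isCompact_iff.2 ?_
  have hc : IsCompact {M : Fin 2 → Fin 2 → ℚ_[p] | ∀ i j, ‖M i j‖ ≤ 1} := by
    have : {M : Fin 2 → Fin 2 → ℚ_[p] | ∀ i j, ‖M i j‖ ≤ 1} =
        Set.univ.pi fun _ => Set.univ.pi fun _ => Metric.closedBall 0 1 := by
      ext M
      simp only [Set.mem_pi, Set.mem_univ, true_implies, mem_closedBall_zero_iff]
      rfl
    rw [this]
    exact isCompact_univ_pi fun _ => isCompact_univ_pi fun _ => isCompact_closedBall _ _
  refine IsCompact.of_isClosed_subset (X := Matrix (Fin 2) (Fin 2) ℚ_[p]) hc ?_ ?_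
  · have : Subtype.val '' (iwahori p : Set SL(2, ℚ_[p])) =
        {M : Matrix (Fin 2) (Fin 2) ℚ_[p] | M.det = 1} ∩
          ({M | ∀ i j, M i j ∈ Metric.closedBall 0 1} ∩ {M | M 1 0 ∈ Metric.ball 0 1}) := by
      ext M
      constructor
      · rintro ⟨g, hg, rfl⟩
        exact ⟨g.2, fun i j => by simpa using hg.1 i j, by simpa using hg.2⟩
      · rintro ⟨h1, h2, h3⟩
        exact ⟨⟨M, h1⟩, ⟨fun i j => by simpa using h2 i j, by simpa using h3⟩, rfl⟩
    rw [this]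
    refine (isClosed_eq (by fun_prop) continuous_const).inter (IsClosed.inter ?_ ?_)
    · simp only [Set.ofPred_forall]
      exact isClosed_iInter fun i => isClosed_iInter fun j =>
        Metric.isClosed_closedBall.preimage (by fun_prop)
    · exact (IsUltrametricDist.isClosed_ball (0 : ℚ_[p]) 1).preimage (by fun_prop)
  · rintro _ ⟨g, hg, rfl⟩ i j
    exact hg.1 i j

instance : CompactSpace (iwahori p) := isCompact_iff_compactSpace.1 isCompact_iwahori

lemma continuous_entry (i j : Fin 2) :
    Continuous fun k : iwahori p => ((k : SL(2, ℚ_[p])) i j : ℚ_[p]) :=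
  Continuous.matrix_elem (A := fun k : iwahori p =>
    ((k : SL(2, ℚ_[p])) : Matrix (Fin 2) (Fin 2) ℚ_[p]))
    (continuous_subtype_val.comp continuous_subtype_val) i j

lemma eventually_near (k : iwahori p) {r : ℝ} (hr : 0 < r) :
    ∀ᶠ k' : iwahori p in nhds k, ∀ i j,
      ‖((k : SL(2, ℚ_[p]))⁻¹ * (k' : SL(2, ℚ_[p]))) i j - (1 : SL(2, ℚ_[p])) i j‖ < r := by
  refine Filter.eventually_all.2 fun i => Filter.eventually_all.2 fun j => ?_
  have hcont : Continuous fun k' : iwahori p =>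
      ‖((k : SL(2, ℚ_[p]))⁻¹ * (k' : SL(2, ℚ_[p]))) i j - (1 : SL(2, ℚ_[p])) i j‖ := by
    simp only [mul_entry]
    exact (((continuous_const.mul (continuous_entry 0 j)).add
      (continuous_const.mul (continuous_entry 1 j))).sub continuous_const).norm
  refine hcont.continuousAt.eventually_lt continuousAt_const ?_
  rw [inv_mul_cancel, sub_self, norm_zero]
  exact hr

/-- Nearby elements k, k' of the Iwahori subgroup satisfy (k', ε) = (k, ε)(k⁻¹k', 1), since the
cocycle is trivial there, and (k⁻¹k', 1) is in a small congruence neighbourhood. Compactness of S is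
thus inherited from the matrix group. -/
lemma continuous_section (ε : ℤˣ) :
    Continuous fun k : iwahori p => (⟨(k : SL(2, ℚ_[p])), ε⟩ : Mp p) := by
  refine continuous_generateFrom_iff.2 ?_
  rintro _ ⟨g, n, hn, rfl⟩
  rw [isOpen_iff_mem_nhds]
  rintro k ⟨m, hm, hk⟩
  have hpos : (0 : ℝ) < (p : ℝ) ^ (-(n : ℤ)) := by
    have : (0 : ℝ) < p := by exact_mod_cast (Fact.out : p.Prime).pos
    positivity
  filter_upwards [eventually_near k hpos] with k' hk'
  have hl : lift ((k : SL(2, ℚ_[p]))⁻¹ * (k' : SL(2, ℚ_[p]))) ∈ congruenceNhd n :=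
    ⟨rfl, fun i j => (hk' i j).le⟩
  refine ⟨m * lift ((k : SL(2, ℚ_[p]))⁻¹ * (k' : SL(2, ℚ_[p]))), congruenceNhd_mul hm hl, ?_⟩
  simp only at hk ⊢
  rw [← mul_assoc, hk, lift, mul_def]
  simp only
  rw [mul_inv_cancel_left, mul_one, sigma_maxCompact (iwahori_le_maxCompact k.2)
    (iwahori_le_maxCompact (mul_mem (inv_mem k.2) k'.2)), mul_one]

lemma isCompact_iwahoriCover : IsCompact (iwahoriCover p : Set (Mp p)) := by
  have e : (iwahoriCover p : Set (Mp p)) =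
      ⋃ ε : ℤˣ, Set.range fun k : iwahori p => (⟨(k : SL(2, ℚ_[p])), ε⟩ : Mp p) := by
    ext g
    rw [Set.mem_iUnion]
    constructor
    · intro hg
      exact ⟨g.sgn, ⟨g.mat, hg⟩, rfl⟩
    · rintro ⟨ε, k, rfl⟩
      exact k.2
  rw [e]
  exact isCompact_iUnion fun ε => isCompact_range (continuous_section ε)

end Mp

/-- The character is trivial on the level p congruence subgroup, so equivariance already forces
local constancy. -/
lemma apply_mul_congruenceNhd {γ : MulChar (ZMod p) ℂ} {f : Mp p → ℂ}
    (hf : f ∈ heckeModule (conjChar γ)) (g : Mp p) {k : Mp p} (hk : k ∈ Mp.congruenceNhd 1) :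
    f (g * k) = f g := by
  have hS := Mp.congruenceNhd_subset_iwahoriCover le_rfl hk
  have h := heckeModule.apply_mul_right hf g ⟨k, hS⟩
  have hr : residue (k.mat 0 0) = 1 := by
    refine residue_eq_one ?_
    have := (hk.2 0 0).trans_lt (Mp.zpow_neg_lt_one le_rfl)
    simpa using this
  rw [conjChar_apply, genuineChar, hk.1, hr] at h
  simpa using h

/-- Left cosets of S are open and compact: a compact support is covered by finitely many of them,
and conversely a finite union of them is compact and closed. -/
lemma mem_heckeSpace_iff {γ : MulChar (ZMod p) ℂ} {f : Mp p → ℂ} :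
    f ∈ heckeSpace γ ↔ f ∈ heckeModule (conjChar γ) := by
  constructor
  · rintro ⟨-, h2, h3⟩
    refine ⟨fun g k k' => h3 g k k.2 k' k'.2, ?_⟩
    obtain ⟨t, ht⟩ := IsCompact.elim_finite_subcover h2
      (fun x => (QuotientGroup.mk : Mp p → Mp p ⧸ iwahoriCover p) ⁻¹' {x})
      (fun x => Mp.isOpen_preimage_mk _) (fun g _ => Set.mem_iUnion.2 ⟨g, rfl⟩)
    refine t.finite_toSet.subset ?_
    rintro _ ⟨g, hg, rfl⟩
    have := ht (subset_tsupport f hg)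
    simpa using this
  · intro hf
    refine ⟨?_, ?_, fun g k hk k' hk' => hf.1 g ⟨k, hk⟩ ⟨k', hk'⟩⟩
    · rw [IsLocallyConstant.iff_exists_open]
      intro g
      refine ⟨_, Mp.isOpen_mul_congruenceNhd g le_rfl,
        ⟨1, Mp.one_mem_congruenceNhd 1, mul_one g⟩, ?_⟩
      rintro _ ⟨k, hk, rfl⟩
      exact apply_mul_congruenceNhd hf g hk
    · refine HasCompactSupport.intro' (K := QuotientGroup.mk ⁻¹' cosetSupport (iwahoriCover p) f)
        ?_ (Mp.isClosed_preimage_mk _) ?_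
      · rw [← Set.biUnion_preimage_singleton]
        refine hf.2.isCompact_biUnion fun x _ => ?_
        have e : (QuotientGroup.mk : Mp p → Mp p ⧸ iwahoriCover p) ⁻¹' {x} =
            (fun g => x.out * g) '' (iwahoriCover p) := by
          rw [Mp.preimage_mk_singleton]
          ext g
          constructor
          · intro hg
            exact ⟨_, hg, mul_inv_cancel_left _ _⟩
          · rintro ⟨k, hk, rfl⟩
            simpa using hk
        rw [e]
        exact Mp.isCompact_iwahoriCover.image (Mp.continuous_const_mul _)
      · intro g hg
        by_contra h
        exact hg ⟨g, h, rfl⟩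

lemma heckeOne_eq_unitFun (γ : MulChar (ZMod p) ℂ) :
    heckeOne γ = heckeModule.unitFun (conjChar γ) := by
  funext g
  rw [heckeOne, heckeModule.unitFun]
  split_ifs <;> rfl

lemma measure_coset {μ : Measure (Mp p)} [μ.IsHaarMeasure]
    (hμ : μ (iwahoriCover p : Set (Mp p)) = 1) (x : Mp p ⧸ iwahoriCover p) :
    μ ((QuotientGroup.mk : Mp p → Mp p ⧸ iwahoriCover p) ⁻¹' {x}) = 1 := by
  have hS : MeasurableSet (iwahoriCover p : Set (Mp p)) := by
    have e : (iwahoriCover p : Set (Mp p)) =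
        (QuotientGroup.mk : Mp p → Mp p ⧸ iwahoriCover p) ⁻¹' {QuotientGroup.mk 1} := by
      ext g
      rw [Set.mem_preimage, Set.mem_singleton_iff, eq_comm, QuotientGroup.eq, inv_one, one_mul]
      rfl
    rw [e]
    exact (Mp.isOpen_preimage_mk _).measurableSet
  rw [Mp.preimage_mk_singleton, ← Measure.map_apply (Mp.continuous_const_mul _).measurable hS,
    map_mul_left_eq_self, hμ]

/-- The integrand is constant on left cosets of S, each of measure 1 by left invariance, so it is a
finite sum of indicator functions. -/
lemma conv_eq_cosetConv {μ : Measure (Mp p)} [μ.IsHaarMeasure]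
    (hμ : μ (iwahoriCover p : Set (Mp p)) = 1) {γ : MulChar (ZMod p) ℂ} {f₁ f₂ : Mp p → ℂ}
    (h₁ : f₁ ∈ heckeModule (conjChar γ)) (h₂ : f₂ ∈ heckeModule (conjChar γ)) :
    conv μ f₁ f₂ = cosetConv (iwahoriCover p) f₁ f₂ := by
  funext h
  rw [heckeModule.conv_apply_eq_sum_finset h₁.2, conv]
  set F : Mp p → ℂ := fun g => f₁ g * f₂ (g⁻¹ * h) with hF
  have e : F = fun g => ∑ x ∈ h₁.2.toFinset,
      ((QuotientGroup.mk : Mp p → Mp p ⧸ iwahoriCover p) ⁻¹' {x}).indicator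
        (fun _ => F x.out) g := by
    funext g
    have hmem : g ∈ (QuotientGroup.mk : Mp p → Mp p ⧸ iwahoriCover p) ⁻¹' {(g : Mp p ⧸ iwahoriCover p)} :=
      Set.mem_singleton (g : Mp p ⧸ iwahoriCover p)
    have hout : F ((g : Mp p ⧸ iwahoriCover p).out) = F g :=
      apply_out (F := F) (heckeModule.conv_summand h₁ h₂ h) g
    rw [Finset.sum_eq_single (g : Mp p ⧸ iwahoriCover p)]
    · rw [Set.indicator_of_mem hmem, hout]
    · intro x _ hx
      rw [Set.indicator_of_notMem]
      exact fun h => hx (Set.mem_singleton_iff.1 (Set.mem_preimage.1 h)).symm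
    · intro hg
      rw [Set.indicator_of_mem hmem, hout, hF]
      have : f₁ g = 0 := by
        by_contra h0
        exact hg (h₁.2.mem_toFinset.2 ⟨g, h0, rfl⟩)
      simp only [this, zero_mul]
  have hm : ∀ x : Mp p ⧸ iwahoriCover p,
      MeasurableSet ((QuotientGroup.mk : Mp p → Mp p ⧸ iwahoriCover p) ⁻¹' {x}) :=
    fun x => (Mp.isOpen_preimage_mk _).measurableSet
  change ∫ g, F g ∂μ = _
  rw [e, integral_finsetSum]
  · refine Finset.sum_congr rfl fun x _ => ?_
    rw [integral_indicator_const _ (hm x), measureReal_def, measure_coset hμ]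
    simp [hF]
  · intro x _
    refine (integrable_indicator_iff (hm x)).2 (integrableOn_const ?_)
    rw [measure_coset hμ]
    simp

end Topology

/-! ### Double cosets of the Iwahori subgroup -/

section Bruhat

variable {p : ℕ} [Fact p.Prime]

/-- The matrix `(1, 0; v, 1)`. -/
def nMat (v : ℚ_[p]) : SL(2, ℚ_[p]) := ⟨!![1, 0; v, 1], by simp [Matrix.det_fin_two]⟩

lemma ext_entries {g h : SL(2, ℚ_[p])} (h00 : g 0 0 = h 0 0) (h01 : g 0 1 = h 0 1)
    (h10 : g 1 0 = h 1 0) (h11 : g 1 1 = h 1 1) : g = h := by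
  ext i j
  fin_cases i <;> fin_cases j <;> assumption

lemma hMat_congr {t t' : ℚ_[p]} (h : t = t') (ht : t ≠ 0) : hMat t ht = hMat t' (h ▸ ht) := by
  subst h; rfl

lemma wMat_congr {t t' : ℚ_[p]} (h : t = t') (ht : t ≠ 0) : wMat t ht = wMat t' (h ▸ ht) := by
  subst h; rfl

lemma hMat_one : hMat (1 : ℚ_[p]) one_ne_zero = 1 := by
  apply ext_entries <;> simp [hMat]

lemma wMat_mul_hMat {s t : ℚ_[p]} (hs : s ≠ 0) (ht : t ≠ 0) :
    wMat s hs * hMat t ht = wMat (s / t) (div_ne_zero hs ht) := by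
  apply ext_entries <;> rw [mul_entry] <;> simp [wMat, hMat] <;> field_simp

lemma hMat_mul_wMat {s t : ℚ_[p]} (hs : s ≠ 0) (ht : t ≠ 0) :
    hMat s hs * wMat t ht = wMat (s * t) (mul_ne_zero hs ht) := by
  apply ext_entries <;> rw [mul_entry] <;> simp [wMat, hMat]
  field_simp

lemma hMat_mul_hMat {s t : ℚ_[p]} (hs : s ≠ 0) (ht : t ≠ 0) :
    hMat s hs * hMat t ht = hMat (s * t) (mul_ne_zero hs ht) := by
  apply ext_entries <;> rw [mul_entry] <;> simp [hMat]
  field_simp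

lemma wMat_mul_wMat {s t : ℚ_[p]} (hs : s ≠ 0) (ht : t ≠ 0) :
    wMat s hs * wMat t ht = hMat (-(s / t)) (neg_ne_zero.2 (div_ne_zero hs ht)) := by
  apply ext_entries <;> rw [mul_entry] <;> simp [wMat, hMat] <;> field_simp

lemma xMat_mul_hMat (s : ℚ_[p]) {t : ℚ_[p]} (ht : t ≠ 0) :
    xMat s * hMat t ht = hMat t ht * xMat (s / t ^ 2) := by
  apply ext_entries <;> rw [mul_entry, mul_entry] <;> simp [xMat, hMat]
  field_simp

lemma nMat_mul_hMat (v : ℚ_[p]) {t : ℚ_[p]} (ht : t ≠ 0) :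
    nMat v * hMat t ht = hMat t ht * nMat (v * t ^ 2) := by
  apply ext_entries <;> rw [mul_entry, mul_entry] <;> simp [nMat, hMat]
  field_simp

lemma xMat_mul_wMat (s : ℚ_[p]) {t : ℚ_[p]} (ht : t ≠ 0) :
    xMat s * wMat t ht = wMat t ht * nMat (-(s / t ^ 2)) := by
  apply ext_entries <;> rw [mul_entry, mul_entry] <;> simp [xMat, wMat, nMat]
  field_simp

lemma nMat_mul_wMat (v : ℚ_[p]) {t : ℚ_[p]} (ht : t ≠ 0) :
    nMat v * wMat t ht = wMat t ht * xMat (-(v * t ^ 2)) := by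
  apply ext_entries <;> rw [mul_entry, mul_entry] <;> simp [xMat, wMat, nMat]
  field_simp

lemma eq_nMat_hMat_xMat {g : SL(2, ℚ_[p])} (h : g 0 0 ≠ 0) :
    g = nMat (g 1 0 / g 0 0) * hMat (g 0 0) h * xMat (g 0 1 / g 0 0) := by
  have dg := det_entries g
  apply ext_entries <;> simp only [mul_entry] <;> simp [xMat, hMat, nMat] <;> field_simp
  linear_combination dg

lemma eq_xMat_hMat_nMat {g : SL(2, ℚ_[p])} (h : g 1 1 ≠ 0) :
    g = xMat (g 0 1 / g 1 1) * hMat (g 1 1)⁻¹ (inv_ne_zero h) * nMat (g 1 0 / g 1 1) := by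
  have dg := det_entries g
  apply ext_entries <;> simp only [mul_entry] <;> simp [xMat, hMat, nMat] <;> field_simp
  linear_combination dg

lemma eq_xMat_wMat_xMat {g : SL(2, ℚ_[p])} (h : g 1 0 ≠ 0) :
    g = xMat (g 0 0 / g 1 0) * wMat (-(g 1 0)⁻¹) (neg_ne_zero.2 (inv_ne_zero h)) *
      xMat (g 1 1 / g 1 0) := by
  have dg := det_entries g
  apply ext_entries <;> simp only [mul_entry] <;> simp [xMat, wMat] <;> field_simp
  linear_combination -dg

lemma eq_nMat_wMat_nMat {g : SL(2, ℚ_[p])} (h : g 0 1 ≠ 0) :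
    g = nMat (g 1 1 / g 0 1) * wMat (g 0 1) h * nMat (g 0 0 / g 0 1) := by
  have dg := det_entries g
  apply ext_entries <;> simp only [mul_entry] <;> simp [nMat, wMat] <;> field_simp
  linear_combination -dg

lemma xMat_mem_iwahori {s : ℚ_[p]} (hs : ‖s‖ ≤ 1) : xMat s ∈ iwahori p :=
  ⟨xMat_mem hs, by simp [xMat]⟩

lemma hMat_mem_iwahori {u : ℚ_[p]} (hu : ‖u‖ = 1) (hu0 : u ≠ 0) : hMat u hu0 ∈ iwahori p :=
  ⟨hMat_mem hu hu0, by simp [hMat]⟩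

lemma nMat_mem_iwahori {v : ℚ_[p]} (hv : ‖v‖ < 1) : nMat v ∈ iwahori p := by
  refine ⟨fun i j => ?_, by simpa [nMat] using hv⟩
  fin_cases i <;> fin_cases j <;> simp [nMat, hv.le]

lemma iwahori_diag {k : SL(2, ℚ_[p])} (hk : k ∈ iwahori p) : ‖k 0 0‖ = 1 ∧ ‖k 1 1‖ = 1 :=
  ⟨(maxCompact.entry_unit hk.1 hk.2).1, (maxCompact.entry_unit hk.1 hk.2).2.1⟩

lemma mem_dcoset_of {G : Type*} [Group G] {S : Subgroup G} {k x k' : G} (hk : k ∈ S)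
    (hk' : k' ∈ S) : k * x * k' ∈ dcoset S x := ⟨⟨k, hk⟩, ⟨k', hk'⟩, rfl⟩

lemma dcoset_trans {G : Type*} [Group G] {S : Subgroup G} {x y g : G} (hg : g ∈ dcoset S x)
    (hx : x ∈ dcoset S y) : g ∈ dcoset S y := by
  obtain ⟨k, k', rfl⟩ := hg
  exact mem_dcoset_mul (mul_mem_dcoset hx k) k'

/-- Every matrix is in the double coset of a monomial matrix. -/
lemma exists_monomial (g : SL(2, ℚ_[p])) :
    ∃ (t : ℚ_[p]) (ht : t ≠ 0), g ∈ dcoset (iwahori p) (hMat t ht) ∨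
      g ∈ dcoset (iwahori p) (wMat t ht) := by
  have dg := det_entries g
  have hle : ∀ {x y : ℚ_[p]}, ‖x‖ ≤ ‖y‖ → ‖x / y‖ ≤ 1 := by
    intro x y h
    rw [norm_div]
    exact div_le_one_of_le₀ h (norm_nonneg _)
  have hlt : ∀ {x y : ℚ_[p]}, ‖x‖ < ‖y‖ → ‖x / y‖ < 1 := by
    intro x y h
    rw [norm_div]
    exact (div_lt_one ((norm_nonneg x).trans_lt h)).2 h
  have hne : ∀ {x y : ℚ_[p]}, ‖x‖ < ‖y‖ → y ≠ 0 := by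
    rintro x _ h rfl
    rw [norm_zero] at h
    exact (norm_nonneg x).not_gt h
  -- Elimination with an entry of largest norm as pivot. The Iwahori condition decides ties:
  -- multipliers in lower unipotents must have norm < 1, those in upper unipotents only norm ≤ 1. So
  -- b needs strict inequalities, c weak ones, and a, d one of each.
  have pivot_a : ‖g 1 0‖ < ‖g 0 0‖ → ‖g 0 1‖ ≤ ‖g 0 0‖ → ∃ (t : ℚ_[p]) (ht : t ≠ 0),
      g ∈ dcoset (iwahori p) (hMat t ht) ∨ g ∈ dcoset (iwahori p) (wMat t ht) := by
    intro h1 h2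
    refine ⟨g 0 0, hne h1, Or.inl ?_⟩
    have := mem_dcoset_of (x := hMat (g 0 0) (hne h1)) (nMat_mem_iwahori (hlt h1))
      (xMat_mem_iwahori (hle h2))
    rwa [← eq_nMat_hMat_xMat (hne h1)] at this
  have pivot_d : ‖g 1 0‖ < ‖g 1 1‖ → ‖g 0 1‖ ≤ ‖g 1 1‖ → ∃ (t : ℚ_[p]) (ht : t ≠ 0),
      g ∈ dcoset (iwahori p) (hMat t ht) ∨ g ∈ dcoset (iwahori p) (wMat t ht) := by
    intro h1 h2
    refine ⟨(g 1 1)⁻¹, inv_ne_zero (hne h1), Or.inl ?_⟩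
    have := mem_dcoset_of (x := hMat (g 1 1)⁻¹ (inv_ne_zero (hne h1)))
      (xMat_mem_iwahori (hle h2)) (nMat_mem_iwahori (hlt h1))
    rwa [← eq_xMat_hMat_nMat (hne h1)] at this
  have pivot_b : ‖g 1 1‖ < ‖g 0 1‖ → ‖g 0 0‖ < ‖g 0 1‖ → ∃ (t : ℚ_[p]) (ht : t ≠ 0),
      g ∈ dcoset (iwahori p) (hMat t ht) ∨ g ∈ dcoset (iwahori p) (wMat t ht) := by
    intro h1 h2
    refine ⟨g 0 1, hne h1, Or.inr ?_⟩
    have := mem_dcoset_of (x := wMat (g 0 1) (hne h1)) (nMat_mem_iwahori (hlt h1))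
      (nMat_mem_iwahori (hlt h2))
    rwa [← eq_nMat_wMat_nMat (hne h1)] at this
  rcases le_or_gt ‖g 0 0‖ ‖g 1 0‖ with h1 | h1
  · rcases le_or_gt ‖g 1 1‖ ‖g 1 0‖ with h2 | h2
    · have hc : g 1 0 ≠ 0 := by
        intro h
        rw [h, norm_zero] at h1
        rw [h, norm_le_zero_iff.1 h1] at dg
        simp at dg
      refine ⟨_, neg_ne_zero.2 (inv_ne_zero hc), Or.inr ?_⟩
      have := mem_dcoset_of (x := wMat (-(g 1 0)⁻¹) (neg_ne_zero.2 (inv_ne_zero hc)))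
        (xMat_mem_iwahori (hle h1)) (xMat_mem_iwahori (hle h2))
      rwa [← eq_xMat_wMat_xMat hc] at this
    · rcases le_or_gt ‖g 0 1‖ ‖g 1 1‖ with h3 | h3
      · exact pivot_d h2 h3
      · exact pivot_b h3 (h1.trans_lt (h2.trans h3))
  · rcases le_or_gt ‖g 0 1‖ ‖g 0 0‖ with h3 | h3
    · exact pivot_a h1 h3
    · rcases le_or_gt ‖g 0 1‖ ‖g 1 1‖ with h2 | h2
      · exact pivot_d (h1.trans (h3.trans_le h2)) h2
      · exact pivot_b h2 h3

lemma exists_intertwine {G : Type*} [Group G] {S : Subgroup G} {x y g : G} (hx : g ∈ dcoset S x)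
    (hy : g ∈ dcoset S y) : ∃ k ∈ S, ∃ k' ∈ S, k * x = y * k' := by
  obtain ⟨k, k', rfl⟩ := hx
  obtain ⟨l, l', h⟩ := hy
  refine ⟨(l : G)⁻¹ * k, mul_mem (inv_mem l.2) k.2, (l' : G) * (k' : G)⁻¹, mul_mem l'.2 (inv_mem k'.2), ?_⟩
  rw [mul_assoc, inv_mul_eq_iff_eq_mul, ← mul_assoc y, ← mul_assoc (l : G), ← mul_assoc (l : G),
    ← h, mul_inv_cancel_right]

lemma hMat_inter {t s : ℚ_[p]} (ht : t ≠ 0) (hs : s ≠ 0) {g : SL(2, ℚ_[p])}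
    (h1 : g ∈ dcoset (iwahori p) (hMat t ht)) (h2 : g ∈ dcoset (iwahori p) (hMat s hs)) :
    ‖t‖ = ‖s‖ := by
  obtain ⟨k, hk, k', hk', e⟩ := exists_intertwine h1 h2
  have e1 := congrArg (fun g : SL(2, ℚ_[p]) => ‖g 0 0‖) e
  simp only [mul_entry] at e1
  simpa [hMat, (iwahori_diag hk).1, (iwahori_diag hk').1] using e1

lemma wMat_inter {t s : ℚ_[p]} (ht : t ≠ 0) (hs : s ≠ 0) {g : SL(2, ℚ_[p])}
    (h1 : g ∈ dcoset (iwahori p) (wMat t ht)) (h2 : g ∈ dcoset (iwahori p) (wMat s hs)) :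
    ‖t‖ = ‖s‖ := by
  obtain ⟨k, hk, k', hk', e⟩ := exists_intertwine h1 h2
  have e1 := congrArg (fun g : SL(2, ℚ_[p]) => ‖g 0 1‖) e
  simp only [mul_entry] at e1
  simpa [wMat, (iwahori_diag hk).1, (iwahori_diag hk').2] using e1

/-- Comparing diagonal entries in k h(t) = w(s) k' gives |t| = |s||c'| < |s| and |t|⁻¹ = |s|⁻¹|b'| ≤
|s|⁻¹, which are incompatible. -/
lemma hMat_wMat_inter {t s : ℚ_[p]} (ht : t ≠ 0) (hs : s ≠ 0) {g : SL(2, ℚ_[p])}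
    (h1 : g ∈ dcoset (iwahori p) (hMat t ht)) (h2 : g ∈ dcoset (iwahori p) (wMat s hs)) :
    False := by
  obtain ⟨k, hk, k', hk', e⟩ := exists_intertwine h1 h2
  have e0 := congrArg (fun g : SL(2, ℚ_[p]) => ‖g 0 0‖) e
  have e1 := congrArg (fun g : SL(2, ℚ_[p]) => ‖g 1 1‖) e
  simp only [mul_entry] at e0 e1
  simp [hMat, wMat, (iwahori_diag hk).1] at e0
  simp [hMat, wMat, (iwahori_diag hk).2] at e1
  have hs' : 0 < ‖s‖ := norm_pos_iff.2 hs
  have h3 : ‖t‖ < ‖s‖ := by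
    rw [e0]
    exact mul_lt_of_lt_one_right hs' hk'.2
  have h4 : ‖t‖⁻¹ ≤ ‖s‖⁻¹ := by
    rw [e1]
    exact mul_le_of_le_one_right (inv_nonneg.2 hs'.le) (hk'.1 0 1)
  exact h3.not_ge ((inv_le_inv₀ (norm_pos_iff.2 ht) hs').1 h4)

/-- The monomial matrices `h(p ^ (n / 2))` (`n` even) and `w(p ^ ((n - 1) / 2))` (`n` odd). -/
def monMat (p : ℕ) [Fact p.Prime] (n : ℤ) : SL(2, ℚ_[p]) :=
  -- The division rounds down, so n = 1 is w(1) and n = -1 is w(p⁻¹), as the signed length requires.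
  if Even n then hMat ((p : ℚ_[p]) ^ (n / 2)) (zpow_ne_zero _ p_ne)
  else wMat ((p : ℚ_[p]) ^ (n / 2)) (zpow_ne_zero _ p_ne)

lemma monMat_even (j : ℤ) :
    monMat p (2 * j) = hMat ((p : ℚ_[p]) ^ j) (zpow_ne_zero _ p_ne) := by
  rw [monMat, if_pos (even_two_mul j)]
  exact hMat_congr (by congr 1; omega) _

lemma monMat_odd (j : ℤ) :
    monMat p (2 * j + 1) = wMat ((p : ℚ_[p]) ^ j) (zpow_ne_zero _ p_ne) := by
  rw [monMat, if_neg (by simp)]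
  exact wMat_congr (by congr 1; omega) _

lemma norm_div_eq_one {t s : ℚ_[p]} (ht : t ≠ 0) (h : ‖t‖ = ‖s‖) : ‖t / s‖ = 1 := by
  rw [norm_div, ← h, div_self (norm_ne_zero_iff.2 ht)]

lemma hMat_mem_monMat {t : ℚ_[p]} (ht : t ≠ 0) {j : ℤ} (h : ‖t‖ = ‖(p : ℚ_[p]) ^ j‖) :
    hMat t ht ∈ dcoset (iwahori p) (monMat p (2 * j)) := by
  have hp : (p : ℚ_[p]) ^ j ≠ 0 := zpow_ne_zero _ p_ne
  have := mem_dcoset_of (x := monMat p (2 * j))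
    (hMat_mem_iwahori (norm_div_eq_one ht h) (div_ne_zero ht hp)) (one_mem (iwahori p))
  rw [mul_one, monMat_even, hMat_mul_hMat] at this
  rw [monMat_even]
  rwa [hMat_congr (div_mul_cancel₀ t hp)] at this

lemma wMat_mem_monMat {t : ℚ_[p]} (ht : t ≠ 0) {j : ℤ} (h : ‖t‖ = ‖(p : ℚ_[p]) ^ j‖) :
    wMat t ht ∈ dcoset (iwahori p) (monMat p (2 * j + 1)) := by
  have hp : (p : ℚ_[p]) ^ j ≠ 0 := zpow_ne_zero _ p_ne
  have := mem_dcoset_of (x := monMat p (2 * j + 1))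
    (hMat_mem_iwahori (norm_div_eq_one ht h) (div_ne_zero ht hp)) (one_mem (iwahori p))
  rw [mul_one, monMat_odd, hMat_mul_wMat] at this
  rw [monMat_odd]
  rwa [wMat_congr (div_mul_cancel₀ t hp)] at this

lemma norm_eq_zpow_valuation {t : ℚ_[p]} (ht : t ≠ 0) : ‖t‖ = ‖(p : ℚ_[p]) ^ t.valuation‖ := by
  rw [Padic.norm_eq_zpow_neg_valuation ht, Padic.norm_p_zpow]

lemma monMat_cover (g : SL(2, ℚ_[p])) : ∃ n, g ∈ dcoset (iwahori p) (monMat p n) := by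
  obtain ⟨t, ht, h | h⟩ := exists_monomial g
  · exact ⟨_, dcoset_trans h (hMat_mem_monMat ht (norm_eq_zpow_valuation ht))⟩
  · exact ⟨_, dcoset_trans h (wMat_mem_monMat ht (norm_eq_zpow_valuation ht))⟩

lemma zpow_norm_injective {i j : ℤ} (h : ‖(p : ℚ_[p]) ^ i‖ = ‖(p : ℚ_[p]) ^ j‖) : i = j := by
  rw [Padic.norm_p_zpow, Padic.norm_p_zpow] at h
  have hp : (1 : ℝ) < p := by exact_mod_cast (Fact.out : p.Prime).one_lt
  have := zpow_right_injective₀ (by positivity) hp.ne' h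
  omega

lemma monMat_disj (m n : ℤ) (g : SL(2, ℚ_[p])) (hm : g ∈ dcoset (iwahori p) (monMat p m))
    (hn : g ∈ dcoset (iwahori p) (monMat p n)) : m = n := by
  obtain ⟨i, rfl | rfl⟩ := Int.even_or_odd' m <;> obtain ⟨j, rfl | rfl⟩ := Int.even_or_odd' n
  · rw [monMat_even] at hm hn
    rw [zpow_norm_injective (hMat_inter _ _ hm hn)]
  · rw [monMat_even] at hm
    rw [monMat_odd] at hn
    exact (hMat_wMat_inter _ _ hm hn).elim
  · rw [monMat_odd] at hm
    rw [monMat_even] at hn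
    exact (hMat_wMat_inter _ _ hn hm).elim
  · rw [monMat_odd] at hm hn
    rw [zpow_norm_injective (wMat_inter _ _ hm hn)]

/-- If k = s u, with s moving to the left past w and u to the right past x, then w k x k' = s' (w x)
u' k' stays in one double coset. -/
lemma mul_mem_dcoset_of_factor {G : Type*} [Group G] {S : Subgroup G} {w x y : G}
    (hy : w * x ∈ dcoset S y)
    (H : ∀ k ∈ S, ∃ s u : G, ∃ s' ∈ S, ∃ u' ∈ S, k = s * u ∧ w * s = s' * w ∧ u * x = x * u')
    {g : G} (hg : g ∈ dcoset S x) : w * g ∈ dcoset S y := by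
  obtain ⟨k, k', rfl⟩ := hg
  obtain ⟨s, u, s', hs', u', hu', hk, h1, h2⟩ := H k k.2
  have e : w * (k * x * k') = s' * (w * x) * (u' * k') := by
    rw [hk, mul_assoc s, h2, ← mul_assoc, ← mul_assoc, ← mul_assoc, h1]
    simp only [mul_assoc]
  rw [e]
  exact mem_dcoset_mul (mul_mem_dcoset hy ⟨s', hs'⟩) ⟨u' * k', mul_mem hu' k'.2⟩

lemma norm_zpow_le_one {j : ℤ} (hj : 0 ≤ j) : ‖(p : ℚ_[p]) ^ j‖ ≤ 1 := by
  rw [Padic.norm_p_zpow]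
  exact zpow_le_one_of_nonpos₀ (by exact_mod_cast (Fact.out : p.Prime).one_lt.le) (by omega)

lemma norm_zpow_lt_one {j : ℤ} (hj : 0 < j) : ‖(p : ℚ_[p]) ^ j‖ < 1 := by
  rw [Padic.norm_p_zpow]
  exact zpow_lt_one_of_neg₀ (by exact_mod_cast (Fact.out : p.Prime).one_lt) (by omega)

lemma div_zpow_sq (s : ℚ_[p]) (j : ℤ) :
    s / ((p : ℚ_[p]) ^ j) ^ 2 = s * (p : ℚ_[p]) ^ (-(2 * j)) := by
  rw [← zpow_natCast, ← zpow_mul, div_eq_mul_inv, ← zpow_neg]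
  congr 2
  push_cast
  ring

lemma mul_zpow_sq (s : ℚ_[p]) (j : ℤ) :
    s * ((p : ℚ_[p]) ^ j) ^ 2 = s * (p : ℚ_[p]) ^ (2 * j) := by
  rw [← zpow_natCast, ← zpow_mul]
  congr 2
  push_cast
  ring

/-- Left multiplication by `w(1)` increases the length on the double cosets with `n ≤ 0`. -/
lemma wMat_one_mul_monMat {n : ℤ} (hn : n ≤ 0) {g : SL(2, ℚ_[p])}
    (hg : g ∈ dcoset (iwahori p) (monMat p n)) :
    wMat 1 one_ne_zero * g ∈ dcoset (iwahori p) (monMat p (1 - n)) := by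
  -- In k = n(v) h(a) x(s), conjugation by w(1) keeps the first two factors in the Iwahori subgroup.
  -- The root subgroup of x(s) must pass the representative, which is possible because n ≤ 0.
  have factor : ∀ x : SL(2, ℚ_[p]), (∀ s : ℚ_[p], ‖s‖ ≤ 1 → ∃ u' ∈ iwahori p,
      xMat s * x = x * u') → ∀ k ∈ iwahori p, ∃ s u : SL(2, ℚ_[p]), ∃ s' ∈ iwahori p,
      ∃ u' ∈ iwahori p, k = s * u ∧ wMat 1 one_ne_zero * s = s' * wMat 1 one_ne_zero ∧
        u * x = x * u' := by
    intro x hx k hk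
    have ha := (iwahori_diag hk).1
    have ha0 := ne_zero_of_norm_one ha
    obtain ⟨u', hu', e⟩ := hx (k 0 1 / k 0 0) (by rw [norm_div, ha, div_one]; exact hk.1 0 1)
    refine ⟨nMat (k 1 0 / k 0 0) * hMat (k 0 0) ha0, xMat (k 0 1 / k 0 0),
      xMat (-(k 1 0 / k 0 0)) * hMat (k 0 0)⁻¹ (inv_ne_zero ha0),
      mul_mem (xMat_mem_iwahori ?_) (hMat_mem_iwahori (by rw [norm_inv, ha, inv_one]) _),
      u', hu', eq_nMat_hMat_xMat ha0, ?_, e⟩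
    · rw [norm_neg, norm_div, ha, div_one]
      exact hk.1 1 0
    · apply ext_entries <;> simp only [mul_entry] <;> simp [xMat, wMat, nMat, hMat, ha0]
  obtain ⟨j, rfl | rfl⟩ := Int.even_or_odd' n
  · refine mul_mem_dcoset_of_factor ?_ (factor _ ?_) hg
    · rw [monMat_even, wMat_mul_hMat]
      have := wMat_mem_monMat (j := -j) (div_ne_zero one_ne_zero (zpow_ne_zero j (p_ne (p := p))))
        (by rw [zpow_neg, one_div])
      rwa [show 2 * -j + 1 = 1 - 2 * j by ring] at this
    · intro s hs
      rw [monMat_even]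
      refine ⟨_, xMat_mem_iwahori ?_, xMat_mul_hMat s _⟩
      rw [div_zpow_sq, norm_mul]
      exact mul_le_one₀ hs (norm_nonneg _) (norm_zpow_le_one (by omega))
  · refine mul_mem_dcoset_of_factor ?_ (factor _ ?_) hg
    · rw [monMat_odd, wMat_mul_wMat]
      have := hMat_mem_monMat (j := -j)
        (neg_ne_zero.2 (div_ne_zero one_ne_zero (zpow_ne_zero j (p_ne (p := p)))))
        (by rw [zpow_neg, one_div, norm_neg])
      rwa [show 2 * -j = 1 - (2 * j + 1) by ring] at this
    · intro s hs
      rw [monMat_odd]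
      refine ⟨_, nMat_mem_iwahori ?_, xMat_mul_wMat s _⟩
      rw [div_zpow_sq, norm_neg]
      exact norm_mul_lt_one_right hs (norm_zpow_lt_one (by omega))

/-- Left multiplication by `w(p⁻¹)` increases the length on the double cosets with `n ≥ 0`. -/
lemma wMat_inv_mul_monMat {n : ℤ} (hn : 0 ≤ n) {g : SL(2, ℚ_[p])}
    (hg : g ∈ dcoset (iwahori p) (monMat p n)) :
    wMat (p : ℚ_[p])⁻¹ (inv_ne_zero p_ne) * g ∈ dcoset (iwahori p) (monMat p (-1 - n)) := by
  have hp := p_ne (p := p)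
  have hp1 : ‖(p : ℚ_[p])‖ < 1 := Padic.norm_p_lt_one
  -- The opposite order k = x(s) h n(v): conjugation by w(p⁻¹) sends x(s) to n(-s p²), and n(v)
  -- passes the representative because n ≥ 0.
  have factor : ∀ x : SL(2, ℚ_[p]), (∀ s : ℚ_[p], ‖s‖ < 1 → ∃ u' ∈ iwahori p,
      nMat s * x = x * u') → ∀ k ∈ iwahori p, ∃ s u : SL(2, ℚ_[p]), ∃ s' ∈ iwahori p,
      ∃ u' ∈ iwahori p, k = s * u ∧
        wMat (p : ℚ_[p])⁻¹ (inv_ne_zero hp) * s = s' * wMat (p : ℚ_[p])⁻¹ (inv_ne_zero hp) ∧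
        u * x = x * u' := by
    intro x hx k hk
    have hd := (iwahori_diag hk).2
    have hd0 := ne_zero_of_norm_one hd
    obtain ⟨u', hu', e⟩ := hx (k 1 0 / k 1 1) (by rw [norm_div, hd, div_one]; exact hk.2)
    refine ⟨xMat (k 0 1 / k 1 1) * hMat (k 1 1)⁻¹ (inv_ne_zero hd0), nMat (k 1 0 / k 1 1),
      nMat (-(k 0 1 / k 1 1 * ((p : ℚ_[p]) * (p : ℚ_[p])))) * hMat (k 1 1) hd0,
      mul_mem (nMat_mem_iwahori ?_) (hMat_mem_iwahori hd _),
      u', hu', eq_xMat_hMat_nMat hd0, ?_, e⟩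
    · rw [norm_neg]
      refine norm_mul_lt_one_right ?_ (norm_mul_lt_one_right hp1.le hp1)
      rw [norm_div, hd, div_one]
      exact hk.1 0 1
    · apply ext_entries <;> simp only [mul_entry] <;> simp [xMat, wMat, nMat, hMat] <;> field_simp
  obtain ⟨j, rfl | rfl⟩ := Int.even_or_odd' n
  · refine mul_mem_dcoset_of_factor ?_ (factor _ ?_) hg
    · rw [monMat_even, wMat_mul_hMat]
      have := wMat_mem_monMat (j := -1 - j) (div_ne_zero (inv_ne_zero hp) (zpow_ne_zero j hp))
        (by rw [zpow_sub₀ hp, zpow_neg_one])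
      rwa [show 2 * (-1 - j) + 1 = -1 - 2 * j by ring] at this
    · intro s hs
      rw [monMat_even]
      refine ⟨_, nMat_mem_iwahori ?_, nMat_mul_hMat s _⟩
      rw [mul_zpow_sq]
      exact norm_mul_lt_one_left hs (norm_zpow_le_one (by omega))
  · refine mul_mem_dcoset_of_factor ?_ (factor _ ?_) hg
    · rw [monMat_odd, wMat_mul_wMat]
      have := hMat_mem_monMat (j := -1 - j)
        (neg_ne_zero.2 (div_ne_zero (inv_ne_zero hp) (zpow_ne_zero j hp)))
        (by rw [zpow_sub₀ hp, zpow_neg_one, norm_neg])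
      rwa [show 2 * (-1 - j) = -1 - (2 * j + 1) by ring] at this
    · intro s hs
      rw [monMat_odd]
      refine ⟨_, xMat_mem_iwahori ?_, nMat_mul_wMat s _⟩
      rw [mul_zpow_sq, norm_neg]
      exact (norm_mul_lt_one_left hs (norm_zpow_le_one (by omega))).le

/-- S is a full inverse image and contains the kernel {±1}, so signs play no role in the double
coset combinatorics. -/
lemma mem_dcoset_iwahoriCover {x g : Mp p} :
    g ∈ dcoset (iwahoriCover p) x ↔ g.mat ∈ dcoset (iwahori p) x.mat := by
  constructor
  · rintro ⟨k, k', rfl⟩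
    exact ⟨⟨_, k.2⟩, ⟨_, k'.2⟩, rfl⟩
  · rintro ⟨k, k', h⟩
    have hl : (lift (k : SL(2, ℚ_[p])) * x * lift (k' : SL(2, ℚ_[p])))⁻¹ * g ∈ iwahoriCover p := by
      rw [mem_iwahoriCover]
      change (k * x.mat * k')⁻¹ * g.mat ∈ iwahori p
      rw [h, inv_mul_cancel]
      exact one_mem _
    have := mem_dcoset_of (x := x) (S := iwahoriCover p) (k := lift (k : SL(2, ℚ_[p])))
      k.2 (mul_mem (show lift (k' : SL(2, ℚ_[p])) ∈ iwahoriCover p from k'.2) hl)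
    rwa [← mul_assoc, mul_inv_cancel_left] at this

/-- The double cosets of the inverse image of the Iwahori subgroup. -/
lemma dihedralCosets (p : ℕ) [Fact p.Prime] :
    DihedralCosets (iwahoriCover p) (lift (wMat (1 : ℚ_[p]) one_ne_zero))
      (lift (wMat (p : ℚ_[p])⁻¹ (inv_ne_zero p_ne))) fun n => lift (monMat p n) where
  zero := by
    have := monMat_even (p := p) 0
    rw [hMat_congr (zpow_zero _), hMat_one] at this
    exact congrArg lift this
  cover g := by
    obtain ⟨n, hn⟩ := monMat_cover g.mat
    refine ⟨n, ?_⟩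
    rwa [mem_dcoset_iwahoriCover]
  disj m n g hm hn := by
    rw [mem_dcoset_iwahoriCover] at hm hn
    exact monMat_disj m n g.mat hm hn
  left n hn g hg := by
    rw [mem_dcoset_iwahoriCover] at hg ⊢
    exact wMat_one_mul_monMat hn hg
  right n hn g hg := by
    rw [mem_dcoset_iwahoriCover] at hg ⊢
    exact wMat_inv_mul_monMat hn hg

end Bruhat

/-! ### The two rank one elements -/

section Residue

variable {p : ℕ} [Fact p.Prime]

lemma residue_sub {x y : ℚ_[p]} (hx : ‖x‖ ≤ 1) (hy : ‖y‖ ≤ 1) :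
    residue (x - y) = residue x - residue y := by
  have hxy : ‖x - y‖ ≤ 1 := by
    rw [sub_eq_add_neg]
    exact (Padic.nonarchimedean _ _).trans (max_le hx (by rwa [norm_neg]))
  rw [residue, residue, residue, dif_pos hx, dif_pos hy, dif_pos hxy, ← map_sub]
  rfl

lemma norm_natCast_le_one (n : ℕ) : ‖(n : ℚ_[p])‖ ≤ 1 := by
  exact_mod_cast PadicInt.norm_le_one (n : ℤ_[p])

lemma residue_natCast (n : ℕ) : residue (n : ℚ_[p]) = n := by
  rw [residue, dif_pos (norm_natCast_le_one n), ← map_natCast (PadicInt.toZMod (p := p))]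
  congr 1

lemma residue_val (b : ZMod p) : residue (b.val : ℚ_[p]) = b := by
  rw [residue_natCast, ZMod.natCast_zmod_val]

lemma norm_sub_lt_one_iff {x y : ℚ_[p]} (hx : ‖x‖ ≤ 1) (hy : ‖y‖ ≤ 1) :
    ‖x - y‖ < 1 ↔ residue x = residue y := by
  have hxy : ‖x - y‖ ≤ 1 := by
    rw [sub_eq_add_neg]
    exact (Padic.nonarchimedean _ _).trans (max_le hx (by rwa [norm_neg]))
  rw [← residue_eq_zero_iff hxy, residue_sub hx hy, sub_eq_zero]

lemma norm_val_residue_sub {y : ℚ_[p]} (hy : ‖y‖ ≤ 1) : ‖((residue y).val : ℚ_[p]) - y‖ < 1 :=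
  (norm_sub_lt_one_iff (norm_natCast_le_one _) hy).2 (residue_val _)

lemma eq_of_norm_val_sub_lt {i j : ZMod p} (h : ‖(i.val : ℚ_[p]) - j.val‖ < 1) : i = j := by
  rw [norm_sub_lt_one_iff (norm_natCast_le_one _) (norm_natCast_le_one _), residue_val,
    residue_val] at h
  exact h

lemma norm_val_eq_one {b : ZMod p} (hb : b ≠ 0) : ‖(b.val : ℚ_[p])‖ = 1 := by
  refine le_antisymm (norm_natCast_le_one _) (not_lt.1 fun h => hb ?_)
  rw [← residue_val b]
  exact (residue_eq_zero_iff h.le).2 h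

/-- Discreteness of the valuation: norm < 1 means norm ≤ p⁻¹. -/
lemma norm_div_p_le_one_iff {x : ℚ_[p]} : ‖x / p‖ ≤ 1 ↔ ‖x‖ < 1 := by
  have h := Padic.norm_le_pow_iff_norm_lt_pow_add_one x (-1)
  rw [neg_add_cancel, zpow_zero] at h
  have hp : (0 : ℝ) < p := by exact_mod_cast (Fact.out : p.Prime).pos
  rw [← h, norm_div, Padic.norm_p, div_inv_eq_mul, zpow_neg_one, ← one_div, le_div_iff₀ hp]

lemma residue_neg_one : residue (-1 : ℚ_[p]) = -1 := by
  have := residue_sub (x := (0 : ℚ_[p])) (y := 1) (by simp) (by simp)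
  rw [zero_sub, residue_eq_one (x := (1 : ℚ_[p])) (by simp),
    (residue_eq_zero_iff (x := (0 : ℚ_[p])) (by simp)).2 (by simp), zero_sub] at this
  exact this

lemma legUnit_coe_of_norm_one {x : ℚ_[p]} (hx : ‖x‖ = 1) :
    (legUnit x : ℤ) = quadraticChar (ZMod p) (residue x) := by
  rw [legUnit_coe (ne_zero_of_norm_one hx), unitPart, valuation_zero_of_norm_one hx]
  simp

end Residue

/-! ### Characters with values 0, ±1, which treat both choices of γ together. -/

section QuadraticCharacter

variable {p : ℕ} {γ : MulChar (ZMod p) ℂ}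

lemma conj_of_isQuadratic (hγ : γ.IsQuadratic) (x : ZMod p) : (starRingEnd ℂ) (γ x) = γ x := by
  rcases hγ x with h | h | h <;> simp [h]

variable [Fact p.Prime]

lemma sq_of_isQuadratic (hγ : γ.IsQuadratic) {x : ZMod p} (hx : x ≠ 0) : γ x * γ x = 1 := by
  have h0 : γ x ≠ 0 := (hx.isUnit.map γ).ne_zero
  rcases hγ x with h | h | h
  · exact absurd h h0
  · simp [h]
  · simp [h]

lemma eq_of_mul_eq_one (hγ : γ.IsQuadratic) {x y : ZMod p} (hxy : x * y = 1) : γ x = γ y := by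
  have h1 : γ x * γ y = 1 := by rw [← map_mul, hxy, map_one]
  have h2 := sq_of_isQuadratic hγ (right_ne_zero_of_mul_eq_one hxy)
  linear_combination γ y * h1 - γ x * h2

lemma conjChar_eq (hγ : γ.IsQuadratic) (k : iwahoriCover p) :
    conjChar γ k = ((k.1.sgn : ℤ) : ℂ) * γ (residue (k.1.mat 0 0)) := by
  rw [conjChar_apply, genuineChar, map_mul, conj_of_isQuadratic hγ]
  simp

lemma char_diag (hγ : γ.IsQuadratic) {k : SL(2, ℚ_[p])} (hk : k ∈ iwahori p) :
    γ (residue (k 0 0)) = γ (residue (k 1 1)) := by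
  apply eq_of_mul_eq_one hγ
  rw [← residue_mul (hk.1 0 0) (hk.1 1 1)]
  exact residue_eq_one (maxCompact.near (norm_mul_lt_one_right (hk.1 0 1) hk.2))

lemma conjChar_inv_eq (hγ : γ.IsQuadratic) (k : iwahoriCover p) :
    conjChar γ k⁻¹ = conjChar γ k := by
  have h1 := char_mul_inv (conjChar γ) k
  have h2 : conjChar γ k * conjChar γ k = 1 := by
    have hk := (iwahori_diag (k := k.1.mat) k.2).1
    have h0 : residue (k.1.mat 0 0) ≠ 0 := by
      rw [Ne, residue_eq_zero_iff hk.le, hk]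
      exact lt_irrefl _
    have h3 := sq_of_isQuadratic hγ h0
    have h4 : ((k.1.sgn : ℤ) : ℂ) * ((k.1.sgn : ℤ) : ℂ) = 1 := by
      rw [← Int.cast_mul, ← Units.val_mul, sq_one]
      simp
    rw [conjChar_eq hγ]
    linear_combination h3 + γ (residue (k.1.mat 0 0)) * γ (residue (k.1.mat 0 0)) * h4
  exact mul_left_cancel₀ (char_ne_zero _ k) (h1.trans h2.symm)

end QuadraticCharacter

/-! ### Coset representatives and rank one relations for w(1) and w(p⁻¹). -/

section RankOneData

variable {p : ℕ} [Fact p.Prime]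

/-- The element `(w(1), 1)`. -/
def wZero (p : ℕ) [Fact p.Prime] : Mp p := lift (wMat (1 : ℚ_[p]) one_ne_zero)

/-- The element `(w(p⁻¹), 1)`. -/
def wOne (p : ℕ) [Fact p.Prime] : Mp p := lift (wMat (p : ℚ_[p])⁻¹ (inv_ne_zero p_ne))

lemma wMat_one_mem : wMat (1 : ℚ_[p]) one_ne_zero ∈ maxCompact p := wMat_mem (by simp) _

lemma hMat_neg_one_mem : hMat (-1 : ℚ_[p]) (by simp) ∈ iwahori p := hMat_mem_iwahori (by simp) _

lemma xMat_zero : xMat (0 : ℚ_[p]) = 1 := by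
  apply ext_entries <;> simp [xMat]

lemma nMat_zero : nMat (0 : ℚ_[p]) = 1 := by
  apply ext_entries <;> simp [nMat]

lemma xMat_inv (s : ℚ_[p]) : (xMat s)⁻¹ = xMat (-s) := by
  rw [inv_eq_iff_mul_eq_one]
  apply ext_entries <;> rw [mul_entry] <;> simp [xMat]

/-- The elements `(x(b), 1)`, where `b` runs over the residues modulo `p`. -/
def xRep (b : ZMod p) : iwahoriCover p :=
  ⟨lift (xMat (b.val : ℚ_[p])), xMat_mem_iwahori (norm_natCast_le_one _)⟩

lemma norm_p_mul_lt_one {x : ℚ_[p]} (hx : ‖x‖ ≤ 1) : ‖(p : ℚ_[p]) * x‖ < 1 :=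
  norm_mul_lt_one_left Padic.norm_p_lt_one hx

/-- The elements `(n(p b), 1)`, where `b` runs over the residues modulo `p`. -/
def nRep (b : ZMod p) : iwahoriCover p :=
  ⟨lift (nMat ((p : ℚ_[p]) * (b.val : ℚ_[p]))),
    nMat_mem_iwahori (norm_p_mul_lt_one (norm_natCast_le_one _))⟩

lemma inv_mul_conj (g k : SL(2, ℚ_[p])) {t : ℚ_[p]} (ht : t ≠ 0) :
    (g * wMat t ht)⁻¹ * (k * wMat t ht) = (wMat t ht)⁻¹ * (g⁻¹ * k) * wMat t ht := by
  group

lemma wMat_conj_entries (g : SL(2, ℚ_[p])) {t : ℚ_[p]} (ht : t ≠ 0) :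
    ((wMat t ht)⁻¹ * g * wMat t ht) 0 0 = g 1 1 ∧
    ((wMat t ht)⁻¹ * g * wMat t ht) 0 1 = -(t ^ 2 * g 1 0) ∧
    ((wMat t ht)⁻¹ * g * wMat t ht) 1 0 = -(g 0 1 / t ^ 2) ∧
    ((wMat t ht)⁻¹ * g * wMat t ht) 1 1 = g 0 0 := by
  refine ⟨?_, ?_, ?_, ?_⟩ <;> simp only [mul_entry, Matrix.SpecialLinearGroup.coe_inv,
    Matrix.adjugate_fin_two] <;> simp [wMat] <;> field_simp

lemma wMat_conj_mem_iwahori {g : SL(2, ℚ_[p])} {t : ℚ_[p]} (ht : t ≠ 0) :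
    (wMat t ht)⁻¹ * g * wMat t ht ∈ iwahori p ↔
      ‖g 0 0‖ ≤ 1 ∧ ‖g 1 1‖ ≤ 1 ∧ ‖t ^ 2 * g 1 0‖ ≤ 1 ∧ ‖g 0 1 / t ^ 2‖ < 1 := by
  obtain ⟨h00, h01, h10, h11⟩ := wMat_conj_entries g ht
  rw [mem_iwahori]
  simp only [Fin.forall_fin_two, h00, h01, h10, h11, norm_neg]
  constructor
  · rintro ⟨⟨⟨h1, h2⟩, h3, h4⟩, h5⟩
    exact ⟨h4, h1, h2, h5⟩
  · rintro ⟨h1, h2, h3, h4⟩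
    exact ⟨⟨⟨h2, h3⟩, h4.le, h1⟩, h4⟩

lemma xMat_inv_mul_entries (s : ℚ_[p]) (g : SL(2, ℚ_[p])) :
    ((xMat s)⁻¹ * g) 0 0 = g 0 0 - s * g 1 0 ∧ ((xMat s)⁻¹ * g) 0 1 = g 0 1 - s * g 1 1 ∧
    ((xMat s)⁻¹ * g) 1 0 = g 1 0 ∧ ((xMat s)⁻¹ * g) 1 1 = g 1 1 := by
  refine ⟨?_, ?_, ?_, ?_⟩ <;> simp only [mul_entry, Matrix.SpecialLinearGroup.coe_inv,
    Matrix.adjugate_fin_two] <;> simp [xMat] <;> ring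

lemma nMat_inv_mul_entries (v : ℚ_[p]) (g : SL(2, ℚ_[p])) :
    ((nMat v)⁻¹ * g) 0 0 = g 0 0 ∧ ((nMat v)⁻¹ * g) 0 1 = g 0 1 ∧
    ((nMat v)⁻¹ * g) 1 0 = g 1 0 - v * g 0 0 ∧ ((nMat v)⁻¹ * g) 1 1 = g 1 1 - v * g 0 1 := by
  refine ⟨?_, ?_, ?_, ?_⟩ <;> simp only [mul_entry, Matrix.SpecialLinearGroup.coe_inv,
    Matrix.adjugate_fin_two] <;> simp [nMat] <;> ring

lemma norm_sub_le_one {x y : ℚ_[p]} (hx : ‖x‖ ≤ 1) (hy : ‖y‖ ≤ 1) : ‖x - y‖ ≤ 1 := by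
  rw [sub_eq_add_neg]
  exact (Padic.nonarchimedean _ _).trans (max_le hx (by rwa [norm_neg]))

lemma mul_norm_le_one {x y : ℚ_[p]} (hx : ‖x‖ ≤ 1) (hy : ‖y‖ ≤ 1) : ‖x * y‖ ≤ 1 := by
  rw [norm_mul]
  exact mul_le_one₀ hx (norm_nonneg _) hy

variable {γ : MulChar (ZMod p) ℂ}

/-- Conjugation by w(t) exchanges the diagonal entries; as ad ≡ 1 and γ is quadratic, γ(a) = γ(d).
Only the signs remain to be compared. -/
lemma stab_of_sgn_eq (hγ : γ.IsQuadratic) {t : ℚ_[p]} (ht : t ≠ 0) (k k' : iwahoriCover p)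
    (h : (k : Mp p) * lift (wMat t ht) = lift (wMat t ht) * k')
    (hs : k.1.sgn = k'.1.sgn) : conjChar γ k = conjChar γ k' := by
  have hm : k.1.mat * wMat t ht = wMat t ht * k'.1.mat := congrArg Mp.mat h
  have e := (wMat_conj_entries k.1.mat ht).1
  rw [mul_assoc, hm, inv_mul_cancel_left] at e
  have hd := char_diag hγ (k := k.1.mat) k.2
  rw [conjChar_eq hγ, conjChar_eq hγ, hs, e, hd]

/-- The rank one data of `(w(1), 1)`. -/
def rankZero (hγ : γ.IsQuadratic) : RankOne (conjChar γ) (wZero p) (ZMod p) where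
  r := xRep
  base := 0
  c b := γ (-1) * γ b
  z := ⟨lift (hMat (-1) (by simp)), hMat_neg_one_mem⟩
  r_base := by
    apply Subtype.ext
    change lift (xMat ((ZMod.val 0 : ℕ) : ℚ_[p])) = 1
    rw [ZMod.val_zero, Nat.cast_zero, xMat_zero, lift_one]
  char_r b := by
    rw [conjChar_eq hγ]
    simp [xRep, lift, xMat, residue_eq_one]
  sq_eq := by
    change lift _ * lift _ = lift _
    rw [lift_mul wMat_one_mem wMat_one_mem, wMat_mul_wMat]
    exact congrArg lift (hMat_congr (by simp) _)
  inj i j h := by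
    rw [mem_iwahoriCover] at h
    change (xMat _ * wMat 1 one_ne_zero)⁻¹ * (xMat _ * wMat 1 one_ne_zero) ∈ iwahori p at h
    rw [inv_mul_conj, wMat_conj_mem_iwahori, (xMat_inv_mul_entries _ _).2.1] at h
    refine (eq_of_norm_val_sub_lt ?_).symm
    simpa [xMat] using h.2.2.2
  cover s := by
    have hs : s.1.mat ∈ iwahori p := s.2
    have hd := (iwahori_diag hs).2
    have hd0 := ne_zero_of_norm_one hd
    have hy : ‖s.1.mat 0 1 / s.1.mat 1 1‖ ≤ 1 := by
      rw [norm_div, hd, div_one]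
      exact hs.1 0 1
    -- The representative x(β) is chosen so that β ≡ b/d, which brings the upper right entry of
    -- x(β)⁻¹ s into p ℤ_p.
    refine ⟨residue (s.1.mat 0 1 / s.1.mat 1 1), ?_⟩
    rw [mem_iwahoriCover]
    change (xMat _ * wMat 1 one_ne_zero)⁻¹ * (s.1.mat * wMat 1 one_ne_zero) ∈ iwahori p
    have hr := norm_val_residue_sub hy
    set β : ℚ_[p] := ((residue (s.1.mat 0 1 / s.1.mat 1 1)).val : ℚ_[p]) with hβ
    obtain ⟨h00, h01, h10, h11⟩ := xMat_inv_mul_entries β s.1.mat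
    rw [inv_mul_conj, wMat_conj_mem_iwahori, h00, h01, h10, h11]
    refine ⟨norm_sub_le_one (hs.1 0 0) (mul_norm_le_one (norm_natCast_le_one _) (hs.1 1 0)),
      hs.1 1 1, by simpa using hs.1 1 0, ?_⟩
    have e : (s.1.mat 0 1 - β * s.1.mat 1 1) / 1 ^ 2 =
        -((β - s.1.mat 0 1 / s.1.mat 1 1) * s.1.mat 1 1) := by
      field_simp
      ring
    rw [e, norm_neg]
    exact norm_mul_lt_one_left hr hd.le
  stab k k' h := by
    refine stab_of_sgn_eq hγ one_ne_zero k k' h ?_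
    have hs := congrArg Mp.sgn h
    change k.1.sgn * 1 * sigma k.1.mat (wMat 1 one_ne_zero) =
      1 * k'.1.sgn * sigma (wMat 1 one_ne_zero) k'.1.mat at hs
    rwa [sigma_maxCompact (g := k.1.mat) (iwahori_le_maxCompact k.2) wMat_one_mem,
      sigma_maxCompact (h := k'.1.mat) wMat_one_mem (iwahori_le_maxCompact k'.2), mul_one, mul_one, mul_one,
      one_mul] at hs
  opp b hb := by
    have hβ := norm_val_eq_one hb
    have hr := residue_val b
    change ∃ k k' : iwahoriCover p, (wZero p)⁻¹ * (lift (xMat (b.val : ℚ_[p])))⁻¹ * wZero p = _ ∧ _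
    generalize (b.val : ℚ_[p]) = β at hβ hr
    have hβ0 := ne_zero_of_norm_one hβ
    have hi : ‖β⁻¹‖ = 1 := by rw [norm_inv, hβ, inv_one]
    have hi' : ‖-β⁻¹‖ = 1 := by rw [norm_neg, hi]
    have hi0 : -β⁻¹ ≠ 0 := ne_zero_of_norm_one hi'
    have hx := xMat_mem_iwahori hi.le
    have hh := hMat_mem_iwahori hi' hi0
    -- The left side is n(β), and n(β) = x(β⁻¹) h(-β⁻¹) w(1) x(β⁻¹). All factors are integral, so no
    -- signs arise and the character sees only -β⁻¹.
    refine ⟨⟨lift (xMat β⁻¹ * hMat (-β⁻¹) hi0), mul_mem hx hh⟩, ⟨lift (xMat β⁻¹), hx⟩, ?_, ?_⟩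
    · have hx' := iwahori_le_maxCompact hx
      have hh' := iwahori_le_maxCompact hh
      have hβm := xMat_mem hβ.le
      rw [wZero, lift_inv wMat_one_mem, lift_inv hβm, lift_mul (inv_mem wMat_one_mem) (inv_mem hβm),
        lift_mul (mul_mem (inv_mem wMat_one_mem) (inv_mem hβm)) wMat_one_mem,
        lift_mul (mul_mem hx' hh') wMat_one_mem,
        lift_mul (mul_mem (mul_mem hx' hh') wMat_one_mem) hx']
      refine congrArg lift ?_
      rw [xMat_inv, mul_assoc, xMat_mul_wMat, inv_mul_cancel_left]
      apply ext_entries <;> simp only [mul_entry] <;> simp [xMat, nMat, wMat, hMat, hβ0]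
    · rw [conjChar_eq hγ, conjChar_eq hγ]
      have e : residue (-β⁻¹) = -b⁻¹ := by
        have h1 := residue_mul hβ.le hi'.le
        rw [mul_neg, mul_inv_cancel₀ hβ0, residue_neg_one, hr] at h1
        apply mul_left_cancel₀ hb
        rw [← h1, mul_neg, mul_inv_cancel₀ hb]
      have e2 : γ b⁻¹ = γ b := eq_of_mul_eq_one hγ (inv_mul_cancel₀ hb)
      have e3 : (xMat β⁻¹ * hMat (-β⁻¹) hi0) 0 0 = -β⁻¹ := by
        rw [mul_entry]; simp [xMat, hMat]
      simp only [lift]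
      rw [e3, e, ← e2, ← map_mul, neg_one_mul]
      simp [xMat, residue_eq_one]

lemma sFactor_of_one {g : SL(2, ℚ_[p])} (h : g 1 1 = 1) : sFactor g = 1 := by
  rw [sFactor, h, hilb_one_right, ite_self]

lemma sFactor_of_zero {g : SL(2, ℚ_[p])} (h : g 1 0 * g 1 1 = 0) : sFactor g = 1 := by
  rw [sFactor, h, if_neg]
  simp

lemma tau_wMat {t : ℚ_[p]} (ht : t ≠ 0) : tau (wMat t ht) = -t⁻¹ := by
  simp [tau, wMat, ht]

lemma sFactor_wMat {t : ℚ_[p]} (ht : t ≠ 0) : sFactor (wMat t ht) = 1 :=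
  sFactor_of_zero (by simp [wMat])

lemma sFactor_xMat (s : ℚ_[p]) : sFactor (xMat s) = 1 := sFactor_of_one (by simp [xMat])

lemma sFactor_nMat (v : ℚ_[p]) : sFactor (nMat v) = 1 := sFactor_of_one (by simp [nMat])

lemma sFactor_hMat {t : ℚ_[p]} (ht : t ≠ 0) : sFactor (hMat t ht) = 1 :=
  sFactor_of_zero (by simp [hMat])

/-- The cocycle is symmetric for the conjugation by `w(t)`. -/
lemma sigma_wMat_comm {t : ℚ_[p]} (ht : t ≠ 0) {k k' : SL(2, ℚ_[p])} (hk : k ∈ iwahori p)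
    (hk' : k' ∈ iwahori p) (h : k * wMat t ht = wMat t ht * k') :
    sigma k (wMat t ht) = sigma (wMat t ht) k' := by
  have hd := (iwahori_diag hk).2
  have hd' := (iwahori_diag hk').2
  have hd0 := ne_zero_of_norm_one hd
  have e : k' 1 1 = k 0 0 := by
    have := (wMat_conj_entries k ht).2.2.2
    rwa [mul_assoc, h, inv_mul_cancel_left] at this
  have hl := (maxCompact.entry_unit hk.1 hk.2).2.2
  have hc : ∀ x, hilb (k' 1 1) x = hilb (k 1 1) x := by
    intro x
    rw [e]
    exact hilb_congr (iwahori_diag hk).1 hd hl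
  have hq : -t⁻¹ ≠ 0 := neg_ne_zero.2 (inv_ne_zero ht)
  have hT0 : (k * wMat t ht) 1 0 = k 1 1 * -t⁻¹ := by
    rw [mul_entry]; simp [wMat]
  have hT : tau (k * wMat t ht) = k 1 1 * -t⁻¹ := by
    rw [tau_of_ne (by rw [hT0]; exact mul_ne_zero hd0 hq), hT0]
  rw [sigma, sigma, ← h, kub, kub, ← h, hT, tau_wMat, sFactor_wMat, sFactor_of_diag hd,
    sFactor_of_diag hd', hc]
  congr 1
  have ha := tau_ne_zero k
  have ha' := tau_ne_zero k'
  generalize tau k = a at *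
  generalize tau k' = a' at *
  generalize -t⁻¹ = q at *
  generalize k 1 1 = d at *
  have hdd := hilb_unit_unit hd hd
  -- With the s-factors (d, a) and (d, a') included, both sides reduce to (q, d), so the entries
  -- below the diagonal drop out.
  have h1 : hilb (d * q * a) (d * q * q) = hilb q d * hilb a d := by
    rw [mul_assoc d q q, hilb_mul_right _ hd0 (mul_ne_zero hq hq), hilb_mul_self _ hq, mul_one,
      hilb_mul_left _ (mul_ne_zero hd0 hq) ha, hilb_mul_left _ hd0 hq, hdd, one_mul]
  have h2 : hilb (d * q * q) (d * q * a') = hilb q d * hilb a' d := by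
    rw [mul_assoc d q q, hilb_mul_left _ hd0 (mul_ne_zero hq hq), hilb_comm (q * q),
      hilb_mul_self _ hq, mul_one, hilb_mul_right _ (mul_ne_zero hd0 hq) ha',
      hilb_mul_right _ hd0 hq, hdd, one_mul, hilb_comm d, hilb_comm d]
  rw [h1, h2, hilb_comm d a, hilb_comm d a', mul_one, mul_one, mul_assoc, sq_one, mul_assoc,
    sq_one]

lemma valuation_p_mul_unit {u : ℚ_[p]} (hu : ‖u‖ = 1) : (u * (p : ℚ_[p])).valuation = 1 := by
  rw [Padic.valuation_mul (ne_zero_of_norm_one hu) p_ne, valuation_zero_of_norm_one hu,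
    Padic.valuation_p, zero_add]

/-- The inverse of `(n(p b), 1)`, conjugated by `(w(p⁻¹), 1)`. -/
lemma wOne_conj (β : ℚ_[p]) :
    (wOne p)⁻¹ * (lift (nMat ((p : ℚ_[p]) * β)))⁻¹ * wOne p = lift (xMat (β / (p : ℚ_[p]))) := by
  have hp := p_ne (p := p)
  have hp' := inv_ne_zero hp
  have hmat : nMat ((p : ℚ_[p]) * β) * (wMat (p : ℚ_[p])⁻¹ hp' * xMat (β / (p : ℚ_[p]))) =
      wMat (p : ℚ_[p])⁻¹ hp' := by
    apply ext_entries <;> simp only [mul_entry] <;> simp [xMat, nMat, wMat]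
    all_goals field_simp
    all_goals simp
  have ht1 : tau (wMat (p : ℚ_[p])⁻¹ hp' * xMat (β / (p : ℚ_[p]))) = -(p : ℚ_[p]) := by
    have : (wMat (p : ℚ_[p])⁻¹ hp' * xMat (β / (p : ℚ_[p]))) 1 0 = -(p : ℚ_[p]) := by
      rw [mul_entry]; simp [xMat, wMat]
    rw [tau_of_ne (by rw [this]; exact neg_ne_zero.2 hp), this]
  have ht2 : tau (wMat (p : ℚ_[p])⁻¹ hp') = -(p : ℚ_[p]) := by rw [tau_wMat, inv_inv]
  have hnp : -(p : ℚ_[p]) ≠ 0 := neg_ne_zero.2 hp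
  have h1 : sigma (wMat (p : ℚ_[p])⁻¹ hp') (xMat (β / (p : ℚ_[p]))) =
      sFactor (wMat (p : ℚ_[p])⁻¹ hp' * xMat (β / (p : ℚ_[p]))) := by
    rw [sigma, kub, ht1, ht2, hilb_comm, hilb_mul_self _ hnp, sFactor_wMat, sFactor_xMat]
    simp
  have h2 : sigma (nMat ((p : ℚ_[p]) * β)) (wMat (p : ℚ_[p])⁻¹ hp' * xMat (β / (p : ℚ_[p]))) =
      sFactor (wMat (p : ℚ_[p])⁻¹ hp' * xMat (β / (p : ℚ_[p]))) := by
    rw [sigma, kub, hmat, ht1, ht2, hilb_mul_self _ hnp, sFactor_wMat, sFactor_nMat]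
    simp
  -- Both cocycles in this product equal the s-factor of w(p⁻¹) x(β/p), so they cancel.
  have h3 : lift (nMat ((p : ℚ_[p]) * β)) * (wOne p * lift (xMat (β / (p : ℚ_[p])))) = wOne p := by
    rw [wOne, lift, lift, lift, Mp.mul_def, Mp.mul_def]
    simp only [one_mul]
    rw [h1, h2, sq_one, hmat]
  rw [mul_assoc, inv_mul_eq_iff_eq_mul, inv_mul_eq_iff_eq_mul, h3]

/-- The decomposition of `(x(b / p), 1)`. -/
lemma lift_xMat_eq {β : ℚ_[p]} (hβ : ‖β‖ = 1) (hβ0 : β ≠ 0) :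
    lift (xMat (β / (p : ℚ_[p]))) = lift (nMat ((p : ℚ_[p]) * β⁻¹)) * ⟨hMat β hβ0, legUnit β⟩ * wOne p *
      lift (nMat ((p : ℚ_[p]) * β⁻¹)) := by
  have hp := p_ne (p := p)
  have hp' := inv_ne_zero hp
  have hnp : -(p : ℚ_[p]) ≠ 0 := neg_ne_zero.2 hp
  have hβi := inv_ne_zero hβ0
  have hw0 : β * (p : ℚ_[p])⁻¹ ≠ 0 := mul_ne_zero hβ0 hp'
  have hv0 : (p : ℚ_[p]) * β⁻¹ ≠ 0 := mul_ne_zero hp hβi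
  have htw : tau (wMat (β * (p : ℚ_[p])⁻¹) hw0) = -((p : ℚ_[p]) * β⁻¹) := by
    rw [tau_wMat, mul_inv, inv_inv, mul_comm]
  have hval : (-(p : ℚ_[p])).valuation = 1 := by
    have := valuation_p_mul_unit (p := p) (u := -1) (by simp)
    rwa [neg_one_mul] at this
  -- The only nontrivial cocycle in the decomposition: it is (β, -p) = (β/p), which the sign
  -- attached to h(β) compensates.
  have h1 : (⟨hMat β hβ0, legUnit β⟩ : Mp p) * wOne p = lift (wMat (β * (p : ℚ_[p])⁻¹) hw0) := by
    have hσ : sigma (hMat β hβ0) (wMat (p : ℚ_[p])⁻¹ hp') = legUnit β := by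
      have ht : tau (hMat β hβ0) = β⁻¹ := by simp [tau, hMat]
      rw [sigma, kub, tau_h_mul, hMat_mul_wMat, sFactor_hMat, sFactor_wMat, sFactor_wMat, ht,
        tau_wMat, inv_inv, mul_assoc β⁻¹ (-(p : ℚ_[p])) (-(p : ℚ_[p])),
        hilb_mul_right _ hβi (mul_ne_zero hnp hnp), hilb_mul_self _ hnp, mul_comm β⁻¹ (-(p : ℚ_[p])),
        mul_assoc (-(p : ℚ_[p])), hilb_mul_left _ hnp (mul_ne_zero hβi hβi), hilb_comm (β⁻¹ * β⁻¹),
        hilb_mul_self _ hβi, hilb_inv_right _ hβ0, hilb_comm, hilb_unit_left _ hβ, hval]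
      simp
    rw [wOne, lift, lift, Mp.mul_def]
    simp only [mul_one]
    rw [hσ, sq_one, hMat_mul_wMat]
  have hm1 : ∀ j, (nMat ((p : ℚ_[p]) * β⁻¹) * wMat (β * (p : ℚ_[p])⁻¹) hw0) 1 j =
      ![-((p : ℚ_[p]) * β⁻¹), 1] j := by
    intro j
    rw [mul_entry]
    fin_cases j <;> simp [nMat, wMat]
    field_simp
  have ht1 : tau (nMat ((p : ℚ_[p]) * β⁻¹) * wMat (β * (p : ℚ_[p])⁻¹) hw0) =
      -((p : ℚ_[p]) * β⁻¹) := by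
    rw [tau_of_ne (by rw [hm1]; exact neg_ne_zero.2 hv0), hm1]
    rfl
  have htn : tau (nMat ((p : ℚ_[p]) * β⁻¹)) = (p : ℚ_[p]) * β⁻¹ := by
    rw [tau_of_ne (by simpa [nMat] using hv0)]
    simp [nMat]
  have h2 : sigma (nMat ((p : ℚ_[p]) * β⁻¹)) (wMat (β * (p : ℚ_[p])⁻¹) hw0) = 1 := by
    rw [sigma, kub, ht1, htw, hilb_mul_self _ (neg_ne_zero.2 hv0), sFactor_nMat, sFactor_wMat,
      sFactor_of_one (hm1 1)]
    simp
  have hm2 : nMat ((p : ℚ_[p]) * β⁻¹) * wMat (β * (p : ℚ_[p])⁻¹) hw0 * nMat ((p : ℚ_[p]) * β⁻¹) =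
      xMat (β / (p : ℚ_[p])) := by
    apply ext_entries <;> simp only [mul_entry] <;> simp [xMat, nMat, wMat]
    all_goals field_simp
    all_goals simp
  have h3 : sigma (nMat ((p : ℚ_[p]) * β⁻¹) * wMat (β * (p : ℚ_[p])⁻¹) hw0)
      (nMat ((p : ℚ_[p]) * β⁻¹)) = 1 := by
    have htx : tau (xMat (β / (p : ℚ_[p]))) = 1 := by simp [tau, xMat]
    rw [sigma, kub, hm2, ht1, htx, htn, one_mul, one_mul, hilb_comm, hilb_neg_self hv0,
      sFactor_nMat, sFactor_xMat, sFactor_of_one (hm1 1)]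
    simp
  rw [mul_assoc (lift _), h1, lift_mul_lift h2, lift_mul_lift h3, hm2]

/-- The rank one data of `(w(p⁻¹), 1)`. -/
def rankOne (hγ : γ.IsQuadratic) : RankOne (conjChar γ) (wOne p) (ZMod p) where
  r := nRep
  base := 0
  c b := ((quadraticChar (ZMod p) b : ℤ) : ℂ) * γ b
  z := ⟨⟨hMat (-1) (by simp), legUnit (-1 : ℚ_[p])⟩, hMat_neg_one_mem⟩
  r_base := by
    apply Subtype.ext
    change lift (nMat ((p : ℚ_[p]) * ((ZMod.val 0 : ℕ) : ℚ_[p]))) = 1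
    rw [ZMod.val_zero, Nat.cast_zero, mul_zero, nMat_zero, lift_one]
  char_r b := by
    rw [conjChar_eq hγ]
    simp [nRep, lift, nMat, residue_eq_one]
  sq_eq := by
    have hp' := inv_ne_zero (p_ne (p := p))
    have hnp : -(p : ℚ_[p]) ≠ 0 := neg_ne_zero.2 p_ne
    have hm : wMat (p : ℚ_[p])⁻¹ hp' * wMat (p : ℚ_[p])⁻¹ hp' = hMat (-1) (by simp) := by
      rw [wMat_mul_wMat]
      exact hMat_congr (by rw [div_self hp']) _
    have hτ : tau (hMat (-1 : ℚ_[p]) (by simp)) = -1 := by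
      rw [tau_of_eq (by simp [hMat])]
      simp [hMat]
    -- The symbol is (p, p) = (-1, p) = (-1/p); this is the sign in w(p⁻¹)².
    have hσ : sigma (wMat (p : ℚ_[p])⁻¹ hp') (wMat (p : ℚ_[p])⁻¹ hp') = legUnit (-1 : ℚ_[p]) := by
      rw [sigma, kub, hm, hτ, tau_wMat, inv_inv, sFactor_wMat, sFactor_hMat, neg_one_mul, neg_neg,
        hilb_self rfl p_ne, hilb_unit_left _ (by simp), Padic.valuation_p]
      simp
    change lift _ * lift _ = _
    rw [lift, Mp.mul_def]
    simp only [one_mul]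
    rw [hσ, hm]
  inj i j h := by
    have hp := p_ne (p := p)
    rw [mem_iwahoriCover] at h
    change (nMat _ * wMat (p : ℚ_[p])⁻¹ (inv_ne_zero hp))⁻¹ *
      (nMat _ * wMat (p : ℚ_[p])⁻¹ (inv_ne_zero hp)) ∈ iwahori p at h
    rw [inv_mul_conj, wMat_conj_mem_iwahori, (nMat_inv_mul_entries _ _).2.2.1] at h
    refine (eq_of_norm_val_sub_lt ?_).symm
    have h3 := h.2.2.1
    rw [← norm_div_p_le_one_iff]
    convert h3 using 2
    simp [nMat]
    field_simp
  cover s := by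
    have hp := p_ne (p := p)
    have hs : s.1.mat ∈ iwahori p := s.2
    have ha := (iwahori_diag hs).1
    have ha0 := ne_zero_of_norm_one ha
    have hy : ‖s.1.mat 1 0 / s.1.mat 0 0 / p‖ ≤ 1 := by
      rw [norm_div_p_le_one_iff, norm_div, ha, div_one]
      exact hs.2
    -- Conjugation by w(p⁻¹) divides the lower left entry by p², so n(pβ) must cancel c modulo p²;
    -- hence β ≡ c/(ap).
    refine ⟨residue (s.1.mat 1 0 / s.1.mat 0 0 / (p : ℚ_[p])), ?_⟩
    rw [mem_iwahoriCover]
    change (nMat _ * wMat (p : ℚ_[p])⁻¹ (inv_ne_zero hp))⁻¹ *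
      (s.1.mat * wMat (p : ℚ_[p])⁻¹ (inv_ne_zero hp)) ∈ iwahori p
    have hr := norm_val_residue_sub hy
    have hβ1 := norm_natCast_le_one (p := p) (residue (s.1.mat 1 0 / s.1.mat 0 0 / (p : ℚ_[p]))).val
    set β : ℚ_[p] := ((residue (s.1.mat 1 0 / s.1.mat 0 0 / (p : ℚ_[p]))).val : ℚ_[p]) with hβ
    obtain ⟨h00, h01, h10, h11⟩ := nMat_inv_mul_entries ((p : ℚ_[p]) * β) s.1.mat
    rw [inv_mul_conj, wMat_conj_mem_iwahori, h00, h01, h10, h11]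
    have hpβ := norm_p_mul_lt_one hβ1
    refine ⟨hs.1 0 0, norm_sub_le_one (hs.1 1 1) (mul_norm_le_one hpβ.le (hs.1 0 1)), ?_, ?_⟩
    · have e : (p : ℚ_[p])⁻¹ ^ 2 * (s.1.mat 1 0 - (p : ℚ_[p]) * β * s.1.mat 0 0) =
          -((β - s.1.mat 1 0 / s.1.mat 0 0 / (p : ℚ_[p])) * s.1.mat 0 0) / p := by
        field_simp
        ring
      rw [e, norm_div_p_le_one_iff, norm_neg]
      exact norm_mul_lt_one_left hr ha.le
    · have e : s.1.mat 0 1 / (p : ℚ_[p])⁻¹ ^ 2 = p * (p * s.1.mat 0 1) := by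
        field_simp
      rw [e]
      exact norm_p_mul_lt_one (norm_p_mul_lt_one (hs.1 0 1)).le
  stab k k' h := by
    have hp := p_ne (p := p)
    refine stab_of_sgn_eq hγ (inv_ne_zero hp) k k' h ?_
    have hm : k.1.mat * wMat (p : ℚ_[p])⁻¹ (inv_ne_zero hp) =
      wMat (p : ℚ_[p])⁻¹ (inv_ne_zero hp) * k'.1.mat := congrArg Mp.mat h
    have hs := congrArg Mp.sgn h
    change k.1.sgn * 1 * sigma k.1.mat (wMat (p : ℚ_[p])⁻¹ (inv_ne_zero hp)) =
      1 * k'.1.sgn * sigma (wMat (p : ℚ_[p])⁻¹ (inv_ne_zero hp)) k'.1.mat at hs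
    rw [sigma_wMat_comm (inv_ne_zero hp) (k := k.1.mat) k.2 k'.2 hm, mul_one, one_mul] at hs
    exact mul_right_cancel hs
  opp b hb := by
    have hβ := norm_val_eq_one hb
    have hr := residue_val b
    change ∃ k k' : iwahoriCover p,
      (wOne p)⁻¹ * (lift (nMat ((p : ℚ_[p]) * (b.val : ℚ_[p]))))⁻¹ * wOne p = _ ∧ _
    generalize (b.val : ℚ_[p]) = β at hβ hr
    have hβ0 := ne_zero_of_norm_one hβ
    have hn : ‖(p : ℚ_[p]) * β⁻¹‖ < 1 := norm_p_mul_lt_one (by rw [norm_inv, hβ, inv_one])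
    let n : iwahoriCover p := ⟨lift (nMat ((p : ℚ_[p]) * β⁻¹)), nMat_mem_iwahori hn⟩
    let k : iwahoriCover p := ⟨⟨hMat β hβ0, legUnit β⟩, hMat_mem_iwahori hβ hβ0⟩
    have hχn : conjChar γ n = 1 := by
      rw [conjChar_eq hγ]
      simp [n, lift, nMat, residue_eq_one]
    -- The unipotent factors have trivial character; the middle one contributes (b/p) from its sign
    -- and γ(b) from its entry.
    refine ⟨n * k, n, ?_, ?_⟩
    · rw [wOne_conj, lift_xMat_eq hβ hβ0]
      rfl
    · rw [map_mul, hχn, one_mul, mul_one, conjChar_eq hγ, ← hr, ← legUnit_coe_of_norm_one hβ]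
      simp [k, hMat]

end RankOneData

/-! ### Normalisation of the generators and evaluation of the coefficients. -/

section Main

variable {p : ℕ} [Fact p.Prime]

lemma wElt_zero : wElt p 0 = wZero p := by
  have h : (p : ℚ_[p]) ^ (-(0 : ℤ)) = 1 := by simp
  exact congrArg lift (wMat_congr h _)

lemma wElt_one : wElt p 1 = wOne p :=
  congrArg lift (wMat_congr (zpow_neg_one _) _)

lemma isHeckeU_doubleCosetFun {γ : MulChar (ZMod p) ℂ} {w : Mp p} {ι : Type*} {n : ℤ}
    (R : RankOne (conjChar γ) w ι) (hw : wElt p n = w) {lam : ℂ}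
    (hlam : lam = (starRingEnd ℂ) (gammaW ((p : ℚ_[p]) ^ (-n)))) :
    IsHeckeU γ n (doubleCosetFun (conjChar γ) w lam) := by
  subst hw hlam
  exact ⟨fun k hk k' hk' => R.doubleCosetFun_apply _ ⟨k, hk⟩ ⟨k', hk'⟩,
    fun g hg => doubleCosetFun_of_forall_ne fun k k' => hg k k.2 k' k'.2⟩

lemma conj_gammaW_zero : (starRingEnd ℂ) (gammaW ((p : ℚ_[p]) ^ (-(0 : ℤ)))) = 1 := by
  simp [gammaW]

lemma quadraticChar_neg_one_of_mod (hp : p ≠ 2) :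
    quadraticChar (ZMod p) (-1) = if p % 4 = 1 then 1 else -1 := by
  have hodd : p % 2 = 1 := (Fact.out : p.Prime).eq_two_or_odd.resolve_left hp
  rw [quadraticChar_neg_one (by rwa [ZMod.ringChar_zmod_n]), ZMod.card]
  split_ifs with h
  · exact ZMod.χ₄_nat_one_mod_four h
  · exact ZMod.χ₄_nat_three_mod_four (by omega)

/-- This cancels the sign (-1/p) of w(p⁻¹)² in the constant term of the second relation. -/
lemma epsilonP_sq (hp : p ≠ 2) :
    epsilonP p ^ 2 = ((quadraticChar (ZMod p) (-1) : ℤ) : ℂ) := by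
  rw [quadraticChar_neg_one_of_mod hp, epsilonP]
  split_ifs <;> simp

lemma epsilonP_ne_zero (p : ℕ) : epsilonP p ≠ 0 := by
  rw [epsilonP]
  split_ifs <;> simp

/-- For p ≡ 3 modulo 4 the conjugation and the factor (-1/p) = -1 each change the sign of i; for p ≡
1 both are harmless. -/
lemma conj_gammaW_one (hp : p ≠ 2) :
    (starRingEnd ℂ) (gammaW ((p : ℚ_[p]) ^ (-(1 : ℤ)))) = epsilonP p := by
  have hv : ((p : ℚ_[p]) ^ (-(1 : ℤ))).valuation = -1 := by
    rw [zpow_neg_one, Padic.valuation_inv, Padic.valuation_p]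
  have hl : legUnit (-(p : ℚ_[p]) ^ (-(1 : ℤ))) = legUnit (-1 : ℚ_[p]) := by
    have hu : unitPart ((p : ℚ_[p]) ^ (-(1 : ℤ))) = 1 := by
      rw [unitPart, hv, neg_neg, zpow_one, zpow_neg_one, inv_mul_cancel₀ p_ne]
    have h1 : legUnit ((p : ℚ_[p]) ^ (-(1 : ℤ))) = 1 := by
      rw [legUnit, hu]
      simp [residue_eq_one]
    rw [← neg_one_mul, legUnit_mul (by simp) (zpow_ne_zero _ p_ne), h1, mul_one]
  rw [gammaW, hv, if_neg (by decide), hl, legUnit_coe_of_norm_one (by simp), residue_neg_one,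
    quadraticChar_neg_one_of_mod hp, epsilonP]
  split_ifs <;> simp

lemma notMem_iwahori_wMat {t : ℚ_[p]} (ht : t ≠ 0) : wMat t ht ∉ iwahori p := by
  intro h
  have := (iwahori_diag h).1
  simp [wMat] at this

/-- A multiplicative character vanishes at 0, so the base index may be restored and complete
character sums appear. -/
lemma sum_erase_zero_char (γ : MulChar (ZMod p) ℂ) (f : ZMod p → ℂ) :
    ∑ b ∈ Finset.univ.erase (0 : ZMod p), f b * γ b = ∑ b, f b * γ b := by
  refine Finset.sum_erase _ ?_
  rw [MulChar.map_zero, mul_zero]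

/-- The presentation of the Hecke algebra for a quadratic character. -/
theorem hasPresentation_of_isQuadratic (hp : p ≠ 2) {μ : Measure (Mp p)} [μ.IsHaarMeasure]
    (hμ : μ (iwahoriCover p : Set (Mp p)) = 1) {γ : MulChar (ZMod p) ℂ} (hγ : γ.IsQuadratic)
    {a b : Fin 2 → ℂ} (ha0 : a 0 = γ (-1) * ∑ x, γ x)
    (ha1 : a 1 = epsilonP p * ∑ x, ((quadraticChar (ZMod p) x : ℤ) : ℂ) * γ x)
    (hb0 : b 0 = γ (-1) * p) (hb1 : b 1 = γ (-1) * p) : HasPresentation μ γ a b := by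
  let lam : Fin 2 → ℂ := ![1, epsilonP p]
  have hlam : ∀ i, lam i ≠ 0 := by
    intro i
    fin_cases i
    · exact one_ne_zero
    · exact epsilonP_ne_zero p
  have hz0 : conjChar γ (rankZero hγ).z⁻¹ = γ (-1) := by
    rw [conjChar_inv_eq hγ, conjChar_eq hγ]
    simp [rankZero, lift, hMat, residue_neg_one]
  have hz1 : conjChar γ (rankOne hγ).z⁻¹ =
      ((quadraticChar (ZMod p) (-1) : ℤ) : ℂ) * γ (-1) := by
    rw [conjChar_inv_eq hγ, conjChar_eq hγ, ← residue_neg_one,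
      ← legUnit_coe_of_norm_one (x := (-1 : ℚ_[p])) (by simp)]
    simp [rankOne, hMat]
  obtain ⟨Φ, h0, h1⟩ := (dihedralCosets p).exists_algEquiv (rankZero hγ) (rankOne hγ) hlam
    (notMem_iwahori_wMat one_ne_zero) (notMem_iwahori_wMat (inv_ne_zero p_ne)) (a := a) (b := b)
    (by
      change a 0 = 1 * ∑ i ∈ Finset.univ.erase (0 : ZMod p), γ (-1) * γ i
      rw [sum_erase_zero_char, ha0, one_mul, Finset.mul_sum])
    (by
      change a 1 = epsilonP p * ∑ i ∈ Finset.univ.erase (0 : ZMod p), _ * γ i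
      rw [sum_erase_zero_char, ha1])
    (by
      rw [hz0, ZMod.card, hb0]
      change _ = p * (1 : ℂ) ^ 2 * γ (-1)
      ring)
    (by
      rw [hz1, ZMod.card, hb1]
      change _ = p * epsilonP p ^ 2 * _
      rw [epsilonP_sq hp]
      have : ((quadraticChar (ZMod p) (-1) : ℤ) : ℂ) * ((quadraticChar (ZMod p) (-1) : ℤ) : ℂ) =
          1 := by
        rw [← Int.cast_mul, ← map_mul]
        simp
      linear_combination (-(p : ℂ) * γ (-1)) * this)
  have hmod : heckeModule (conjChar γ) = heckeSpace γ := by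
    ext f
    exact mem_heckeSpace_iff.symm
  refine ⟨Φ.toLinearEquiv.trans (LinearEquiv.ofEq _ _ hmod), fun x y => ?_, ?_, ?_, ?_⟩
  · change (Φ (x * y)).1 = conv μ (Φ x).1 (Φ y).1
    rw [map_mul, conv_eq_cosetConv hμ (Φ x).2 (Φ y).2]
    rfl
  · change (Φ 1).1 = heckeOne γ
    rw [map_one, heckeOne_eq_unitFun]
    rfl
  · change IsHeckeU γ 0 (Φ (QuadAlg.gen a b 0)).1
    rw [h0]
    exact isHeckeU_doubleCosetFun (rankZero hγ) wElt_zero conj_gammaW_zero.symm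
  · change IsHeckeU γ 1 (Φ (QuadAlg.gen a b 1)).1
    rw [h1]
    exact isHeckeU_doubleCosetFun (rankOne hγ) wElt_one (conj_gammaW_one hp).symm

lemma sum_trivial_char (p : ℕ) [Fact p.Prime] :
    ∑ x : ZMod p, (1 : MulChar (ZMod p) ℂ) x = (p : ℂ) - 1 := by
  rw [MulChar.sum_one_eq_card_units, ZMod.card_units,
    Nat.cast_sub (Fact.out : p.Prime).one_lt.le, Nat.cast_one]

lemma sum_quadraticChar (hp : p ≠ 2) :
    ∑ x : ZMod p, ((quadraticChar (ZMod p) x : ℤ) : ℂ) = 0 := by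
  rw [← Int.cast_sum, quadraticChar_sum_zero (by rwa [ZMod.ringChar_zmod_n]), Int.cast_zero]

end Main

end

end MetaSL2

open MeasureTheory MetaSL2 in
theorem theorem2 (p : ℕ) [Fact p.Prime] (hp : p ≠ 2)
    (μ : Measure (Mp p)) [μ.IsHaarMeasure] (hμ : μ (iwahoriCover p : Set (Mp p)) = 1) :
    HasPresentation μ (1 : MulChar (ZMod p) ℂ)
      ![(p : ℂ) - 1, 0]
      ![(p : ℂ), (p : ℂ)] ∧
    HasPresentation μ (legendreChar p)
      ![0, epsilonP p * ((p : ℂ) - 1)]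
      ![(legendreSym p (-1) : ℂ) * p, (legendreSym p (-1) : ℂ) * p] := by
  -- The trivial character takes the value 0 at 0, so it is a unit for multiplication only on
  -- functions vanishing there.
  have hone : ∀ f : ZMod p → ℂ, f 0 = 0 → ∀ x, f x * (1 : MulChar (ZMod p) ℂ) x = f x := by
    intro f hf x
    by_cases hx : x = 0
    · rw [hx, hf, zero_mul]
    · rw [MulChar.one_apply (IsUnit.mk0 x hx), mul_one]
  have hone' : (1 : MulChar (ZMod p) ℂ) (-1) = 1 := MulChar.one_apply isUnit_one.neg
  have hleg : ∀ x, legendreChar p x = ((quadraticChar (ZMod p) x : ℤ) : ℂ) := fun x => rfl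
  have hneg : ((legendreSym p (-1) : ℤ) : ℂ) = legendreChar p (-1) := by
    rw [hleg, legendreSym]
    simp
  constructor
  · refine hasPresentation_of_isQuadratic hp hμ ?_ ?_ ?_ ?_ ?_
    · intro x
      by_cases hx : x = 0
      · exact Or.inl (hx ▸ MulChar.map_zero _)
      · exact Or.inr (Or.inl (MulChar.one_apply (IsUnit.mk0 x hx)))
    · rw [hone', one_mul, sum_trivial_char]
      rfl
    · simp only [hone (fun x => ((quadraticChar (ZMod p) x : ℤ) : ℂ)) (by simp)]
      rw [sum_quadraticChar hp, mul_zero]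
      rfl
    · rw [hone', one_mul]
      rfl
    · rw [hone', one_mul]
      rfl
  · refine hasPresentation_of_isQuadratic hp hμ ?_ ?_ ?_ ?_ ?_
    · intro x
      rw [hleg]
      rcases quadraticChar_isQuadratic (ZMod p) x with h | h | h <;> simp [h]
    · simp only [hleg]
      rw [sum_quadraticChar hp, mul_zero]
      rfl
    -- The square of the Legendre character is the trivial character, including the value 0 at 0, so
    -- the sum is p - 1.
    · have h : ∀ x, ((quadraticChar (ZMod p) x : ℤ) : ℂ) * legendreChar p x =
          (1 : MulChar (ZMod p) ℂ) x := by
        intro x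
        rw [hleg, ← Int.cast_mul]
        by_cases hx : x = 0
        · rw [hx, MulChar.map_zero, MulChar.map_zero]
          simp
        · rw [MulChar.one_apply (IsUnit.mk0 x hx), ← sq, quadraticChar_sq_one hx, Int.cast_one]
      simp only [h]
      rw [sum_trivial_char]
      rfl
    · rw [← hneg]
      rfl
    · rw [← hneg]
      rfl
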